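/- **Setting.** Let $n\ge 0$ and let $\lambda$ be a partition with $|\lambda|=n$, identified with its Young diagram in English notation; the content of the box $\square$ in row $r$ and column $s$ is $c(\square)=s-r$. All algebras are over $\mathbb{Q}(q,t)$. *Tableaux.* Order the formal products $jq^b$ ($1\le j\le n$, $b\ge 0$) by $jq^m<kq^\ell$ iff $m>\ell$, or $m=\ell$ and $j<k$. $\mathrm{PSYT}(\lambda)$ is the set of labellings $\tau$ of the boxes of $\lambda$ by such products, strictly increasing along rows and columns, in which each $1\le j\le n$ occurs in exactly one box. $\mathrm{SYT}(\lambda)\subset\mathrm{PSYT}(\lambda)$ is the set of standard Young tableaux (all exponents $b$ equal to $0$). If $\tau(\square)=iq^b$, put $w_\tau(i)=b$ and $c_\tau(i)=c(\square)$. For $1\le i\le n-1$, $s_i(\tau)$ is the labelling obtained by exchanging $i$ and $i+1$ and leaving the exponent in each box unchanged; it is defined if the result is in $\mathrm{PSYT}(\lambda)$. $\Psi(\tau)$ is obtained by replacing each label $kq^a$ with $k\ge2$ by $(k-1)q^a$, and $1q^a$ by $nq^{a+1}$. Let $<$ be the order generated by $\tau<\Psi(\tau)$, by $\tau<s_i(\tau)$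 if $w_\tau(i)<w_\tau(i+1)$, and by $\tau<s_i(\tau)$ if $w_\tau(i)=w_\tau(i+1)$, $c_\tau(i)-c_\tau(i+1)>1$. *Algebras.* $\mathcal{H}_n$ is generated by $T_1,\dots,T_{n-1}$ with $(T_i-1)(T_i+t)=0$, $T_iT_{i+1}T_i=T_{i+1}T_iT_{i+1}$, and $T_iT_j=T_jT_i$ for $|i-j|>1$. $\mathcal{A}_n$ is generated by $T_1,\dots,T_{n-1},\theta_1,\dots,\theta_n$ with the relations of $\mathcal{H}_n$, $\theta_i\theta_j=\theta_j\theta_i$, $\theta_{i+1}=tT_i^{-1}\theta_iT_i^{-1}$, and $T_i\theta_j=\theta_jT_i$ for $j\notin\{i,i+1\}$; for $n\ge 1$ put $\pi_n=t^{n-1}\theta_1T_1^{-1}\cdots T_{n-1}^{-1}$. $\mathcal{D}_n$ is generated by $T_i,\theta_i$ and $X_1,\dots,X_n$ with the relations of $\mathcal{A}_n$, $X_iX_j=X_jX_i$, $X_{i+1}=tT_i^{-1}X_iT_i^{-1}$, $T_iX_j=X_jT_i$ for $j\notin\{i,i+1\}$, $\pi_nX_i=X_{i+1}\pi_n$ for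 $1\le i\le n-1$, and $\pi_nX_n=qX_1\pi_n$. In $\mathcal{H}_n$ put $\overline\theta_1=1$, $\overline\theta_{i+1}=tT_i^{-1}\overline\theta_iT_i^{-1}$ and $\overline\varphi_i=(tT_i^{-1})\overline\theta_i-\overline\theta_i(tT_i^{-1})$; there is an algebra map $\rho_n:\mathcal{A}_n\to\mathcal{H}_n$ with $T_i\mapsto T_i$, $\theta_i\mapsto\overline\theta_i$. *Modules.* Let $\lambda$ also denote the $\mathcal{H}_n$-module generated by the $\tau\in\mathrm{SYT}(\lambda)$ with relations $\overline\theta_i(\tau)=t^{c_\tau(i)}\tau$; $\overline\varphi_i(\tau)=(t^{c_\tau(i)}-t^{c_\tau(i+1)})s_i(\tau)$ if $s_i(\tau)>\tau$; $T_i(\tau)=\tau$ if $i,i+1$ lie in the same row of $\tau$; and $T_i(\tau)=-t\tau$ if they lie in the same column. Let $V_\lambda=\mathrm{Ind}_{\mathcal{A}_n}^{\mathcal{D}_n}\rho_n^*(\lambda)=\mathcal{D}_n\otimes_{\mathcal{A}_n}\rho_n^*(\lambda)$. **Proposition.** There is a $\mathbb{Q}(q,t)$-basis $\{F_\tau:\tau\in\mathrm{PSYT}(\lambda)\}$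 of $V_\lambda$ such that: 1. $\theta_i(F_\tau)=q^{w_\tau(i)}t^{c_\tau(i)}F_\tau$ for all $\tau\in\mathrm{PSYT}(\lambda)$, $1\le i\le n$, and distinct $\tau$ have distinct weights $(q^{w_\tau(i)}t^{c_\tau(i)})_{1\le i\le n}$; 2. $F_\tau=1\otimes\tau$ for $\tau\in\mathrm{SYT}(\lambda)$; 3. if $s_i(\tau)>\tau$, then $$\left(tT_i^{-1}+\frac{(t-1)q^{w_\tau(i+1)}t^{c_\tau(i+1)}}{q^{w_\tau(i)}t^{c_\tau(i)}-q^{w_\tau(i+1)}t^{c_\tau(i+1)}}\right)F_\tau=F_{s_i(\tau)};$$ 4. if $n\ge1$, then $\pi_n$ acts invertibly on $V_\lambda$, and $F_{\Psi(\tau)}=q^{w_\tau(1)}X_n\pi_n^{-1}F_\tau$ for all $\tau\in\mathrm{PSYT}(\lambda)$. -/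

import Mathlib

namespace VVMac

noncomputable section

/-! ### The base field `ℚ(q,t)` -/

/-- The field `ℚ(q,t)` of rational functions in two independent variables. -/
def K : Type := FractionRing (MvPolynomial (Fin 2) ℚ)

instance : Field K := inferInstanceAs (Field (FractionRing (MvPolynomial (Fin 2) ℚ)))

instance : Algebra (MvPolynomial (Fin 2) ℚ) K :=
  inferInstanceAs (Algebra (MvPolynomial (Fin 2) ℚ) (FractionRing (MvPolynomial (Fin 2) ℚ)))

instance : IsFractionRing (MvPolynomial (Fin 2) ℚ) K :=
  inferInstanceAs (IsFractionRing (MvPolynomial (Fin 2) ℚ) (FractionRing (MvPolynomial (Fin 2) ℚ)))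

def q : K := algebraMap (MvPolynomial (Fin 2) ℚ) K (MvPolynomial.X 0)

def t : K := algebraMap (MvPolynomial (Fin 2) ℚ) K (MvPolynomial.X 1)

theorem t_ne_zero : t ≠ 0 := by
  unfold t
  rw [Ne, IsFractionRing.to_map_eq_zero_iff]
  exact MvPolynomial.X_ne_zero 1

/-! ### Tableaux

Indices are zero-based: `k : Fin n` stands for the label `k + 1`, and `i : Fin (n - 1)` stands
for the index `i + 1` of a simple transposition. `lo i` and `hi i` are `i` and `i + 1` in `Fin n`. -/

def lo {n : ℕ} (i : Fin (n - 1)) : Fin n := ⟨i.1, by omega⟩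

def hi {n : ℕ} (i : Fin (n - 1)) : Fin n := ⟨i.1 + 1, by omega⟩

/-- The pair `(j, m)` is the formal product `j q^m`; `j q^m < k q^l` if `m > l`, or `m = l` and
`j < k`. -/
def LabelLt {n : ℕ} (x y : Fin n × ℕ) : Prop := y.2 < x.2 ∨ (x.2 = y.2 ∧ x.1 < y.1)

/-- Non-negative periodic standard Young tableaux of shape `μ`. A cell is `(row, column)`. -/
@[ext] structure PSYT (n : ℕ) (μ : YoungDiagram) where
  label : μ.cells → Fin n × ℕ
  bij : Function.Bijective (fun b => (label b).1)
  row_lt : ∀ b b' : μ.cells, b.1.1 = b'.1.1 → b.1.2 < b'.1.2 → LabelLt (label b) (label b')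
  col_lt : ∀ b b' : μ.cells, b.1.2 = b'.1.2 → b.1.1 < b'.1.1 → LabelLt (label b) (label b')

/-- Standard Young tableaux of shape `μ`. -/
@[ext] structure SYT (n : ℕ) (μ : YoungDiagram) where
  label : μ.cells → Fin n
  bij : Function.Bijective label
  row_lt : ∀ b b' : μ.cells, b.1.1 = b'.1.1 → b.1.2 < b'.1.2 → label b < label b'
  col_lt : ∀ b b' : μ.cells, b.1.2 = b'.1.2 → b.1.1 < b'.1.1 → label b < label b'

/-- The inclusion of standard into periodic standard tableaux, `j ↦ j q^0`. -/
def SYT.toPSYT {n : ℕ} {μ : YoungDiagram} (τ : SYT n μ) : PSYT n μ where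
  label b := (τ.label b, 0)
  bij := τ.bij
  row_lt b b' h h' := Or.inr ⟨rfl, τ.row_lt b b' h h'⟩
  col_lt b b' h h' := Or.inr ⟨rfl, τ.col_lt b b' h h'⟩

/-- The content of a cell: column minus row. -/
def content (b : ℕ × ℕ) : ℤ := (b.2 : ℤ) - (b.1 : ℤ)

namespace PSYT

variable {n : ℕ} {μ : YoungDiagram}

/-- The cell whose label is `i q^b` for some `b`. -/
def box (τ : PSYT n μ) (i : Fin n) : μ.cells := (Equiv.ofBijective _ τ.bij).symm i

/-- `w_τ(i) = b` when `i q^b` is a label of `τ`. -/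
def w (τ : PSYT n μ) (i : Fin n) : ℕ := (τ.label (τ.box i)).2

/-- `c_τ(i)` is the content of the cell labelled `i q^b`. -/
def c (τ : PSYT n μ) (i : Fin n) : ℤ := content (τ.box i).1

/-- `q^{w_τ(i)} t^{c_τ(i)}` -/
def weight (τ : PSYT n μ) (i : Fin n) : K := q ^ τ.w i * t ^ τ.c i

/-- `IsSwap i τ σ` says that `s_i(τ)` is defined (lies in `PSYT`) and equals `σ`. -/
def IsSwap (i : Fin (n - 1)) (τ σ : PSYT n μ) : Prop :=
  ∀ b, σ.label b = (Equiv.swap (lo i) (hi i) (τ.label b).1, (τ.label b).2)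

/-- The effect of `Ψ` on labels: `k q^a ↦ (k-1) q^a` if `k ≥ 2` and `1 q^a ↦ n q^{a+1}`. -/
def shiftLabel (x : Fin n × ℕ) : Fin n × ℕ :=
  if x.1.1 = 0 then (⟨n - 1, by have := x.1.2; omega⟩, x.2 + 1)
  else (⟨x.1.1 - 1, by have := x.1.2; omega⟩, x.2)

theorem shiftLabel_lt {x y : Fin n × ℕ} (h : LabelLt x y) :
    LabelLt (shiftLabel x) (shiftLabel y) := by
  obtain ⟨⟨a, ha⟩, m⟩ := x
  obtain ⟨⟨b, hb⟩, l⟩ := y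
  unfold LabelLt shiftLabel at *
  simp only [Fin.lt_def] at *
  split_ifs <;> simp only [] <;> omega

theorem shiftLabel_fst_inj {x y : Fin n × ℕ} (h : (shiftLabel x).1 = (shiftLabel y).1) :
    x.1 = y.1 := by
  obtain ⟨⟨a, ha⟩, m⟩ := x
  obtain ⟨⟨b, hb⟩, l⟩ := y
  unfold shiftLabel at h
  simp only [Fin.mk.injEq] at *
  split_ifs at h <;> simp only [Fin.mk.injEq] at h <;> omega

def Psi (τ : PSYT n μ) : PSYT n μ where
  label b := shiftLabel (τ.label b)
  bij := by
    have hinj : Function.Injective (fun b => (shiftLabel (τ.label b)).1) :=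
      fun b b' h => τ.bij.1 (shiftLabel_fst_inj h)
    exact (Fintype.bijective_iff_injective_and_card _).2
      ⟨hinj, Fintype.card_of_bijective τ.bij⟩
  row_lt b b' h h' := shiftLabel_lt (τ.row_lt b b' h h')
  col_lt b b' h h' := shiftLabel_lt (τ.col_lt b b' h h')

/-- The cover relations: `Cover τ σ` makes `σ` larger than `τ`. -/
inductive Cover : PSYT n μ → PSYT n μ → Prop
  | psi (τ : PSYT n μ) : Cover τ τ.Psi
  | swap_of_lt (i : Fin (n - 1)) (τ σ : PSYT n μ) (h : IsSwap i τ σ)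
      (hw : τ.w (lo i) < τ.w (hi i)) : Cover τ σ
  | swap_of_eq (i : Fin (n - 1)) (τ σ : PSYT n μ) (h : IsSwap i τ σ)
      (hw : τ.w (lo i) = τ.w (hi i)) (hc : 1 < τ.c (lo i) - τ.c (hi i)) : Cover τ σ

/-- The strict order `τ < σ` generated by the cover relations. -/
def Lt (τ σ : PSYT n μ) : Prop := Relation.TransGen Cover τ σ

end PSYT

/-! ### The algebras -/

section Relations

variable {n : ℕ} {A : Type} [Ring A] [Algebra K A]

/-- `t T_i⁻¹`; by the quadratic relation `(T_i - 1)(T_i + t) = 0` it is `T_i + t - 1`. -/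
def tTinv (T : Fin (n - 1) → A) (i : Fin (n - 1)) : A := T i + algebraMap K A (t - 1)

/-- `T_i⁻¹` -/
def Tinv (T : Fin (n - 1) → A) (i : Fin (n - 1)) : A := t⁻¹ • tTinv T i

/-- The defining relations of the finite Hecke algebra. -/
inductive HeckeRel (T : Fin (n - 1) → A) : A → A → Prop
  | quad (i : Fin (n - 1)) : HeckeRel T ((T i - 1) * (T i + algebraMap K A t)) 0
  | braid (i j : Fin (n - 1)) (h : i.1 + 1 = j.1) :
      HeckeRel T (T i * T j * T i) (T j * T i * T j)
  | comm (i j : Fin (n - 1)) (h : i.1 + 1 < j.1 ∨ j.1 + 1 < i.1) :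
      HeckeRel T (T i * T j) (T j * T i)

/-- The defining relations of the positive affine Hecke algebra. -/
inductive AffineRel (T : Fin (n - 1) → A) (θ : Fin n → A) : A → A → Prop
  | hecke {a b : A} (h : HeckeRel T a b) : AffineRel T θ a b
  | theta_comm (i j : Fin n) : AffineRel T θ (θ i * θ j) (θ j * θ i)
  | theta_succ (i : Fin (n - 1)) :
      AffineRel T θ (θ (hi i)) (t • (Tinv T i * θ (lo i) * Tinv T i))
  | T_theta (i : Fin (n - 1)) (j : Fin n) (h : j ≠ lo i) (h' : j ≠ hi i) :
      AffineRel T θ (T i * θ j) (θ j * T i)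

/-- `π_n = t^{n-1} θ_1 T_1⁻¹ ⋯ T_{n-1}⁻¹` -/
def piElt (T : Fin (n - 1) → A) (θ : Fin n → A) (hn : 0 < n) : A :=
  t ^ (n - 1) • (θ ⟨0, hn⟩ * (List.ofFn (Tinv T)).prod)

/-- The defining relations of the positive double affine Hecke algebra. -/
inductive DahaRel (T : Fin (n - 1) → A) (θ X : Fin n → A) : A → A → Prop
  | affine {a b : A} (h : AffineRel T θ a b) : DahaRel T θ X a b
  | X_comm (i j : Fin n) : DahaRel T θ X (X i * X j) (X j * X i)
  | X_succ (i : Fin (n - 1)) :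
      DahaRel T θ X (X (hi i)) (t • (Tinv T i * X (lo i) * Tinv T i))
  | T_X (i : Fin (n - 1)) (j : Fin n) (h : j ≠ lo i) (h' : j ≠ hi i) :
      DahaRel T θ X (T i * X j) (X j * T i)
  | pi_X (hn : 0 < n) (i : Fin (n - 1)) :
      DahaRel T θ X (piElt T θ hn * X (lo i)) (X (hi i) * piElt T θ hn)
  | pi_X_last (hn : 0 < n) :
      DahaRel T θ X (piElt T θ hn * X ⟨n - 1, by omega⟩) (q • (X ⟨0, hn⟩ * piElt T θ hn))

/-- Auxiliary recursion for `thetaBar` on natural numbers (the value `0` outside the range is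
never used). -/
def thetaBarAux (T : Fin (n - 1) → A) : ℕ → A
  | 0 => 1
  | k + 1 => if h : k < n - 1 then t • (Tinv T ⟨k, h⟩ * thetaBarAux T k * Tinv T ⟨k, h⟩) else 0

/-- `θ̄_1 = 1` and `θ̄_{i+1} = t T_i⁻¹ θ̄_i T_i⁻¹`. -/
def thetaBar (T : Fin (n - 1) → A) (i : Fin n) : A := thetaBarAux T i.1

/-- `φ̄_i = (t T_i⁻¹) θ̄_i - θ̄_i (t T_i⁻¹)` -/
def phiBar (T : Fin (n - 1) → A) (i : Fin (n - 1)) : A :=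
  tTinv T i * thetaBar T (lo i) - thetaBar T (lo i) * tTinv T i

/-- A family satisfies the Hecke relations. -/
def SatHecke (T : Fin (n - 1) → A) : Prop := ∀ a b, HeckeRel T a b → a = b

variable {T : Fin (n - 1) → A}

theorem T_mul_tTinv (hT : SatHecke T) (i : Fin (n - 1)) : T i * tTinv T i = t • 1 := by
  have h := hT _ _ (HeckeRel.quad i)
  rw [sub_mul, one_mul, mul_add] at h
  rw [tTinv, map_sub, map_one, mul_add, mul_sub, mul_one, Algebra.smul_def, mul_one]
  rw [← sub_eq_zero, ← h]
  abel

theorem tTinv_mul_T (hT : SatHecke T) (i : Fin (n - 1)) : tTinv T i * T i = t • 1 := by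
  rw [← T_mul_tTinv hT i, tTinv, add_mul, mul_add, Algebra.commutes]

theorem T_mul_Tinv (hT : SatHecke T) (i : Fin (n - 1)) : T i * Tinv T i = 1 := by
  rw [Tinv, mul_smul_comm, T_mul_tTinv hT, smul_smul, inv_mul_cancel₀ t_ne_zero, one_smul]

theorem Tinv_mul_T (hT : SatHecke T) (i : Fin (n - 1)) : Tinv T i * T i = 1 := by
  rw [Tinv, smul_mul_assoc, tTinv_mul_T hT, smul_smul, inv_mul_cancel₀ t_ne_zero, one_smul]

theorem commute_Tinv {a : A} {i : Fin (n - 1)} (h : Commute a (T i)) : Commute a (Tinv T i) :=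
  Commute.smul_right (h.add_right (Algebra.commutes _ a).symm) _

theorem thetaBarAux_succ (k : ℕ) (h : k < n - 1) :
    thetaBarAux T (k + 1) = t • (Tinv T ⟨k, h⟩ * thetaBarAux T k * Tinv T ⟨k, h⟩) := by
  rw [thetaBarAux, dif_pos h]

theorem commute_thetaBarAux {a : A} (k : ℕ) (h : ∀ i : Fin (n - 1), i.1 < k → Commute a (T i)) :
    Commute a (thetaBarAux T k) := by
  induction k with
  | zero => exact Commute.one_right a
  | succ k ih =>
    rw [thetaBarAux]
    split_ifs with hk
    · have h1 := commute_Tinv (h ⟨k, hk⟩ (Nat.lt_succ_self k))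
      exact ((h1.mul_right (ih fun i hi => h i (by omega))).mul_right h1).smul_right _
    · exact Commute.zero_right a

theorem commute_T_T (hT : SatHecke T) (i j : Fin (n - 1)) (h : i.1 + 1 < j.1 ∨ j.1 + 1 < i.1) :
    Commute (T i) (T j) := hT _ _ (HeckeRel.comm i j h)

/-- `T_i T_{j}⁻¹ T_i⁻¹ = T_j⁻¹ T_i⁻¹ T_j` for `|i - j| = 1`. -/
theorem braid_inv (hT : SatHecke T) (i j : Fin (n - 1)) (h : i.1 + 1 = j.1) :
    T i * (Tinv T j * Tinv T i) = Tinv T j * Tinv T i * T j ∧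
      Tinv T i * Tinv T j * T i = T j * (Tinv T i * Tinv T j) := by
  have hb := hT _ _ (HeckeRel.braid i j h)
  have i1 := T_mul_Tinv hT i
  have i2 := Tinv_mul_T hT i
  have j1 := T_mul_Tinv hT j
  have j2 := Tinv_mul_T hT j
  generalize Tinv T i = a' at *
  generalize Tinv T j = b' at *
  generalize T i = a at *
  generalize T j = b at *
  constructor
  · calc a * (b' * a') = (b' * (a' * a) * b) * a * (b' * a') := by
          rw [i2, mul_one, j2, one_mul]
      _ = b' * a' * (a * b * a) * (b' * a') := by simp only [mul_assoc]
      _ = b' * a' * b * (a * (b * b') * a') := by rw [hb]; simp only [mul_assoc]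
      _ = b' * a' * b := by rw [j1, mul_one, i1, mul_one]
  · calc a' * b' * a = a' * b' * a * (b * (a * a') * b') := by rw [i1, mul_one, j1, mul_one]
      _ = a' * b' * (a * b * a) * (a' * b') := by simp only [mul_assoc]
      _ = a' * (b' * b) * a * b * (a' * b') := by rw [hb]; simp only [mul_assoc]
      _ = b * (a' * b') := by rw [j2, mul_one, i2, one_mul]

theorem commute_T_thetaBarAux (hT : SatHecke T) (i : Fin (n - 1)) (k : ℕ) (h : k ≠ i.1)
    (h' : k ≠ i.1 + 1) : Commute (T i) (thetaBarAux T k) := by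
  rcases lt_or_gt_of_ne h with hk | hk
  · exact commute_thetaBarAux k fun j hj => commute_T_T hT i j (Or.inr (by omega))
  · obtain ⟨d, rfl⟩ : ∃ d, k = i.1 + 2 + d := ⟨k - i.1 - 2, by omega⟩
    clear h h' hk
    induction d with
    | zero =>
      by_cases hj : i.1 + 1 < n - 1
      · have hi : i.1 < n - 1 := i.2
        obtain ⟨e1, e2⟩ := braid_inv hT i ⟨i.1 + 1, hj⟩ rfl
        have hc : Commute (T ⟨i.1 + 1, hj⟩) (thetaBarAux T i.1) :=
          commute_thetaBarAux _ fun j hj' => commute_T_T hT _ _ (Or.inr (by simpa using hj'))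
        change Commute (T i) (thetaBarAux T (i.1 + 1 + 1))
        rw [thetaBarAux_succ _ hj, thetaBarAux_succ _ hi]
        simp only [mul_smul_comm, smul_mul_assoc]
        refine Commute.smul_right (Commute.smul_right ?_ _) _
        generalize Tinv T ⟨i.1 + 1, hj⟩ = b' at *
        change Commute (T i) (b' * (Tinv T i * thetaBarAux T i.1 * Tinv T i) * b')
        generalize Tinv T i = a' at *
        generalize T ⟨i.1 + 1, hj⟩ = b at *
        generalize thetaBarAux T i.1 = x at *
        generalize T i = a at *
        change a * (b' * (a' * x * a') * b') = b' * (a' * x * a') * b' * a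
        calc a * (b' * (a' * x * a') * b') = a * (b' * a') * x * (a' * b') := by
              simp only [mul_assoc]
          _ = b' * a' * (b * x) * (a' * b') := by rw [e1]; simp only [mul_assoc]
          _ = b' * a' * x * (b * (a' * b')) := by rw [hc.eq]; simp only [mul_assoc]
          _ = b' * (a' * x * a') * b' * a := by rw [← e2]; simp only [mul_assoc]
      · change Commute (T i) (thetaBarAux T (i.1 + 1 + 1))
        rw [thetaBarAux, dif_neg hj]
        exact Commute.zero_right _
    | succ d ih =>
      change Commute (T i) (thetaBarAux T (i.1 + 2 + d + 1))
      rw [thetaBarAux]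
      split_ifs with hk
      · have h1 := commute_Tinv
          (commute_T_T hT i ⟨i.1 + 2 + d, hk⟩ (Or.inl (by simp only []; omega)))
        exact ((h1.mul_right ih).mul_right h1).smul_right _
      · exact Commute.zero_right _

theorem commute_thetaBar (hT : SatHecke T) (i j : Fin n) :
    Commute (thetaBar T i) (thetaBar T j) := by
  rcases lt_trichotomy i.1 j.1 with h | h | h
  · exact (commute_thetaBarAux _ fun k hk =>
      (commute_T_thetaBarAux hT k j.1 (by omega) (by omega)).symm).symm
  · rw [Fin.ext h]
  · exact commute_thetaBarAux _ fun k hk =>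
      (commute_T_thetaBarAux hT k i.1 (by omega) (by omega)).symm

/-- The elements `θ̄_i` satisfy the relations of the affine Hecke algebra. -/
theorem affineRel_thetaBar (hT : SatHecke T) {a b : A} (h : AffineRel T (thetaBar T) a b) :
    a = b := by
  cases h with
  | hecke h => exact hT _ _ h
  | theta_comm i j => exact commute_thetaBar hT i j
  | theta_succ i => exact thetaBarAux_succ i.1 i.2
  | T_theta i j h h' =>
    exact commute_T_thetaBarAux hT i j.1 (fun e => h (Fin.ext e)) (fun e => h' (Fin.ext e))

end Relations

section Map

variable {n : ℕ} {A B : Type} [Ring A] [Algebra K A] [Ring B] [Algebra K B]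

theorem map_tTinv (f : A →ₐ[K] B) (T : Fin (n - 1) → A) (i : Fin (n - 1)) :
    f (tTinv T i) = tTinv (fun j => f (T j)) i := by
  simp only [tTinv, map_add, AlgHom.commutes]

theorem map_Tinv (f : A →ₐ[K] B) (T : Fin (n - 1) → A) (i : Fin (n - 1)) :
    f (Tinv T i) = Tinv (fun j => f (T j)) i := by
  simp only [Tinv, map_smul, map_tTinv]

theorem HeckeRel.map (f : A →ₐ[K] B) {T : Fin (n - 1) → A} {a b : A} (h : HeckeRel T a b) :
    HeckeRel (fun j => f (T j)) (f a) (f b) := by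
  cases h with
  | quad i =>
    simpa only [map_mul, map_sub, map_add, map_one, map_zero, AlgHom.commutes] using
      HeckeRel.quad (T := fun j => f (T j)) i
  | braid i j h => simpa only [map_mul] using HeckeRel.braid (T := fun j => f (T j)) i j h
  | comm i j h => simpa only [map_mul] using HeckeRel.comm (T := fun j => f (T j)) i j h

theorem AffineRel.map (f : A →ₐ[K] B) {T : Fin (n - 1) → A} {θ : Fin n → A} {a b : A}
    (h : AffineRel T θ a b) :
    AffineRel (fun j => f (T j)) (fun j => f (θ j)) (f a) (f b) := by
  cases h with
  | hecke h => exact AffineRel.hecke (h.map f)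
  | theta_comm i j =>
    simpa only [map_mul] using AffineRel.theta_comm (T := fun j => f (T j)) (θ := fun j => f (θ j)) i j
  | theta_succ i =>
    simpa only [map_mul, map_smul, map_Tinv] using
      AffineRel.theta_succ (T := fun j => f (T j)) (θ := fun j => f (θ j)) i
  | T_theta i j h h' =>
    simpa only [map_mul] using
      AffineRel.T_theta (T := fun j => f (T j)) (θ := fun j => f (θ j)) i j h h'

end Map

inductive AffineGen (n : ℕ) : Type
  | T (i : Fin (n - 1))
  | θ (i : Fin n)

inductive DahaGen (n : ℕ) : Type
  | T (i : Fin (n - 1))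
  | θ (i : Fin n)
  | X (i : Fin n)

/-- The `K`-algebra generated by `G` subject to the relations `r`. -/
def Presented (G : Type) (r : FreeAlgebra K G → FreeAlgebra K G → Prop) : Type := RingQuot r

namespace Presented

variable {G : Type} (r : FreeAlgebra K G → FreeAlgebra K G → Prop)

instance : Ring (Presented G r) := inferInstanceAs (Ring (RingQuot r))

instance : Algebra K (Presented G r) := inferInstanceAs (Algebra K (RingQuot r))

/-- The canonical projection from the free algebra. -/
def mk : FreeAlgebra K G →ₐ[K] Presented G r := RingQuot.mkAlgHom K r

/-- The class of a generator. -/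
def gen (g : G) : Presented G r := mk r (FreeAlgebra.ι K g)

variable {r}

theorem mk_rel {a b : FreeAlgebra K G} (h : r a b) : mk r a = mk r b := RingQuot.mkAlgHom_rel K h

variable {A : Type} [Ring A] [Algebra K A]

/-- The universal property. -/
def lift (f : G → A)
    (hf : ∀ a b, r a b → FreeAlgebra.lift K f a = FreeAlgebra.lift K f b) :
    Presented G r →ₐ[K] A :=
  RingQuot.liftAlgHom K ⟨FreeAlgebra.lift K f, fun {a b} h => hf a b h⟩

theorem lift_gen (f : G → A)
    (hf : ∀ a b, r a b → FreeAlgebra.lift K f a = FreeAlgebra.lift K f b) (g : G) :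
    lift f hf (gen r g) = f g :=
  (RingQuot.liftAlgHom_mkAlgHom_apply K (FreeAlgebra.lift K f) (fun {a b} h => hf a b h)
    (FreeAlgebra.ι K g)).trans (FreeAlgebra.lift_ι_apply f g)

end Presented

/-- The finite Hecke algebra. -/
abbrev Hecke (n : ℕ) : Type :=
  Presented (Fin (n - 1)) (HeckeRel (n := n) (FreeAlgebra.ι K))

/-- The positive affine Hecke algebra. -/
abbrev Affine (n : ℕ) : Type :=
  Presented (AffineGen n) (AffineRel (n := n) (fun i => FreeAlgebra.ι K (AffineGen.T i))
    (fun i => FreeAlgebra.ι K (AffineGen.θ i)))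

/-- The positive double affine Hecke algebra. -/
abbrev Daha (n : ℕ) : Type :=
  Presented (DahaGen n) (DahaRel (n := n) (fun i => FreeAlgebra.ι K (DahaGen.T i))
    (fun i => FreeAlgebra.ι K (DahaGen.θ i)) (fun i => FreeAlgebra.ι K (DahaGen.X i)))

def Hecke.T {n : ℕ} (i : Fin (n - 1)) : Hecke n := Presented.gen _ i

def Affine.T {n : ℕ} (i : Fin (n - 1)) : Affine n := Presented.gen _ (AffineGen.T i)

def Affine.θ {n : ℕ} (i : Fin n) : Affine n := Presented.gen _ (AffineGen.θ i)

def Daha.T {n : ℕ} (i : Fin (n - 1)) : Daha n := Presented.gen _ (DahaGen.T i)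

def Daha.θ {n : ℕ} (i : Fin n) : Daha n := Presented.gen _ (DahaGen.θ i)

def Daha.X {n : ℕ} (i : Fin n) : Daha n := Presented.gen _ (DahaGen.X i)

/-- The element `π_n` of the double affine Hecke algebra. -/
def Daha.pi {n : ℕ} (hn : 0 < n) : Daha n := piElt Daha.T Daha.θ hn

/-- The element `t T_i⁻¹` of the double affine Hecke algebra. -/
def Daha.tTinv {n : ℕ} (i : Fin (n - 1)) : Daha n := VVMac.tTinv Daha.T i

theorem AffineRel.mk_daha {n : ℕ} {a b : FreeAlgebra K (DahaGen n)}
    (h : AffineRel (n := n) (fun i => FreeAlgebra.ι K (DahaGen.T i))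
      (fun i => FreeAlgebra.ι K (DahaGen.θ i)) a b) :
    (Presented.mk _ a : Daha n) = Presented.mk _ b :=
  Presented.mk_rel (DahaRel.affine h)

theorem satHecke_T (n : ℕ) : SatHecke (Hecke.T (n := n)) := by
  have key : ∀ a b, HeckeRel (n := n) (FreeAlgebra.ι K) a b →
      (Presented.mk _ a : Hecke n) = Presented.mk _ b := fun a b h => Presented.mk_rel h
  intro a b h
  cases h with
  | quad i =>
    have := key _ _ (HeckeRel.quad i)
    simp only [map_mul, map_sub, map_add, map_one, map_zero, AlgHom.commutes] at this
    exact this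
  | braid i j h =>
    have := key _ _ (HeckeRel.braid i j h)
    simp only [map_mul] at this
    exact this
  | comm i j h =>
    have := key _ _ (HeckeRel.comm i j h)
    simp only [map_mul] at this
    exact this

/-- `ρ_n : T_i ↦ T_i, θ_i ↦ θ̄_i` -/
def rho (n : ℕ) : Affine n →ₐ[K] Hecke n :=
  Presented.lift (fun g => match g with
    | AffineGen.T i => Hecke.T i
    | AffineGen.θ i => thetaBar Hecke.T i) (by
      intro a b h
      have h' := h.map (FreeAlgebra.lift K (fun g => match g with
        | AffineGen.T i => (Hecke.T i : Hecke n)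
        | AffineGen.θ i => thetaBar Hecke.T i))
      simp only [FreeAlgebra.lift_ι_apply] at h'
      exact affineRel_thetaBar (satHecke_T n) h')

/-- The canonical homomorphism from the affine to the double affine Hecke algebra. -/
def affineToDaha (n : ℕ) : Affine n →ₐ[K] Daha n :=
  Presented.lift (fun g => match g with
    | AffineGen.T i => Daha.T i
    | AffineGen.θ i => Daha.θ i) (by
      intro a b h
      have h' := h.map (FreeAlgebra.lift K (fun g => match g with
        | AffineGen.T i => FreeAlgebra.ι K (DahaGen.T (n := n) i)
        | AffineGen.θ i => FreeAlgebra.ι K (DahaGen.θ i)))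
      simp only [FreeAlgebra.lift_ι_apply] at h'
      have h2 := h'.mk_daha
      have e : ∀ x : FreeAlgebra K (AffineGen n),
          (Presented.mk _ (FreeAlgebra.lift K (fun g => match g with
            | AffineGen.T i => FreeAlgebra.ι K (DahaGen.T (n := n) i)
            | AffineGen.θ i => FreeAlgebra.ι K (DahaGen.θ i)) x) : Daha n) =
          FreeAlgebra.lift K (fun g => match g with
            | AffineGen.T i => (Daha.T i : Daha n)
            | AffineGen.θ i => Daha.θ i) x := by
        intro x
        rw [← AlgHom.comp_apply]
        refine DFunLike.congr_fun (FreeAlgebra.hom_ext ?_) x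
        funext g
        cases g <;>
          simp only [Function.comp_apply, AlgHom.comp_apply, FreeAlgebra.lift_ι_apply] <;> rfl
      rw [e, e] at h2
      exact h2)

theorem rho_T {n : ℕ} (i : Fin (n - 1)) : rho n (Affine.T i) = Hecke.T i :=
  Presented.lift_gen _ _ _

theorem rho_θ {n : ℕ} (i : Fin n) : rho n (Affine.θ i) = thetaBar Hecke.T i :=
  Presented.lift_gen _ _ _

theorem affineToDaha_T {n : ℕ} (i : Fin (n - 1)) : affineToDaha n (Affine.T i) = Daha.T i :=
  Presented.lift_gen _ _ _

theorem affineToDaha_θ {n : ℕ} (i : Fin n) : affineToDaha n (Affine.θ i) = Daha.θ i :=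
  Presented.lift_gen _ _ _

/-! ### The modules -/

section Specht

variable (n : ℕ) (μ : YoungDiagram)

variable {n μ} in
/-- The generator of the free Hecke module on `SYT(μ)` given by `τ`. -/
def basisVec (τ : SYT n μ) : SYT n μ →₀ Hecke n := Finsupp.single τ 1

/-- The relations of the Hecke module attached to `μ`, in the free module on `SYT(μ)`; every
listed element is set to zero. -/
inductive SpechtRel : (SYT n μ →₀ Hecke n) → Prop
  | theta (i : Fin n) (τ : SYT n μ) :
      SpechtRel (thetaBar Hecke.T i • basisVec τ
        - (t ^ τ.toPSYT.c i) • basisVec τ)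
  | phi (i : Fin (n - 1)) (τ σ : SYT n μ) (h : PSYT.IsSwap i τ.toPSYT σ.toPSYT)
      (hlt : PSYT.Lt τ.toPSYT σ.toPSYT) :
      SpechtRel (phiBar Hecke.T i • basisVec τ
        - (t ^ τ.toPSYT.c (lo i) - t ^ τ.toPSYT.c (hi i)) • basisVec σ)
  | row (i : Fin (n - 1)) (τ : SYT n μ)
      (h : (τ.toPSYT.box (lo i)).1.1 = (τ.toPSYT.box (hi i)).1.1) :
      SpechtRel (Hecke.T i • basisVec τ - basisVec τ)
  | col (i : Fin (n - 1)) (τ : SYT n μ)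
      (h : (τ.toPSYT.box (lo i)).1.2 = (τ.toPSYT.box (hi i)).1.2) :
      SpechtRel (Hecke.T i • basisVec τ + t • basisVec τ)

/-- The Hecke module `μ`: generated by `SYT(μ)` subject to `SpechtRel`. -/
abbrev Specht : Type :=
  (SYT n μ →₀ Hecke n) ⧸ Submodule.span (Hecke n) {x | SpechtRel n μ x}

/-- The class of a standard tableau in `Specht`. -/
def Specht.of {n : ℕ} {μ : YoungDiagram} (τ : SYT n μ) : Specht n μ :=
  Submodule.Quotient.mk (basisVec τ)

end Specht

section Induction

variable {A H B : Type} [Ring A] [Algebra K A] [Ring H] [Algebra K H] [Ring B] [Algebra K B]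

/-- For algebra maps `f : A → B` and `g : A → H` and an `H`-module `M`, this is
`B ⊗_A g^*(M) = Ind_A^B g^*(M)`, as the quotient of `B ⊗_K M` by the `B`-submodule generated by
the elements `b f(a) ⊗ m - b ⊗ g(a) m`. -/
abbrev IndPullback (f : A →ₐ[K] B) (g : A →ₐ[K] H) (M : Type) [AddCommGroup M] [Module K M]
    [Module H M] [IsScalarTower K H M] : Type :=
  TensorProduct K B M ⧸ Submodule.span B
    {x : TensorProduct K B M | ∃ (b : B) (a : A) (m : M),
      x = TensorProduct.tmul K (b * f a) m - TensorProduct.tmul K b (g a • m)}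

end Induction

/-- `V_μ = Ind (ρ_n^* μ)`, a module over the double affine Hecke algebra. -/
abbrev V (n : ℕ) (μ : YoungDiagram) : Type :=
  IndPullback (affineToDaha n) (rho n) (Specht n μ)

/-- The vector `1 ⊗ τ` of `V_μ`. -/
def oneTmul {n : ℕ} {μ : YoungDiagram} (τ : SYT n μ) : V n μ :=
  Submodule.Quotient.mk (TensorProduct.tmul K (1 : Daha n) (Specht.of τ))

end

end VVMac

/-!
The proof makes `V_λ` explicit. On the space with basis `PSYT(λ)` let `θ_i` act diagonally by the
weights `q^w t^c` and `T_i` by Young's seminormal formulas, the block of `τ` and `s_i(τ)` being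
two-dimensional, and let `Y` send `τ` to `q^(-w_τ(1)) Ψ(τ)`. The element `Y` is to become
`X_n π_n⁻¹`, so `X_n` must act as `Y π_n`, and the remaining `X_k` are then forced by the `T_i`.
The relations of `D_n` hold because `Ψ` shifts the sequence of weights cyclically. On the span of
`SYT(λ)` the algebra `A_n` acts through `ρ_n`, so Frobenius reciprocity gives a map from `V_λ` to
this model with `1 ⊗ τ ↦ τ`.

The map is surjective since every tableau is reached from the standard ones by ascending swaps and
`Ψ`. For injectivity filter `V_λ` by the degree in the `X_k`. The part of degree at most `d` is
spanned by the vectors `X^s ⊗ τ`, and these are no more numerous than the tableaux of total exponent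
at most `d`: a standard tableau together with multiplicities for its labels inflates to a tableau
in `PSYT(λ)`. Since all basis vectors of total exponent at most `d` are in the image of that part,
a dimension count shows that the map is injective on it.
-/

namespace VVMac

noncomputable section

/-! ### Cyclic shifts of affine braid families -/

section Segments

variable {M : Type*} [Monoid M]

/-- The ordered product `T_a T_{a+1} ⋯ T_{a+m-1}`. -/
def segment (T : ℕ → M) (a m : ℕ) : M := (List.ofFn fun i : Fin m => T (a + i)).prod

theorem segment_zero (T : ℕ → M) (a : ℕ) : segment T a 0 = 1 := by
  simp [segment]

theorem segment_succ (T : ℕ → M) (a m : ℕ) :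
    segment T a (m + 1) = segment T a m * T (a + m) := by
  rw [segment, List.ofFn_succ', List.concat_eq_append, List.prod_append, List.prod_singleton]
  rfl

theorem segment_succ' (T : ℕ → M) (a m : ℕ) :
    segment T a (m + 1) = T a * segment T (a + 1) m := by
  rw [segment, segment, List.ofFn_succ, List.prod_cons]
  simp only [Fin.val_zero, add_zero, Fin.val_succ, add_assoc, add_comm 1]

theorem semiconjBy_segment {x : M} {S T : ℕ → Mˣ} {a b m : ℕ}
    (h : ∀ k < m, SemiconjBy x (S (a + k)) (T (b + k))) :
    SemiconjBy x (segment S a m : Mˣ) (segment T b m : Mˣ) := by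
  induction m with
  | zero => simp only [segment_zero, Units.val_one, SemiconjBy.one_right]
  | succ m ih =>
    simp only [segment_succ, Units.val_mul]
    exact (ih fun k hk => h k (by omega)).mul_right (h m (by omega))

end Segments

/-- Elements `T_0, …, T_{N-1}`, `θ_0, …, θ_N` of an algebra subject to the relations of the affine
Hecke algebra of `GL_{N+1}` other than the quadratic one. The families are indexed by all natural
numbers; their values beyond `N` are arbitrary. -/
structure AffineBraidFamily {R : Type*} [CommRing R] (t : Rˣ) (A : Type*) [Ring A] [Algebra R A]
    (N : ℕ) where
  T : ℕ → Aˣ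
  θ : ℕ → A
  braid : ∀ k, k + 1 < N → T k * T (k + 1) * T k = T (k + 1) * T k * T (k + 1)
  comm : ∀ j k, j + 1 < k → k < N → Commute (T j) (T k)
  theta_comm : ∀ j k, j ≤ N → k ≤ N → Commute (θ j) (θ k)
  theta_succ : ∀ k < N, θ (k + 1) = t • (↑(T k)⁻¹ * θ k * ↑(T k)⁻¹)
  T_theta : ∀ k j, k < N → j ≤ N → j ≠ k → j ≠ k + 1 → Commute (T k : A) (θ j)

namespace AffineBraidFamily

variable {R : Type*} [CommRing R] {t : Rˣ} {A : Type*} [Ring A] [Algebra R A] {N : ℕ}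
  (D : AffineBraidFamily t A N)

theorem T_segment_inv {a m i : ℕ} (ha : a ≤ i) (hi : i + 1 < a + m) (hm : a + m ≤ N) :
    SemiconjBy (segment D.T⁻¹ a m) (D.T i) (D.T (i + 1)) := by
  induction m with
  | zero => omega
  | succ m ih =>
    rcases Nat.lt_or_ge (i + 1) (a + m) with h | h
    · rw [segment_succ]
      exact (ih h (by omega)).mul_left (D.comm i (a + m) h (by omega)).symm.inv_left
    · obtain ⟨m, rfl⟩ : ∃ m', m = m' + 1 := ⟨m - 1, by omega⟩
      obtain rfl : i = a + m := by omega
      have hi' : a + m + 1 < N := by omega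
      have last_two : SemiconjBy ((D.T (a + m))⁻¹ * (D.T (a + m + 1))⁻¹)
          (D.T (a + m)) (D.T (a + m + 1)) := by
        rw [← mul_inv_rev, SemiconjBy.inv_symm_left_iff]
        change D.T (a + m + 1) * D.T (a + m) * D.T (a + m + 1) = D.T (a + m) * _
        rw [← D.braid (a + m) hi', mul_assoc]
      have hc : Commute (D.T (a + m + 1)) (segment D.T⁻¹ a m) :=
        .units_of_val <| semiconjBy_segment fun k hk =>
          (D.comm (a + k) (a + m + 1) (by omega) hi').symm.inv_right.units_val
      rw [segment_succ, segment_succ, mul_assoc]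
      exact SemiconjBy.mul_left hc.symm last_two

/-- `π = t^N θ_0 T_0⁻¹ ⋯ T_{N-1}⁻¹`. -/
def pi : A := t ^ N • (D.θ 0 * (segment D.T⁻¹ 0 N : Aˣ))

theorem T_mul_theta_succ {k : ℕ} (hk : k < N) :
    D.T k * D.θ (k + 1) = t • (D.θ k * ↑(D.T k)⁻¹) := by
  rw [D.theta_succ k hk, mul_smul_comm, mul_assoc, Units.mul_inv_cancel_left]

theorem commute_theta_conj {k : ℕ} (hk : k < N) :
    Commute (D.θ k) (↑(D.T k)⁻¹ * D.θ k * ↑(D.T k)⁻¹) := by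
  have h := D.theta_comm k (k + 1) hk.le hk
  rwa [D.theta_succ k hk, Commute.smul_right_iff] at h

theorem pi_T {i : ℕ} (hi : i + 1 < N) : SemiconjBy D.pi (D.T i) (D.T (i + 1)) := by
  have hθ : Commute (D.θ 0) (D.T (i + 1)) :=
    (D.T_theta (i + 1) 0 hi (by omega) (by omega) (by omega)).symm
  have hseg := Units.ext_iff.1 (D.T_segment_inv (Nat.zero_le i) (by omega) (zero_add N).le).eq
  exact (SemiconjBy.mul_left hθ hseg).smul_left _

theorem pi_segment_inv {a m : ℕ} (h : a + m < N) :
    SemiconjBy D.pi (segment D.T⁻¹ a m : Aˣ) (segment D.T⁻¹ (a + 1) m : Aˣ) :=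
  semiconjBy_segment fun k hk => by
    rw [add_right_comm]
    exact (D.pi_T (by omega)).units_inv_right

theorem pi_theta_zero (hN : 0 < N) :
    SemiconjBy D.pi (D.θ 0) (D.T 0 * D.θ 0 * ↑(D.T 0)⁻¹) := by
  obtain ⟨M, rfl⟩ : ∃ M, N = M + 1 := ⟨N - 1, by omega⟩
  have hc : Commute (D.θ 0) (segment D.T⁻¹ 1 M : Aˣ) := semiconjBy_segment fun k hk =>
    Commute.units_inv_right (D.T_theta _ 0 (by omega) (by omega) (by omega) (by omega)).symm
  have hθ : SemiconjBy (D.θ 0 * ↑(D.T 0)⁻¹) (D.θ 0) (D.T 0 * D.θ 0 * ↑(D.T 0)⁻¹) := by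
    have h := (D.commute_theta_conj hN).eq
    simp only [SemiconjBy, mul_assoc] at h ⊢
    rw [h, Units.mul_inv_cancel_left]
  rw [pi, segment_succ', Units.val_mul, ← mul_assoc]
  exact (hθ.mul_left hc.symm).smul_left _

theorem pi_mul_T_last {M : ℕ} (D : AffineBraidFamily t A (M + 1)) :
    D.pi * D.T M = t ^ (M + 1) • (D.θ 0 * (segment D.T⁻¹ 0 M : Aˣ)) := by
  rw [pi, segment_succ, Units.val_mul, zero_add, smul_mul_assoc, mul_assoc, Pi.inv_apply,
    Units.inv_mul_cancel_right]

theorem pi_mul_pi_T_last {M : ℕ} (D : AffineBraidFamily t A (M + 1)) :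
    SemiconjBy (D.pi * D.pi) (D.T M) (D.T 0) :=
  calc D.pi * D.pi * D.T M
      = t ^ (M + 1) • (D.pi * D.θ 0 * (segment D.T⁻¹ 0 M : Aˣ)) := by
        rw [mul_assoc, pi_mul_T_last, mul_smul_comm, mul_assoc]
    _ = t ^ (M + 1) • (D.T 0 * D.θ 0 * ↑(D.T 0)⁻¹ * (segment D.T⁻¹ 1 M : Aˣ)) * D.pi := by
        rw [(D.pi_theta_zero M.succ_pos).eq, mul_assoc, (D.pi_segment_inv (by omega)).eq,
          ← mul_assoc, smul_mul_assoc]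
    _ = D.T 0 * (D.pi * D.pi) := by
        rw [← mul_assoc]
        congr 1
        rw [pi, segment_succ', Units.val_mul, mul_smul_comm]
        simp only [mul_assoc, Pi.inv_apply]

theorem segment_mul_theta {k m : ℕ} (h : k + m ≤ N) :
    (segment D.T k m : Aˣ) * D.θ (k + m) = t ^ m • (D.θ k * (segment D.T⁻¹ k m : Aˣ)) := by
  induction m generalizing k with
  | zero => simp only [segment_zero, Units.val_one, one_mul, mul_one, pow_zero, one_smul, add_zero]
  | succ m ih =>
    rw [segment_succ', Units.val_mul, mul_assoc, ← add_assoc, add_right_comm, ih (by omega),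
      mul_smul_comm, ← mul_assoc, D.T_mul_theta_succ (by omega), smul_mul_assoc, smul_smul,
      segment_succ', Units.val_mul, pow_succ, mul_assoc, Pi.inv_apply]

theorem isUnit_pi (h : IsUnit (D.θ 0)) : IsUnit D.pi :=
  (h.mul (Units.isUnit _)).smul _

theorem theta_mem {S : Subalgebra R A} (hT : ∀ k < N, D.T k ∈ S.toSubmonoid.units)
    (hpi : D.pi ∈ S) {k : ℕ} (hk : k ≤ N) : D.θ k ∈ S := by
  induction k with
  | zero =>
    have hseg : segment D.T⁻¹ 0 N ∈ S.toSubmonoid.units :=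
      Subgroup.list_prod_mem _ fun x hx => by
        obtain ⟨k, rfl⟩ := List.mem_ofFn.1 hx
        exact inv_mem (hT _ (by omega))
    have hθ : D.θ 0 = (t ^ N)⁻¹ • (D.pi * ↑(segment D.T⁻¹ 0 N)⁻¹) := by
      rw [pi, smul_mul_assoc, Units.mul_inv_cancel_right, inv_smul_smul]
    rw [hθ]
    exact S.smul_mem (mul_mem hpi (inv_mem hseg).1) _
  | succ k ih =>
    rw [D.theta_succ k hk]
    have hTk := (inv_mem (hT k hk)).1
    exact S.smul_mem (mul_mem (mul_mem hTk (ih (Nat.le_of_succ_le hk))) hTk) _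

end AffineBraidFamily

/-- A lift `Y` of the cyclic shift `θ_{k+1} ↦ θ_k`, `θ_0 ↦ q⁻¹ θ_N` to the algebra of an affine
braid family with `θ_0` invertible. From it the third family of generators of the double affine
Hecke algebra is recovered, see `ShiftLift.X`. -/
structure ShiftLift {R : Type*} [CommRing R] {t : Rˣ} (q : R) {A : Type*} [Ring A] [Algebra R A]
    {N : ℕ} (D : AffineBraidFamily t A N) where
  Y : A
  Y_theta : ∀ k < N, SemiconjBy Y (D.θ (k + 1)) (D.θ k)
  theta_Y : D.θ N * Y = q • (Y * D.θ 0)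
  Y_T : ∀ k, k + 1 < N → SemiconjBy Y (D.T (k + 1)) (D.T k)
  Y_Y_T : 0 < N → SemiconjBy (Y * Y) (D.T 0) (D.T (N - 1))
  isUnit_theta : IsUnit (D.θ 0)

namespace ShiftLift

variable {R : Type*} [CommRing R] {t : Rˣ} {q : R} {A : Type*} [Ring A] [Algebra R A] {N : ℕ}
  {D : AffineBraidFamily t A N} (E : ShiftLift q D)

/-- The elements `X_0, …, X_N` determined by `X_N = Y π` and `X_k = t⁻¹ T_k X_{k+1} T_k`. -/
def X (k : ℕ) : A :=
  t ^ k • ((segment D.T k (N - k) : Aˣ) * E.Y * D.θ 0 * (segment D.T⁻¹ 0 k : Aˣ))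

theorem X_last : E.X N = E.Y * D.pi := by
  rw [X, Nat.sub_self, segment_zero, Units.val_one, one_mul, AffineBraidFamily.pi, mul_smul_comm,
    mul_assoc]

theorem X_zero : E.X 0 = (segment D.T 0 N : Aˣ) * E.Y * D.θ 0 := by
  rw [X, segment_zero, Units.val_one, mul_one, pow_zero, one_smul, Nat.sub_zero]

theorem X_eq {k : ℕ} (hk : k < N) : E.X k = t⁻¹ • (D.T k * E.X (k + 1) * D.T k) := by
  rw [X, X, show N - k = N - (k + 1) + 1 by omega, segment_succ', segment_succ, zero_add,
    Units.val_mul, Units.val_mul, Pi.inv_apply, eq_inv_smul_iff, smul_smul, ← pow_succ']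
  simp only [mul_smul_comm, smul_mul_assoc, mul_assoc, Units.inv_mul, mul_one]

theorem X_succ {k : ℕ} (hk : k < N) :
    E.X (k + 1) = t • (↑(D.T k)⁻¹ * E.X k * ↑(D.T k)⁻¹) := by
  rw [E.X_eq hk, mul_smul_comm, smul_mul_assoc, smul_inv_smul, mul_assoc, mul_assoc,
    Units.mul_inv, mul_one, Units.inv_mul_cancel_left]

theorem Y_segment_inv {a m : ℕ} (h : a + 1 + m ≤ N) :
    SemiconjBy E.Y (segment D.T⁻¹ (a + 1) m : Aˣ) (segment D.T⁻¹ a m : Aˣ) :=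
  semiconjBy_segment fun k hk => by
    rw [add_right_comm]
    exact (E.Y_T _ (by omega)).units_inv_right

theorem commute_T_X_last {i : ℕ} (hi : i + 1 < N) : Commute (D.T i : A) (E.X N) := by
  rw [X_last]
  exact Commute.symm ((E.Y_T i hi).mul_left (D.pi_T hi))

theorem commute_T_X_of_lt {i k : ℕ} (hk : k ≤ N) (h : i + 1 < k) :
    Commute (D.T i : A) (E.X k) := by
  induction hk using Nat.decreasingInduction with
  | self => exact E.commute_T_X_last h
  | of_succ k hk ih =>
    have hT : Commute (D.T i : A) (D.T k) := (D.comm i k h hk).units_val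
    rw [E.X_eq hk]
    exact ((hT.mul_right (ih (by omega))).mul_right hT).smul_right _

theorem commute_T_succ_X {k : ℕ} (hk : k + 1 < N) : Commute (D.T (k + 1) : A) (E.X k) := by
  have hX := E.commute_T_X_of_lt (show k + 2 ≤ N from hk) k.succ.lt_succ_self
  have braid : (D.T k * D.T (k + 1) * D.T k : A) = D.T (k + 1) * D.T k * D.T (k + 1) :=
    Units.ext_iff.1 (D.braid k hk)
  have left : SemiconjBy (D.T k * D.T (k + 1) : A) (D.T k) (D.T (k + 1)) := by
    rw [SemiconjBy, braid, mul_assoc]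
  have right : SemiconjBy (D.T (k + 1) * D.T k : A) (D.T (k + 1)) (D.T k) := by
    rw [SemiconjBy, ← braid, mul_assoc]
  have conj : Commute (D.T k * D.T (k + 1) * (E.X (k + 2) * (D.T (k + 1) * D.T k)))
      (D.T (k + 1) : A) := left.mul_left (SemiconjBy.mul_left hX.symm right)
  rw [E.X_eq (by omega), E.X_eq hk]
  simp only [mul_smul_comm, smul_mul_assoc]
  refine Commute.smul_right (Commute.smul_right ?_ _) _
  simpa only [mul_assoc] using conj.symm

theorem commute_T_X_of_gt {i k : ℕ} (hi : i < N) (h : k < i) : Commute (D.T i : A) (E.X k) := by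
  obtain ⟨i, rfl⟩ : ∃ j, i = j + 1 := ⟨i - 1, by omega⟩
  induction (Nat.le_of_lt_succ h) using Nat.decreasingInduction with
  | self => exact E.commute_T_succ_X hi
  | of_succ k hk ih =>
    have hT : Commute (D.T (i + 1) : A) (D.T k) :=
      (D.comm k (i + 1) (Nat.succ_lt_succ hk) hi).symm.units_val
    rw [E.X_eq (by omega)]
    exact ((hT.mul_right (ih (Nat.succ_lt_succ hk))).mul_right hT).smul_right _

theorem pi_T_Y {M : ℕ} {D : AffineBraidFamily t A (M + 1)} (E : ShiftLift q D) :
    D.pi * D.T M * E.Y = t • (E.Y * ↑(D.T 0)⁻¹ * D.pi) :=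
  calc D.pi * D.T M * E.Y
      = t ^ (M + 1) • (D.θ 0 * E.Y * (segment D.T⁻¹ 1 M : Aˣ)) := by
        rw [D.pi_mul_T_last, smul_mul_assoc, mul_assoc, ← (E.Y_segment_inv (by omega)).eq,
          mul_assoc]
    _ = t ^ (M + 1) • t • (E.Y * (↑(D.T 0)⁻¹ * D.θ 0 * ↑(D.T 0)⁻¹) * (segment D.T⁻¹ 1 M : Aˣ)) := by
        rw [← (E.Y_theta 0 M.succ_pos).eq, D.theta_succ 0 M.succ_pos, mul_smul_comm,
          smul_mul_assoc]
    _ = t • (E.Y * ↑(D.T 0)⁻¹ * D.pi) := by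
        rw [AffineBraidFamily.pi, segment_succ', Units.val_mul, smul_comm, mul_smul_comm]
        simp only [mul_assoc, Pi.inv_apply, zero_add]

theorem pi_X_penultimate {M : ℕ} {D : AffineBraidFamily t A (M + 1)} (E : ShiftLift q D) :
    SemiconjBy D.pi (E.X M) (E.X (M + 1)) :=
  calc D.pi * E.X M
      = t⁻¹ • (D.pi * D.T M * E.Y * (D.pi * D.T M)) := by
        rw [E.X_eq M.lt_succ_self, E.X_last]
        simp only [mul_smul_comm, mul_assoc]
    _ = E.Y * ↑(D.T 0)⁻¹ * (D.pi * D.pi * D.T M) := by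
        rw [E.pi_T_Y, smul_mul_assoc, inv_smul_smul]
        simp only [mul_assoc]
    _ = E.Y * (D.pi * D.pi) := by
        rw [D.pi_mul_pi_T_last.eq, mul_assoc, Units.inv_mul_cancel_left]
    _ = E.X (M + 1) * D.pi := by rw [E.X_last, mul_assoc]

theorem pi_X {k : ℕ} (hk : k < N) : SemiconjBy D.pi (E.X k) (E.X (k + 1)) := by
  obtain ⟨M, rfl⟩ : ∃ M, N = M + 1 := ⟨N - 1, by omega⟩
  induction (Nat.le_of_lt_succ hk) using Nat.decreasingInduction with
  | self => exact E.pi_X_penultimate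
  | of_succ k hk' ih =>
    have hT : SemiconjBy D.pi (D.T k) (D.T (k + 1)) := D.pi_T (by omega)
    rw [E.X_eq (Nat.succ_lt_succ hk'), E.X_eq hk]
    exact ((hT.mul_right (ih (by omega))).mul_right hT).smul_right _

theorem pi_X_last : D.pi * E.X N = q • (E.X 0 * D.pi) := by
  have h := D.segment_mul_theta (zero_add N).le
  rw [zero_add] at h
  calc D.pi * E.X N = (segment D.T 0 N : Aˣ) * (D.θ N * E.Y) * D.pi := by
        rw [X_last, ← mul_assoc, ← mul_assoc, h, AffineBraidFamily.pi]
    _ = q • (E.X 0 * D.pi) := by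
        rw [E.theta_Y, X_zero, mul_smul_comm, smul_mul_assoc, ← mul_assoc]

theorem commute_X_penultimate {M : ℕ} {D : AffineBraidFamily t A (M + 1)} (E : ShiftLift q D) :
    Commute (E.X M) (E.X (M + 1)) :=
  calc E.X M * E.X (M + 1)
      = t⁻¹ • (D.T M * E.Y * (D.pi * D.T M * E.Y) * D.pi) := by
        rw [E.X_eq M.lt_succ_self, E.X_last]
        simp only [smul_mul_assoc, mul_assoc]
    _ = D.T M * (E.Y * E.Y) * ↑(D.T 0)⁻¹ * D.pi * D.pi := by
        rw [E.pi_T_Y, mul_smul_comm, smul_mul_assoc, inv_smul_smul]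
        simp only [mul_assoc]
    _ = E.Y * (E.Y * D.pi) * D.pi := by
        have h : SemiconjBy (E.Y * E.Y) (D.T 0) (D.T M) := E.Y_Y_T M.succ_pos
        rw [← h.eq, Units.mul_inv_cancel_right]
        simp only [mul_assoc]
    _ = E.X (M + 1) * E.X M := by
        rw [← E.X_last, mul_assoc, ← E.pi_X_penultimate.eq, ← mul_assoc, ← E.X_last]

theorem commute_X_last {k : ℕ} (hk : k < N) : Commute (E.X k) (E.X N) := by
  obtain ⟨M, rfl⟩ : ∃ M, N = M + 1 := ⟨N - 1, by omega⟩
  induction (Nat.le_of_lt_succ hk) using Nat.decreasingInduction with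
  | self => exact E.commute_X_penultimate
  | of_succ k hk' ih =>
    have hT := E.commute_T_X_last (Nat.succ_lt_succ hk')
    rw [E.X_eq hk]
    exact ((hT.mul_left (ih (by omega))).mul_left hT).smul_left _

theorem commute_X_of_lt {j k : ℕ} (hk : k ≤ N) (h : j < k) : Commute (E.X j) (E.X k) := by
  induction hk using Nat.decreasingInduction generalizing j with
  | self => exact E.commute_X_last h
  | of_succ k hk ih =>
    -- conjugation by `π` raises both indices
    have hj := E.pi_X (h.trans hk)
    have hk' := E.pi_X hk
    refine (D.isUnit_pi E.isUnit_theta).mul_left_cancel ?_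
    rw [(hj.mul_right hk').eq, (hk'.mul_right hj).eq, (ih (Nat.succ_lt_succ h)).eq]

end ShiftLift

/-! ### Presentations -/

section Families

variable {n : ℕ} {A B : Type} [Ring A] [Algebra K A] [Ring B] [Algebra K B]

/-- A pair of families satisfies the affine Hecke relations. -/
def SatAffine (T : Fin (n - 1) → A) (θ : Fin n → A) : Prop := ∀ a b, AffineRel T θ a b → a = b

/-- A triple of families satisfies the double affine Hecke relations. -/
def SatDaha (T : Fin (n - 1) → A) (θ X : Fin n → A) : Prop := ∀ a b, DahaRel T θ X a b → a = b

theorem SatAffine.satHecke {T : Fin (n - 1) → A} {θ : Fin n → A} (h : SatAffine T θ) :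
    SatHecke T := fun a b hab => h a b (.hecke hab)

theorem SatDaha.satAffine {T : Fin (n - 1) → A} {θ X : Fin n → A} (h : SatDaha T θ X) :
    SatAffine T θ := fun a b hab => h a b (.affine hab)

theorem map_piElt (f : A →ₐ[K] B) (T : Fin (n - 1) → A) (θ : Fin n → A) (hn : 0 < n) :
    f (piElt T θ hn) = piElt (fun j => f (T j)) (fun j => f (θ j)) hn := by
  simp only [piElt, map_smul, map_mul, map_list_prod, List.map_ofFn]
  congr 4
  funext i
  exact map_Tinv f T i

theorem map_thetaBar (f : A →ₐ[K] B) (T : Fin (n - 1) → A) (k : Fin n) :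
    f (thetaBar T k) = thetaBar (fun j => f (T j)) k := by
  obtain ⟨k, hk⟩ := k
  change f (thetaBarAux T k) = thetaBarAux (fun j => f (T j)) k
  induction k with
  | zero => exact map_one f
  | succ k ih =>
    rw [thetaBarAux_succ k (by omega), thetaBarAux_succ k (by omega), map_smul, map_mul, map_mul,
      map_Tinv, ih (by omega)]

theorem map_phiBar (f : A →ₐ[K] B) (T : Fin (n - 1) → A) (i : Fin (n - 1)) :
    f (phiBar T i) = phiBar (fun j => f (T j)) i := by
  simp only [phiBar, map_sub, map_mul, map_tTinv, map_thetaBar]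

theorem DahaRel.map (f : A →ₐ[K] B) {T : Fin (n - 1) → A} {θ X : Fin n → A} {a b : A}
    (h : DahaRel T θ X a b) :
    DahaRel (fun j => f (T j)) (fun j => f (θ j)) (fun j => f (X j)) (f a) (f b) := by
  cases h with
  | affine h => exact DahaRel.affine (h.map f)
  | X_comm i j =>
    simpa only [map_mul] using DahaRel.X_comm (T := fun j => f (T j)) (θ := fun j => f (θ j))
      (X := fun j => f (X j)) i j
  | X_succ i =>
    simpa only [map_mul, map_smul, map_Tinv] using
      DahaRel.X_succ (T := fun j => f (T j)) (θ := fun j => f (θ j)) (X := fun j => f (X j)) i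
  | T_X i j h h' =>
    simpa only [map_mul] using
      DahaRel.T_X (T := fun j => f (T j)) (θ := fun j => f (θ j)) (X := fun j => f (X j)) i j h h'
  | pi_X hn i =>
    simpa only [map_mul, map_piElt] using
      DahaRel.pi_X (T := fun j => f (T j)) (θ := fun j => f (θ j)) (X := fun j => f (X j)) hn i
  | pi_X_last hn =>
    simpa only [map_mul, map_smul, map_piElt] using
      DahaRel.pi_X_last (T := fun j => f (T j)) (θ := fun j => f (θ j)) (X := fun j => f (X j)) hn

theorem SatHecke.of_map (f : A →ₐ[K] B) {T : Fin (n - 1) → A}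
    (H : ∀ a b, HeckeRel T a b → f a = f b) : SatHecke fun j => f (T j) := by
  intro a b h
  cases h with
  | quad i =>
    simpa only [map_mul, map_sub, map_add, map_one, map_zero, AlgHom.commutes] using
      H _ _ (HeckeRel.quad i)
  | braid i j h => simpa only [map_mul] using H _ _ (HeckeRel.braid i j h)
  | comm i j h => simpa only [map_mul] using H _ _ (HeckeRel.comm i j h)

theorem SatAffine.of_map (f : A →ₐ[K] B) {T : Fin (n - 1) → A} {θ : Fin n → A}
    (H : ∀ a b, AffineRel T θ a b → f a = f b) :
    SatAffine (fun j => f (T j)) fun j => f (θ j) := by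
  intro a b h
  cases h with
  | hecke h => exact SatHecke.of_map f (fun a b h => H a b (.hecke h)) _ _ h
  | theta_comm i j => simpa only [map_mul] using H _ _ (AffineRel.theta_comm i j)
  | theta_succ i => simpa only [map_mul, map_smul, map_Tinv] using H _ _ (AffineRel.theta_succ i)
  | T_theta i j h h' => simpa only [map_mul] using H _ _ (AffineRel.T_theta i j h h')

theorem SatDaha.of_map (f : A →ₐ[K] B) {T : Fin (n - 1) → A} {θ X : Fin n → A}
    (H : ∀ a b, DahaRel T θ X a b → f a = f b) :
    SatDaha (fun j => f (T j)) (fun j => f (θ j)) fun j => f (X j) := by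
  intro a b h
  cases h with
  | affine h => exact SatAffine.of_map f (fun a b h => H a b (.affine h)) _ _ h
  | X_comm i j => simpa only [map_mul] using H _ _ (DahaRel.X_comm i j)
  | X_succ i => simpa only [map_mul, map_smul, map_Tinv] using H _ _ (DahaRel.X_succ i)
  | T_X i j h h' => simpa only [map_mul] using H _ _ (DahaRel.T_X i j h h')
  | pi_X hn i => simpa only [map_mul, map_piElt] using H _ _ (DahaRel.pi_X hn i)
  | pi_X_last hn => simpa only [map_mul, map_smul, map_piElt] using H _ _ (DahaRel.pi_X_last hn)

theorem Daha.satDaha : SatDaha (Daha.T (n := n)) Daha.θ Daha.X :=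
  SatDaha.of_map (Presented.mk _) fun _ _ => Presented.mk_rel

end Families

section UniversalProperty

variable {n : ℕ} {A : Type} [Ring A] [Algebra K A]

/-- The homomorphism out of the finite Hecke algebra given by a family satisfying its
relations. -/
def Hecke.lift (T : Fin (n - 1) → A) (H : SatHecke T) : Hecke n →ₐ[K] A :=
  Presented.lift T fun a b h => by
    have h' := h.map (FreeAlgebra.lift K T)
    simp only [FreeAlgebra.lift_ι_apply] at h'
    exact H _ _ h'

theorem Hecke.lift_T {T : Fin (n - 1) → A} (H : SatHecke T) (i : Fin (n - 1)) :
    Hecke.lift T H (Hecke.T i) = T i :=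
  Presented.lift_gen _ _ _

/-- The homomorphism out of the double affine Hecke algebra given by families satisfying its
relations. -/
def Daha.lift (T : Fin (n - 1) → A) (θ X : Fin n → A) (H : SatDaha T θ X) : Daha n →ₐ[K] A :=
  let onGen : DahaGen n → A := fun
    | .T i => T i
    | .θ i => θ i
    | .X i => X i
  Presented.lift onGen fun a b h => by
    have h' := h.map (FreeAlgebra.lift K onGen)
    simp only [FreeAlgebra.lift_ι_apply] at h'
    exact H _ _ h'

variable {T : Fin (n - 1) → A} {θ X : Fin n → A} (H : SatDaha T θ X)

theorem Daha.lift_T (i : Fin (n - 1)) : Daha.lift T θ X H (Daha.T i) = T i :=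
  Presented.lift_gen _ _ _

theorem Daha.lift_θ (i : Fin n) : Daha.lift T θ X H (Daha.θ i) = θ i :=
  Presented.lift_gen _ _ _

theorem Daha.lift_X (i : Fin n) : Daha.lift T θ X H (Daha.X i) = X i :=
  Presented.lift_gen _ _ _

theorem Presented.induction {G : Type} {r : FreeAlgebra K G → FreeAlgebra K G → Prop}
    {C : Presented G r → Prop} (algebraMap : ∀ k, C (algebraMap K _ k))
    (gen : ∀ g, C (Presented.gen r g)) (mul : ∀ a b, C a → C b → C (a * b))
    (add : ∀ a b, C a → C b → C (a + b)) (x : Presented G r) : C x := by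
  obtain ⟨x, rfl⟩ := RingQuot.mkAlgHom_surjective K r x
  change C (Presented.mk r x)
  induction x using FreeAlgebra.induction with
  | grade0 k => rw [AlgHom.commutes]; exact algebraMap k
  | grade1 g => exact gen g
  | mul a b ha hb => rw [map_mul]; exact mul _ _ ha hb
  | add a b ha hb => rw [map_add]; exact add _ _ ha hb

end UniversalProperty

section IndexByNat

variable {n : ℕ} {A : Type} [Ring A] [Algebra K A]

/-- The parameter `t` as a unit of `ℚ(q,t)`. -/
def tUnit : Kˣ := Units.mk0 t t_ne_zero

/-- The generator `T_i` of the Hecke algebra as a unit with inverse `Tinv T i`. -/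
def SatHecke.unit {T : Fin (n - 1) → A} (hT : SatHecke T) (i : Fin (n - 1)) : Aˣ :=
  ⟨T i, Tinv T i, T_mul_Tinv hT i, Tinv_mul_T hT i⟩

theorem extend_val_of_lt {α : Type*} {m k : ℕ} (f : Fin m → α) (g : ℕ → α) (h : k < m) :
    Function.extend Fin.val f g k = f ⟨k, h⟩ :=
  Fin.val_injective.extend_apply f g ⟨k, h⟩

variable {T : Fin (n - 1) → A} {θ : Fin n → A}

/-- The `ℕ`-indexed form of families satisfying the affine Hecke relations. -/
def SatAffine.braidFamily (H : SatAffine T θ) (hn : 0 < n) :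
    AffineBraidFamily tUnit A (n - 1) where
  T := Function.extend Fin.val H.satHecke.unit 1
  θ := Function.extend Fin.val θ 1
  braid k h := by
    rw [extend_val_of_lt _ _ h, extend_val_of_lt _ _ (by omega)]
    exact Units.ext (H _ _ (.hecke (.braid _ _ rfl)))
  comm j k h hk := by
    rw [extend_val_of_lt _ _ hk, extend_val_of_lt _ _ (by omega)]
    exact .units_of_val (H _ _ (.hecke (.comm _ _ (.inl h))))
  theta_comm j k hj hk := by
    rw [extend_val_of_lt _ _ (show k < n by omega), extend_val_of_lt _ _ (show j < n by omega)]
    exact H _ _ (.theta_comm _ _)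
  theta_succ k h := by
    rw [extend_val_of_lt _ _ h, extend_val_of_lt _ _ (show k < n by omega),
      extend_val_of_lt _ _ (show k + 1 < n by omega)]
    exact H _ _ (.theta_succ ⟨k, h⟩)
  T_theta k j hk hj h h' := by
    rw [extend_val_of_lt _ _ hk, extend_val_of_lt _ _ (show j < n by omega)]
    exact H _ _ (.T_theta ⟨k, hk⟩ ⟨j, by omega⟩ (h ∘ congrArg Fin.val) (h' ∘ congrArg Fin.val))

variable (H : SatAffine T θ) (hn : 0 < n)

theorem SatAffine.braidFamily_T (i : Fin (n - 1)) :
    (H.braidFamily hn).T i = H.satHecke.unit i :=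
  Fin.val_injective.extend_apply _ _ i

theorem SatAffine.braidFamily_θ (i : Fin n) : (H.braidFamily hn).θ i = θ i :=
  Fin.val_injective.extend_apply _ _ i

theorem SatAffine.braidFamily_pi : (H.braidFamily hn).pi = piElt T θ hn := by
  have hseg : ((segment (H.braidFamily hn).T⁻¹ 0 (n - 1) : Aˣ) : A) =
      (List.ofFn (Tinv T)).prod := by
    rw [segment, ← Units.coeHom_apply, map_list_prod, List.map_ofFn]
    congr 2
    funext i
    rw [Function.comp_apply, Units.coeHom_apply, zero_add, Pi.inv_apply, H.braidFamily_T hn]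
    rfl
  rw [AffineBraidFamily.pi, hseg]
  exact congrArg (fun x => t ^ (n - 1) • (x * (List.ofFn (Tinv T)).prod))
    (H.braidFamily_θ hn ⟨0, hn⟩)

theorem ShiftLift.satDaha (E : ShiftLift q (H.braidFamily hn)) :
    SatDaha T θ fun k => E.X k := by
  have T_eq : ∀ i : Fin (n - 1), T i = ((H.braidFamily hn).T i : Aˣ) := fun i => by
    rw [H.braidFamily_T hn]
    rfl
  intro a b h
  cases h with
  | affine h => exact H _ _ h
  | X_comm i j =>
    rcases lt_trichotomy i.1 j.1 with h | h | h
    · exact E.commute_X_of_lt (by omega) h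
    · rw [h]
    · exact (E.commute_X_of_lt (by omega) h).symm
  | X_succ i =>
    have h := E.X_succ i.2
    rw [H.braidFamily_T hn] at h
    exact h
  | T_X i j h h' =>
    rw [T_eq]
    have hlo : j.1 ≠ i.1 := fun e => h (Fin.ext e)
    have hhi : j.1 ≠ i.1 + 1 := fun e => h' (Fin.ext e)
    rcases lt_or_gt_of_ne hlo with h | h
    · exact E.commute_T_X_of_gt i.2 h
    · exact E.commute_T_X_of_lt (by omega) (by omega)
  | pi_X _ i =>
    rw [← H.braidFamily_pi hn]
    exact E.pi_X i.2
  | pi_X_last _ =>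
    rw [← H.braidFamily_pi hn]
    exact E.pi_X_last

end IndexByNat

/-! ### Seminormal forms and weights -/

section Seminormal

variable {F : Type*} [Field F]

/-- The eigenvalue-dependent diagonal coefficient of a Hecke generator `T` with parameter `s` in
seminormal form: `T` maps a joint eigenvector with neighbouring weights `x, y` to
`seminormalDiag s x y` times itself plus a multiple of the vector with weights `y, x`. -/
def seminormalDiag (s x y : F) : F := (1 - s) * x / (x - y)

/-- The product of the two off-diagonal coefficients of a Hecke generator in seminormal form; only
this product is determined by the relations. -/
def seminormalOffProd (s x y : F) : F := (s * x - y) * (x - s * y) / (x - y) ^ 2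

theorem seminormalOffProd_comm (s x y : F) :
    seminormalOffProd s x y = seminormalOffProd s y x := by
  rw [seminormalOffProd, seminormalOffProd, ← neg_sub x y, neg_sq]
  ring

theorem seminormalDiag_add (s : F) {x y : F} (h : x ≠ y) :
    seminormalDiag s x y + seminormalDiag s y x = 1 - s := by
  have hxy := sub_ne_zero.2 h
  have hyx := sub_ne_zero.2 h.symm
  simp only [seminormalDiag]
  field_simp
  ring

theorem seminormalDiag_mul_add (s : F) {x y : F} (h : x ≠ y) :
    seminormalDiag s x y * seminormalDiag s y x + s = seminormalOffProd s x y := by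
  have hxy := sub_ne_zero.2 h
  have hyx := sub_ne_zero.2 h.symm
  simp only [seminormalDiag, seminormalOffProd]
  field_simp
  ring

theorem mul_seminormalDiag (s x y : F) :
    y * seminormalDiag s x y = -(x * seminormalDiag s y x) := by
  rw [seminormalDiag, seminormalDiag, ← neg_sub x y, div_neg]
  ring

theorem seminormalDiag_mul_mul {s a x y : F} (ha : a ≠ 0) :
    seminormalDiag s (a * x) (a * y) = seminormalDiag s x y := by
  rw [seminormalDiag, seminormalDiag, ← mul_sub, mul_left_comm, mul_div_mul_left _ _ ha]

theorem seminormalDiag_mul_diag {s x y z : F} (hxy : x ≠ y) (hxz : x ≠ z) (hyz : y ≠ z) :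
    seminormalDiag s x y * seminormalDiag s y z + seminormalDiag s y x * seminormalDiag s x z =
      seminormalDiag s y z * seminormalDiag s x z := by
  have h₁ := sub_ne_zero.2 hxy
  have h₂ := sub_ne_zero.2 hxz
  have h₃ := sub_ne_zero.2 hyz
  rw [show seminormalDiag s y x = (s - 1) * y / (x - y) by
    rw [seminormalDiag, ← neg_sub x, div_neg, ← neg_div]; ring]
  simp only [seminormalDiag]
  field_simp
  ring

theorem seminormalDiag_mul_diag' {s x y z : F} (hxy : x ≠ y) (hxz : x ≠ z) (hyz : y ≠ z) :
    seminormalDiag s x y * seminormalDiag s x z =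
      seminormalDiag s y z * seminormalDiag s x y +
        seminormalDiag s z y * seminormalDiag s x z := by
  have h₁ := sub_ne_zero.2 hxy
  have h₂ := sub_ne_zero.2 hxz
  have h₃ := sub_ne_zero.2 hyz
  rw [show seminormalDiag s z y = (s - 1) * z / (y - z) by
    rw [seminormalDiag, ← neg_sub y, div_neg, ← neg_div]; ring]
  simp only [seminormalDiag]
  field_simp
  ring

theorem seminormalDiag_sq_mul {s x y z : F} (hxy : x ≠ y) (hxz : x ≠ z) (hyz : y ≠ z) :
    seminormalDiag s x y * (seminormalDiag s y z * seminormalDiag s x y) +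
        seminormalDiag s x z * seminormalOffProd s x y =
      seminormalDiag s y z * (seminormalDiag s x y * seminormalDiag s y z) +
        seminormalDiag s x z * seminormalOffProd s y z := by
  have h₁ := sub_ne_zero.2 hxy
  have h₂ := sub_ne_zero.2 hxz
  have h₃ := sub_ne_zero.2 hyz
  simp only [seminormalDiag, seminormalOffProd]
  field_simp
  ring

theorem seminormal_braid {M ι : Type*} [AddCommGroup M] [Module F M] (s : F) (wt : ι → F)
    (b : ι → ι → F) (hb : ∀ u v, wt u ≠ wt v → b u v * b v u = seminormalOffProd s (wt u) (wt v))
    (f : ι → ι → ι → M) (S T : M →ₗ[F] M)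
    (hS : ∀ u v w, S (f u v w) = seminormalDiag s (wt u) (wt v) • f u v w + b u v • f v u w)
    (hT : ∀ u v w, T (f u v w) = seminormalDiag s (wt v) (wt w) • f u v w + b v w • f u w v)
    {u v w : ι} (huv : wt u ≠ wt v) (huw : wt u ≠ wt w) (hvw : wt v ≠ wt w) :
    S (T (S (f u v w))) = T (S (T (f u v w))) := by
  have hdiag := seminormalDiag_sq_mul (s := s) huv huw hvw
  rw [← hb u v huv, ← hb v w hvw] at hdiag
  simp only [hS, hT, map_add, map_smul, smul_add, smul_smul]
  linear_combination (norm := module) hdiag • f u v w +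
    (b u v * seminormalDiag_mul_diag huv huw hvw) • f v u w +
    (b v w * seminormalDiag_mul_diag' huv huw hvw) • f u w v

end Seminormal

section Weights

theorem q_ne_zero : q ≠ 0 := by
  rw [q, Ne, IsFractionRing.to_map_eq_zero_iff]
  exact MvPolynomial.X_ne_zero 0

theorem q_pow_mul_t_pow (a b : ℕ) :
    q ^ a * t ^ b = algebraMap (MvPolynomial (Fin 2) ℚ) K
      (MvPolynomial.monomial (Finsupp.single 0 a + Finsupp.single 1 b) 1) := by
  rw [q, t, ← map_pow, ← map_pow, ← map_mul, MvPolynomial.X_pow_eq_monomial,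
    MvPolynomial.X_pow_eq_monomial, MvPolynomial.monomial_mul, one_mul]

theorem q_pow_mul_t_pow_inj {a b a' b' : ℕ} (h : q ^ a * t ^ b = q ^ a' * t ^ b') :
    a = a' ∧ b = b' := by
  rw [q_pow_mul_t_pow, q_pow_mul_t_pow] at h
  have hexp := MvPolynomial.monomial_left_injective (R := ℚ) one_ne_zero
    (IsFractionRing.injective (MvPolynomial (Fin 2) ℚ) K h)
  exact ⟨by simpa using DFunLike.congr_fun hexp 0, by simpa using DFunLike.congr_fun hexp 1⟩

/-- The scalar `q ^ a * t ^ b` attached to a pair of exponents `(a, b)`, which are the labelling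
exponent and the content of a box. -/
def wt (u : ℕ × ℤ) : K := q ^ u.1 * t ^ u.2

theorem wt_ne_zero (u : ℕ × ℤ) : wt u ≠ 0 :=
  mul_ne_zero (pow_ne_zero _ q_ne_zero) (zpow_ne_zero _ t_ne_zero)

theorem wt_injective : Function.Injective wt := by
  rintro ⟨a, b⟩ ⟨a', b'⟩ h
  obtain ⟨m, e, e', he, he'⟩ : ∃ m e e' : ℕ, b + m = e ∧ b' + m = e' :=
    ⟨b.natAbs + b'.natAbs, (b + (b.natAbs + b'.natAbs : ℕ)).toNat,
      (b' + (b.natAbs + b'.natAbs : ℕ)).toNat, by omega, by omega⟩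
  have clear_denominators (a : ℕ) {b : ℤ} {e : ℕ} (h : b + m = e) :
      q ^ a * t ^ e = wt (a, b) * t ^ m := by
    rw [← zpow_natCast t e, ← h, zpow_add₀ t_ne_zero, zpow_natCast, wt, mul_assoc]
  obtain ⟨rfl, hee'⟩ := q_pow_mul_t_pow_inj
    ((clear_denominators a he).trans (h ▸ (clear_denominators a' he').symm))
  exact Prod.ext rfl (by dsimp only; omega)

theorem wt_succ_fst (a : ℕ) (b : ℤ) : wt (a + 1, b) = q * wt (a, b) := by
  simp only [wt, pow_succ]
  ring

theorem wt_succ_snd (a : ℕ) (b : ℤ) : wt (a, b + 1) = t * wt (a, b) := by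
  simp only [wt, zpow_add₀ t_ne_zero, zpow_one]
  ring

theorem t_ne_one : t ≠ 1 := by
  intro h
  have : wt (0, 1) = wt (0, 0) := by simp [wt, h]
  simpa using wt_injective this

/-- The condition on the exponents of the labels `i` and `i + 1` under which exchanging these two
labels of a tableau goes up in the order on tableaux. -/
def IsAscent (u v : ℕ × ℤ) : Prop := u.1 < v.1 ∨ (u.1 = v.1 ∧ 1 < u.2 - v.2)

theorem IsAscent.not_symm {u v : ℕ × ℤ} (h : IsAscent u v) : ¬ IsAscent v u := by
  unfold IsAscent at *
  omega

theorem isAscent_shift (u v : ℕ × ℤ) :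
    IsAscent (u.1 + 1, u.2) (v.1 + 1, v.2) ↔ IsAscent u v := by
  simp only [IsAscent, Nat.add_lt_add_iff_right, Nat.add_right_cancel_iff]

theorem eq_or_succ_of_not_isAscent {u v : ℕ × ℤ} (h : ¬ IsAscent u v) (h' : ¬ IsAscent v u) :
    u = v ∨ v = (u.1, u.2 + 1) ∨ u = (v.1, v.2 + 1) := by
  unfold IsAscent at *
  simp only [Prod.ext_iff]
  omega

/-- The diagonal coefficient of `T_i` on a tableau whose labels `i, i + 1` have exponents `u, v`. -/
def diagCoeff (u v : ℕ × ℤ) : K := seminormalDiag t (wt u) (wt v)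

open Classical in
/-- The off-diagonal coefficient of `T_i` on a tableau whose labels `i, i + 1` have exponents
`u, v`, normalised to be `1` on ascents. -/
def offCoeff (u v : ℕ × ℤ) : K :=
  if IsAscent u v then 1 else if IsAscent v u then seminormalOffProd t (wt u) (wt v) else 0

theorem offCoeff_of_isAscent {u v : ℕ × ℤ} (h : IsAscent u v) : offCoeff u v = 1 := if_pos h

theorem offCoeff_of_isAscent_symm {u v : ℕ × ℤ} (h : IsAscent v u) :
    offCoeff u v = seminormalOffProd t (wt u) (wt v) := by
  rw [offCoeff, if_neg h.not_symm, if_pos h]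

theorem offCoeff_eq_zero {u v : ℕ × ℤ} (h : ¬ IsAscent u v) (h' : ¬ IsAscent v u) :
    offCoeff u v = 0 := by
  rw [offCoeff, if_neg h, if_neg h']

theorem offCoeff_succ_right (u : ℕ × ℤ) : offCoeff u (u.1, u.2 + 1) = 0 :=
  offCoeff_eq_zero (by simp [IsAscent]) (by simp [IsAscent])

theorem offCoeff_succ_left (v : ℕ × ℤ) : offCoeff (v.1, v.2 + 1) v = 0 :=
  offCoeff_eq_zero (by simp [IsAscent]) (by simp [IsAscent])

theorem offCoeff_mul_offCoeff {u v : ℕ × ℤ} (h : u ≠ v) :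
    offCoeff u v * offCoeff v u = seminormalOffProd t (wt u) (wt v) := by
  by_cases huv : IsAscent u v
  · rw [offCoeff_of_isAscent huv, offCoeff_of_isAscent_symm huv, one_mul, seminormalOffProd_comm]
  by_cases hvu : IsAscent v u
  · rw [offCoeff_of_isAscent hvu, offCoeff_of_isAscent_symm hvu, mul_one]
  rw [offCoeff_eq_zero huv hvu, zero_mul]
  obtain rfl | hv | hu := eq_or_succ_of_not_isAscent huv hvu
  · exact absurd rfl h
  · rw [hv, wt_succ_snd, seminormalOffProd, sub_self, zero_mul, zero_div]
  · rw [hu, wt_succ_snd, seminormalOffProd, sub_self, mul_zero, zero_div]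

theorem offCoeff_shift (u v : ℕ × ℤ) :
    offCoeff (u.1 + 1, u.2) (v.1 + 1, v.2) = offCoeff u v := by
  have hprod : seminormalOffProd t (q * wt u) (q * wt v) = seminormalOffProd t (wt u) (wt v) := by
    simp only [seminormalOffProd, mul_left_comm t q, ← mul_sub, mul_pow]
    rw [mul_mul_mul_comm, ← sq, mul_div_mul_left _ _ (pow_ne_zero 2 q_ne_zero)]
  rw [offCoeff, offCoeff, wt_succ_fst, wt_succ_fst, hprod]
  classical
  exact if_congr (isAscent_shift u v) rfl (if_congr (isAscent_shift v u) rfl rfl)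

theorem diagCoeff_shift (u v : ℕ × ℤ) :
    diagCoeff (u.1 + 1, u.2) (v.1 + 1, v.2) = diagCoeff u v := by
  simp only [diagCoeff, wt_succ_fst, seminormalDiag_mul_mul q_ne_zero]

theorem diagCoeff_add {u v : ℕ × ℤ} (h : u ≠ v) : diagCoeff u v + diagCoeff v u = 1 - t :=
  seminormalDiag_add t (wt_injective.ne h)

theorem diagCoeff_mul_add {u v : ℕ × ℤ} (h : u ≠ v) :
    diagCoeff u v * diagCoeff v u + t = offCoeff u v * offCoeff v u := by
  rw [offCoeff_mul_offCoeff h]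
  exact seminormalDiag_mul_add t (wt_injective.ne h)

theorem wt_mul_diagCoeff (u v : ℕ × ℤ) : wt v * diagCoeff u v = -(wt u * diagCoeff v u) :=
  mul_seminormalDiag t (wt u) (wt v)

theorem diagCoeff_succ_right (u : ℕ × ℤ) : diagCoeff u (u.1, u.2 + 1) = 1 := by
  have h : (1 - t) * wt u ≠ 0 := mul_ne_zero (sub_ne_zero.2 t_ne_one.symm) (wt_ne_zero u)
  rw [diagCoeff, seminormalDiag, wt_succ_snd, ← one_sub_mul, div_self h]

theorem diagCoeff_succ_left (v : ℕ × ℤ) : diagCoeff (v.1, v.2 + 1) v = -t := by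
  have h : (t - 1) * wt v ≠ 0 := mul_ne_zero (sub_ne_zero.2 t_ne_one) (wt_ne_zero v)
  rw [diagCoeff, seminormalDiag, wt_succ_snd, ← sub_one_mul, div_eq_iff h]
  ring

end Weights

/-! ### Periodic standard tableaux -/

theorem lo_val {n : ℕ} (i : Fin (n - 1)) : (lo i).1 = i.1 := rfl

theorem hi_val {n : ℕ} (i : Fin (n - 1)) : (hi i).1 = i.1 + 1 := rfl

theorem lo_ne_hi {n : ℕ} (i : Fin (n - 1)) : lo i ≠ hi i := by
  simp [lo, hi]

theorem labelLt_iff {n : ℕ} {x y : Fin n × ℕ} :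
    LabelLt x y ↔ y.2 < x.2 ∨ (x.2 = y.2 ∧ x.1.1 < y.1.1) := Iff.rfl

theorem LabelLt.trans {n : ℕ} {x y z : Fin n × ℕ} (h : LabelLt x y) (h' : LabelLt y z) :
    LabelLt x z := by
  rw [labelLt_iff] at *
  omega

theorem LabelLt.not_symm {n : ℕ} {x y : Fin n × ℕ} (h : LabelLt x y) : ¬ LabelLt y x := by
  rw [labelLt_iff] at *
  omega

section Cells

variable {μ : YoungDiagram}

/-- The cell of `μ` at a position weakly north-west of a given cell. -/
def cellOfLE (b : μ.cells) (x : ℕ × ℕ) (h : x ≤ b.1) : μ.cells := ⟨x, μ.isLowerSet h b.2⟩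

theorem cell_covBy {b b' : μ.cells} (h : b ⋖ b') :
    b.1.1 = b'.1.1 ∧ b.1.2 + 1 = b'.1.2 ∨ b.1.2 = b'.1.2 ∧ b.1.1 + 1 = b'.1.1 := by
  have hμ : (Set.range (OrderEmbedding.subtype (· ∈ μ.cells))).OrdConnected := by
    rw [OrderEmbedding.coe_subtype, Subtype.range_coe_subtype]
    exact μ.isLowerSet.ordConnected
  have hcov : b.1 ⋖ b'.1 := (hμ.apply_covBy_apply_iff _).2 h
  rw [Prod.covBy_iff, Nat.covBy_iff_add_one_eq, Nat.covBy_iff_add_one_eq] at hcov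
  omega

theorem le_or_le_of_content_eq {b b' : ℕ × ℕ} (h : content b = content b') : b ≤ b' ∨ b' ≤ b := by
  simp only [content, Prod.le_def] at *
  omega

end Cells

namespace PSYT

variable {n : ℕ} {μ : YoungDiagram}

theorem box_label (τ : PSYT n μ) (b : μ.cells) : τ.box (τ.label b).1 = b :=
  (Equiv.ofBijective _ τ.bij).symm_apply_apply b

theorem label_box_fst (τ : PSYT n μ) (i : Fin n) : (τ.label (τ.box i)).1 = i :=
  (Equiv.ofBijective _ τ.bij).apply_symm_apply i

theorem label_box (τ : PSYT n μ) (i : Fin n) : τ.label (τ.box i) = (i, τ.w i) :=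
  Prod.ext (τ.label_box_fst i) rfl

theorem w_label (τ : PSYT n μ) (b : μ.cells) : τ.w (τ.label b).1 = (τ.label b).2 := by
  rw [w, box_label]

theorem box_injective (τ : PSYT n μ) : Function.Injective τ.box :=
  (Equiv.ofBijective _ τ.bij).symm.injective

theorem box_eq_of_label_eq {τ : PSYT n μ} {b : μ.cells} {i : Fin n} {m : ℕ}
    (h : τ.label b = (i, m)) : τ.box i = b := by
  rw [← τ.box_label b, h]

theorem w_eq_of_label_eq {τ : PSYT n μ} {b : μ.cells} {i : Fin n} {m : ℕ}
    (h : τ.label b = (i, m)) : τ.w i = m := by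
  rw [w, box_eq_of_label_eq h, h]

/-- The exponents `(w_τ(i), c_τ(i))` of the weight of `τ`. -/
def exponents (τ : PSYT n μ) (i : Fin n) : ℕ × ℤ := (τ.w i, τ.c i)

theorem label_lt_label (τ : PSYT n μ) {b b' : μ.cells} (h : b < b') :
    LabelLt (τ.label b) (τ.label b') := by
  obtain ⟨⟨hr, hc⟩, hne⟩ := (lt_iff_le_and_ne (a := b) (b := b')).1 h
  let m : μ.cells := cellOfLE b' (b.1.1, b'.1.2) ⟨hr, le_rfl⟩
  obtain hr | hr := hr.eq_or_lt
  · exact τ.row_lt b b' hr (hc.lt_of_ne fun hc => hne (Subtype.ext (Prod.ext hr hc)))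
  obtain hc | hc := hc.eq_or_lt
  · exact τ.col_lt b b' hc hr
  · exact (τ.row_lt b m rfl hc).trans (τ.col_lt m b' rfl hr)

theorem not_box_le_box {τ : PSYT n μ} {i j : Fin n} (hij : i < j) (hw : τ.w i = τ.w j) :
    ¬ τ.box j ≤ τ.box i := by
  intro h
  have hlt := τ.label_lt_label (h.lt_of_ne (τ.box_injective.ne hij.ne'))
  simp only [label_box, labelLt_iff, Fin.lt_def] at hlt hij
  omega

theorem label_between {τ : PSYT n μ} {i j : Fin n} (hw : τ.w i = τ.w j) {b : μ.cells}
    (hi : τ.box i < b) (hj : b < τ.box j) : i < (τ.label b).1 ∧ (τ.label b).1 < j := by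
  have hi := τ.label_lt_label hi
  have hj := τ.label_lt_label hj
  simp only [label_box, labelLt_iff] at hi hj
  simp only [Fin.lt_def]
  omega

theorem box_covBy_box {τ : PSYT n μ} {i : Fin (n - 1)} (hw : τ.w (lo i) = τ.w (hi i))
    (h : τ.box (lo i) < τ.box (hi i)) : τ.box (lo i) ⋖ τ.box (hi i) := by
  refine ⟨h, fun b hlo hhi => ?_⟩
  have hb := label_between hw hlo hhi
  simp only [Fin.lt_def, lo_val, hi_val] at hb
  omega

theorem exponents_hi_of_row {τ : PSYT n μ} {i : Fin (n - 1)} (hw : τ.w (lo i) = τ.w (hi i))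
    (h : (τ.box (lo i)).1.1 = (τ.box (hi i)).1.1) :
    τ.exponents (hi i) = ((τ.exponents (lo i)).1, (τ.exponents (lo i)).2 + 1) := by
  have hlt : τ.box (lo i) < τ.box (hi i) := by
    have hnot := not_box_le_box (Nat.lt_succ_self i.1 : lo i < hi i) hw
    simp only [← Subtype.coe_le_coe, ← Subtype.coe_lt_coe, Prod.le_def, Prod.lt_iff] at *
    omega
  have hcov := cell_covBy (box_covBy_box hw hlt)
  simp only [exponents, hw, Prod.mk.injEq, true_and, c, content]
  omega

theorem exponents_lo_of_col {τ : PSYT n μ} {i : Fin (n - 1)} (hw : τ.w (lo i) = τ.w (hi i))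
    (h : (τ.box (lo i)).1.2 = (τ.box (hi i)).1.2) :
    τ.exponents (lo i) = ((τ.exponents (hi i)).1, (τ.exponents (hi i)).2 + 1) := by
  have hlt : τ.box (lo i) < τ.box (hi i) := by
    have hnot := not_box_le_box (Nat.lt_succ_self i.1 : lo i < hi i) hw
    simp only [← Subtype.coe_le_coe, ← Subtype.coe_lt_coe, Prod.le_def, Prod.lt_iff] at *
    omega
  have hcov := cell_covBy (box_covBy_box hw hlt)
  simp only [exponents, hw, Prod.mk.injEq, true_and, c, content]
  omega

/-- The labels `i` and `i + 1` of `τ` are ordered either way by `IsAscent`; by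
`swappable_or_covBy` and `IsSwap.swappable` this is the condition for `s_i(τ)` to be a tableau. -/
def Swappable (τ : PSYT n μ) (i : Fin (n - 1)) : Prop :=
  IsAscent (τ.exponents (lo i)) (τ.exponents (hi i)) ∨
    IsAscent (τ.exponents (hi i)) (τ.exponents (lo i))

theorem Swappable.not_box_lt_box {τ : PSYT n μ} {i : Fin (n - 1)} (h : τ.Swappable i)
    (hw : τ.w (lo i) = τ.w (hi i)) : ¬ τ.box (lo i) < τ.box (hi i) := by
  intro hlt
  have hcov := cell_covBy (box_covBy_box hw hlt)
  simp only [Swappable, IsAscent, exponents, c, content] at h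
  omega

theorem swappable_or_covBy (τ : PSYT n μ) (i : Fin (n - 1)) :
    τ.Swappable i ∨ τ.w (lo i) = τ.w (hi i) ∧ τ.box (lo i) ⋖ τ.box (hi i) := by
  by_cases hw : τ.w (lo i) = τ.w (hi i)
  · by_cases hlt : τ.box (lo i) < τ.box (hi i)
    · exact .inr ⟨hw, box_covBy_box hw hlt⟩
    · have hnot := not_box_le_box (Nat.lt_succ_self i.1 : lo i < hi i) hw
      simp only [← Subtype.coe_le_coe, ← Subtype.coe_lt_coe, Prod.le_def, Prod.lt_iff] at *
      simp only [Swappable, IsAscent, exponents, c, content]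
      omega
  · simp only [Swappable, IsAscent, exponents]
    omega

theorem add_two_lt_of_exponents_eq {τ : PSYT n μ} {i j : Fin n} (hij : i < j)
    (h : τ.exponents i = τ.exponents j) : i.1 + 2 < j.1 := by
  obtain ⟨hw, hc⟩ := Prod.mk.inj h
  have hle := (le_or_le_of_content_eq hc).resolve_right (not_box_le_box hij hw)
  have hlt : (τ.box i).1.1 < (τ.box j).1.1 ∧ (τ.box i).1.2 < (τ.box j).1.2 := by
    have hne := not_box_le_box hij hw
    simp only [← Subtype.coe_le_coe, Prod.le_def, c, content] at *
    omega
  let ne : μ.cells := cellOfLE (τ.box j) ((τ.box i).1.1, (τ.box j).1.2) ⟨hlt.1.le, le_rfl⟩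
  let sw : μ.cells := cellOfLE (τ.box j) ((τ.box j).1.1, (τ.box i).1.2) ⟨le_rfl, hlt.2.le⟩
  have hne : i < (τ.label ne).1 ∧ (τ.label ne).1 < j :=
    label_between hw (Prod.lt_iff.2 (.inr ⟨le_rfl, hlt.2⟩)) (Prod.lt_iff.2 (.inl ⟨hlt.1, le_rfl⟩))
  have hsw : i < (τ.label sw).1 ∧ (τ.label sw).1 < j :=
    label_between hw (Prod.lt_iff.2 (.inl ⟨hlt.1, le_rfl⟩)) (Prod.lt_iff.2 (.inr ⟨le_rfl, hlt.2⟩))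
  have hdistinct : (τ.label ne).1 ≠ (τ.label sw).1 := by
    intro e
    have hcell : ne = sw := τ.bij.1 e
    exact hlt.1.ne (congrArg (fun b : μ.cells => b.1.1) hcell :)
  simp only [Fin.lt_def, Ne, Fin.ext_iff] at *
  omega

theorem exponents_lo_ne_hi (τ : PSYT n μ) (i : Fin (n - 1)) :
    τ.exponents (lo i) ≠ τ.exponents (hi i) := by
  intro h
  have := add_two_lt_of_exponents_eq (Nat.lt_succ_self i.1 : lo i < hi i) h
  simp only [lo_val, hi_val] at this
  omega

theorem exponents_ne_of_add_two_eq (τ : PSYT n μ) {i j : Fin n} (hij : i.1 + 2 = j.1) :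
    τ.exponents i ≠ τ.exponents j := by
  intro h
  have := add_two_lt_of_exponents_eq (Fin.lt_def.2 (by omega)) h
  omega

theorem box_eq_box_of_le {τ σ : PSYT n μ} {i : Fin n} (hle : τ.box i ≤ σ.box i)
    (ih : ∀ j, LabelLt (j, σ.w j) (i, σ.w i) → τ.box j = σ.box j) : τ.box i = σ.box i := by
  by_contra hne
  have hlt := σ.label_lt_label (hle.lt_of_ne hne)
  rw [label_box, ← Prod.mk.eta (p := σ.label (τ.box i)), ← w_label] at hlt
  have hbox := ih _ hlt
  rw [box_label] at hbox
  exact hne ((congrArg σ.box (τ.box_injective hbox)).symm.trans (σ.box_label _)).symm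

theorem exponents_injective : Function.Injective (exponents : PSYT n μ → Fin n → ℕ × ℤ) := by
  intro τ σ h
  have hw : τ.w = σ.w := funext fun i => congrArg Prod.fst (congrFun h i)
  have hc : τ.c = σ.c := funext fun i => congrArg Prod.snd (congrFun h i)
  let r : Fin n → Fin n → Prop := fun i j => LabelLt (i, σ.w i) (j, σ.w j)
  have : IsTrans (Fin n) r := ⟨fun _ _ _ => LabelLt.trans⟩
  have : Std.Irrefl r := ⟨fun _ h => h.not_symm h⟩
  have wf : WellFounded r := Finite.wellFounded_of_trans_of_irrefl r
  have hbox : ∀ i, τ.box i = σ.box i := fun i => by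
    induction i using wf.induction with
    | h i ih =>
      rcases le_or_le_of_content_eq (congrFun hc i) with hle | hle
      · exact box_eq_box_of_le hle ih
      · exact (box_eq_box_of_le hle fun j hj => (ih j (by rwa [hw] at hj)).symm).symm
  ext1
  funext b
  have hb := σ.label_box (τ.label b).1
  rw [← hbox, box_label, ← hw, w_label] at hb
  exact hb.symm

theorem labelLt_swap {i : Fin (n - 1)} {x y : Fin n × ℕ} (h : LabelLt x y)
    (h' : ¬ (x.1 = lo i ∧ y.1 = hi i ∧ x.2 = y.2)) :
    LabelLt (Equiv.swap (lo i) (hi i) x.1, x.2) (Equiv.swap (lo i) (hi i) y.1, y.2) := by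
  simp only [labelLt_iff, Equiv.swap_apply_def] at *
  split_ifs <;> simp only [Fin.ext_iff, lo_val, hi_val] at * <;> omega

theorem Swappable.labelLt {τ : PSYT n μ} {i : Fin (n - 1)} (h : τ.Swappable i) {b b' : μ.cells}
    (hb : b < b') :
    LabelLt (Equiv.swap (lo i) (hi i) (τ.label b).1, (τ.label b).2)
      (Equiv.swap (lo i) (hi i) (τ.label b').1, (τ.label b').2) := by
  refine labelLt_swap (τ.label_lt_label hb) ?_
  rintro ⟨hlo, hhi, hw⟩
  rw [← w_label, ← w_label, hlo, hhi] at hw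
  refine h.not_box_lt_box hw ?_
  rwa [← hlo, ← hhi, box_label, box_label]

/-- The tableau `s_i(τ)`. -/
def swap (τ : PSYT n μ) (i : Fin (n - 1)) (h : τ.Swappable i) : PSYT n μ where
  label b := (Equiv.swap (lo i) (hi i) (τ.label b).1, (τ.label b).2)
  bij := (Equiv.swap (lo i) (hi i)).bijective.comp τ.bij
  row_lt _ _ hr hc := h.labelLt (Prod.lt_iff.2 (.inr ⟨hr.le, hc⟩))
  col_lt _ _ hc hr := h.labelLt (Prod.lt_iff.2 (.inl ⟨hr, hc.le⟩))

theorem isSwap_swap (τ : PSYT n μ) (i : Fin (n - 1)) (h : τ.Swappable i) :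
    IsSwap i τ (τ.swap i h) := fun _ => rfl

section IsSwap

variable {i : Fin (n - 1)} {τ σ : PSYT n μ}

theorem IsSwap.label_box_swap (h : IsSwap i τ σ) (k : Fin n) :
    σ.label (τ.box (Equiv.swap (lo i) (hi i) k)) =
      (k, τ.w (Equiv.swap (lo i) (hi i) k)) := by
  rw [h, label_box, Equiv.swap_apply_self]

theorem IsSwap.box_eq (h : IsSwap i τ σ) (k : Fin n) :
    σ.box k = τ.box (Equiv.swap (lo i) (hi i) k) :=
  box_eq_of_label_eq (h.label_box_swap k)

theorem IsSwap.w_eq (h : IsSwap i τ σ) (k : Fin n) :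
    σ.w k = τ.w (Equiv.swap (lo i) (hi i) k) :=
  w_eq_of_label_eq (h.label_box_swap k)

theorem IsSwap.c_eq (h : IsSwap i τ σ) (k : Fin n) :
    σ.c k = τ.c (Equiv.swap (lo i) (hi i) k) := by
  rw [c, c, h.box_eq]

theorem IsSwap.exponents_eq (h : IsSwap i τ σ) :
    σ.exponents = τ.exponents ∘ Equiv.swap (lo i) (hi i) :=
  funext fun k => Prod.ext (h.w_eq k) (h.c_eq k)

theorem IsSwap.symm (h : IsSwap i τ σ) : IsSwap i σ τ := by
  intro b
  simp only [h b, Equiv.swap_apply_self, Prod.mk.eta]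

theorem IsSwap.swappable (h : IsSwap i τ σ) : τ.Swappable i := by
  refine τ.swappable_or_covBy i |>.resolve_right fun ⟨hw, hcov⟩ => ?_
  have hlt := σ.label_lt_label hcov.lt
  simp only [h _, label_box, Equiv.swap_apply_left, Equiv.swap_apply_right, labelLt_iff, hw, lo_val,
    hi_val] at hlt
  omega

end IsSwap

/-- The effect of `Ψ` on the exponents of a tableau: the entries move down by one place and the
first one reappears at the end with its power of `q` increased. -/
def shiftExponents (u : Fin n → ℕ × ℤ) (k : Fin n) : ℕ × ℤ :=
  if h : k.1 + 1 < n then u ⟨k.1 + 1, h⟩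
  else ((u ⟨0, k.pos⟩).1 + 1, (u ⟨0, k.pos⟩).2)

theorem exponents_eq_of_label_eq {τ : PSYT n μ} {b : μ.cells} {i : Fin n} {m : ℕ}
    (h : τ.label b = (i, m)) : τ.exponents i = (m, content b.1) := by
  rw [exponents, c, box_eq_of_label_eq h, w_eq_of_label_eq h]

theorem Psi_label_box (τ : PSYT n μ) (i : Fin n) :
    τ.Psi.label (τ.box i) = shiftLabel (i, τ.w i) := by
  rw [← label_box]
  rfl

theorem exponents_Psi (τ : PSYT n μ) : τ.Psi.exponents = shiftExponents τ.exponents := by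
  funext k
  rw [shiftExponents]
  split_ifs with hk
  · exact exponents_eq_of_label_eq ((τ.Psi_label_box ⟨k.1 + 1, hk⟩).trans (by simp [shiftLabel]))
  · refine exponents_eq_of_label_eq ((τ.Psi_label_box ⟨0, k.pos⟩).trans ?_)
    simp only [shiftLabel, if_true, Prod.mk.injEq, Fin.ext_iff]
    exact ⟨by omega, rfl⟩

theorem labelLt_of_shiftLabel {x y : Fin n × ℕ} (h : LabelLt (shiftLabel x) (shiftLabel y)) :
    LabelLt x y := by
  by_contra hxy
  by_cases hyx : LabelLt y x
  · exact (shiftLabel_lt hyx).not_symm h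
  · have heq : x = y := by
      simp only [labelLt_iff] at hxy hyx
      exact Prod.ext (Fin.ext (by omega)) (by omega)
    exact (heq ▸ h).not_symm (heq ▸ h)

theorem exists_shiftLabel_eq {x : Fin n × ℕ} (h : x.1.1 + 1 = n → 0 < x.2) :
    ∃ y, shiftLabel y = x := by
  by_cases hx : x.1.1 + 1 < n
  · exact ⟨(⟨x.1.1 + 1, hx⟩, x.2), by simp [shiftLabel]⟩
  · refine ⟨(⟨0, x.1.pos⟩, x.2 - 1), ?_⟩
    simp only [shiftLabel, if_true]
    exact Prod.ext (Fin.ext (by dsimp only; omega)) (by dsimp only; omega)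

theorem exists_Psi_eq (τ : PSYT n μ) {k : Fin n} (hk : k.1 + 1 = n) (h : 0 < τ.w k) :
    ∃ σ : PSYT n μ, σ.Psi = τ := by
  have hpre (b : μ.cells) : ∃ y, shiftLabel y = τ.label b := exists_shiftLabel_eq fun hb => by
    rwa [← w_label, show (τ.label b).1 = k from Fin.ext (by omega)]
  choose l hl using hpre
  have hlt {b b' : μ.cells} (hb : LabelLt (τ.label b) (τ.label b')) : LabelLt (l b) (l b') :=
    labelLt_of_shiftLabel (by rwa [hl, hl])
  have hinj : Function.Injective fun b => (l b).1 := fun b b' hb => τ.bij.1 <| by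
    simp only [← hl, shiftLabel, show (l b).1 = (l b').1 from hb]
    split_ifs <;> rfl
  exact ⟨⟨l, (Fintype.bijective_iff_injective_and_card _).2
      ⟨hinj, Fintype.card_of_bijective τ.bij⟩, fun b b' hr hc => hlt (τ.row_lt b b' hr hc),
    fun b b' hc hr => hlt (τ.col_lt b b' hc hr)⟩, PSYT.ext (funext hl)⟩

/-- The total exponent of `q` in the labels of `τ`. -/
def deg (τ : PSYT n μ) : ℕ := ∑ i, τ.w i

theorem IsSwap.deg_eq {i : Fin (n - 1)} {τ σ : PSYT n μ} (h : IsSwap i τ σ) : σ.deg = τ.deg := by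
  simp only [deg, h.w_eq]
  exact Equiv.sum_comp (Equiv.swap (lo i) (hi i)) τ.w

theorem deg_Psi (hn : 0 < n) (τ : PSYT n μ) : τ.Psi.deg = τ.deg + 1 := by
  obtain ⟨m, rfl⟩ : ∃ m, n = m + 1 := ⟨n - 1, by omega⟩
  have hw (k : Fin (m + 1)) : τ.Psi.w k = (shiftExponents τ.exponents k).1 := by
    rw [← exponents_Psi, exponents]
  have hlast : τ.Psi.w (Fin.last m) = τ.w 0 + 1 := by
    rw [hw, shiftExponents, dif_neg (by simp)]
    rfl
  have hcast (k : Fin m) : τ.Psi.w k.castSucc = τ.w k.succ := by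
    rw [hw, shiftExponents, dif_pos (by simp)]
    rfl
  simp only [deg, Fin.sum_univ_castSucc (fun i => τ.Psi.w i), hcast, hlast, Fin.sum_univ_succ τ.w]
  omega

section Order

theorem sum_mul_swap {i : Fin (n - 1)} (f : Fin n → ℤ) :
    ∑ k : Fin n, (k.1 : ℤ) * f (Equiv.swap (lo i) (hi i) k) =
      ∑ k : Fin n, (k.1 : ℤ) * f k + (f (lo i) - f (hi i)) := by
  rw [← sub_eq_iff_eq_add', ← Finset.sum_sub_distrib,
    Finset.sum_eq_add (lo i) (hi i) (lo_ne_hi i)]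
  · simp only [Equiv.swap_apply_left, Equiv.swap_apply_right, lo_val, hi_val]
    push_cast
    ring
  · intro k _ hk
    rw [Equiv.swap_apply_of_ne_of_ne hk.1 hk.2, sub_self]
  · simp
  · simp

/-- A strictly increasing function on the tableaux, which shows that the relation `Lt` generated by
the covers is a strict order. -/
def rank (τ : PSYT n μ) : ℤ ×ₗ ℤ ×ₗ ℤ :=
  toLex ((τ.deg : ℤ), toLex (-∑ k : Fin n, (k.1 : ℤ) * τ.w k, ∑ k : Fin n, (k.1 : ℤ) * τ.c k))

variable {τ σ : PSYT n μ}

theorem IsSwap.rank_lt {i : Fin (n - 1)} (h : IsSwap i τ σ)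
    (hi : IsAscent (τ.exponents (lo i)) (τ.exponents (hi i))) : τ.rank < σ.rank := by
  simp only [rank, h.deg_eq, h.w_eq, h.c_eq, sum_mul_swap (fun k => (τ.w k : ℤ)), sum_mul_swap τ.c,
    Prod.Lex.toLex_lt_toLex, lt_self_iff_false, true_and, false_or]
  simp only [IsAscent, exponents] at hi
  omega

theorem Cover.rank_lt (hn : 0 < n) (h : Cover τ σ) : τ.rank < σ.rank := by
  cases h with
  | psi => exact Prod.Lex.toLex_lt_toLex.2 (.inl (by simp [deg_Psi hn]))
  | swap_of_lt i _ _ h hw => exact h.rank_lt (.inl hw)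
  | swap_of_eq i _ _ h hw hc => exact h.rank_lt (.inr ⟨hw, hc⟩)

theorem Lt.rank_lt (hn : 0 < n) (h : Lt τ σ) : τ.rank < σ.rank := by
  induction h with
  | single h => exact h.rank_lt hn
  | tail _ h ih => exact ih.trans (h.rank_lt hn)

theorem IsSwap.lt {i : Fin (n - 1)} (h : IsSwap i τ σ)
    (hi : IsAscent (τ.exponents (lo i)) (τ.exponents (hi i))) : Lt τ σ :=
  .single (hi.elim (.swap_of_lt i _ _ h) fun ⟨hw, hc⟩ => .swap_of_eq i _ _ h hw hc)

theorem IsSwap.isAscent_of_lt {i : Fin (n - 1)} (h : IsSwap i τ σ) (hlt : Lt τ σ) :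
    IsAscent (τ.exponents (lo i)) (τ.exponents (hi i)) := by
  have hn : 0 < n := by have := i.2; omega
  refine h.swappable.resolve_right fun hdesc => (hlt.rank_lt hn).not_gt (h.symm.rank_lt ?_)
  rwa [h.exponents_eq, Function.comp_apply, Function.comp_apply, Equiv.swap_apply_left,
    Equiv.swap_apply_right]

end Order

theorem exists_toPSYT_eq (τ : PSYT n μ) (h : ∀ i, τ.w i = 0) : ∃ σ : SYT n μ, σ.toPSYT = τ := by
  have hzero (b : μ.cells) : (τ.label b).2 = 0 := by rw [← τ.w_label, h]
  have hlt {b b' : μ.cells} (hb : LabelLt (τ.label b) (τ.label b')) :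
      (τ.label b).1 < (τ.label b').1 := by
    simpa [LabelLt, hzero] using hb
  exact ⟨⟨fun b => (τ.label b).1, τ.bij, fun b b' hr hc => hlt (τ.row_lt b b' hr hc),
    fun b b' hc hr => hlt (τ.col_lt b b' hc hr)⟩,
    PSYT.ext (funext fun b => Prod.ext rfl (hzero b).symm)⟩

end PSYT

namespace SYT

variable {n : ℕ} {μ : YoungDiagram}

theorem w_toPSYT (τ : SYT n μ) (i : Fin n) : τ.toPSYT.w i = 0 := rfl

theorem c_toPSYT_zero (τ : SYT n μ) (hn : 0 < n) : τ.toPSYT.c ⟨0, hn⟩ = 0 := by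
  let b := τ.toPSYT.box ⟨0, hn⟩
  let corner : μ.cells := cellOfLE b (0, 0) (Prod.le_def.2 ⟨Nat.zero_le _, Nat.zero_le _⟩)
  have hle : corner ≤ b := Prod.le_def.2 ⟨Nat.zero_le _, Nat.zero_le _⟩
  have heq : corner = b := by
    by_contra hne
    have hlt := τ.toPSYT.label_lt_label (hle.lt_of_ne hne)
    rw [PSYT.label_box, w_toPSYT] at hlt
    exact hlt.elim (Nat.not_lt_zero _) fun h => Nat.not_lt_zero _ (Fin.lt_def.1 h.2)
  rw [PSYT.c, show τ.toPSYT.box ⟨0, hn⟩ = corner from heq.symm]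
  rfl

theorem exists_isSwap {τ : SYT n μ} {i : Fin (n - 1)} (h : τ.toPSYT.Swappable i) :
    ∃ σ : SYT n μ, PSYT.IsSwap i τ.toPSYT σ.toPSYT := by
  obtain ⟨σ, hσ⟩ := (τ.toPSYT.swap i h).exists_toPSYT_eq fun j => by
    rw [(τ.toPSYT.isSwap_swap i h).w_eq, w_toPSYT]
  exact ⟨σ, hσ ▸ τ.toPSYT.isSwap_swap i h⟩

theorem labelLt_sort (w : Fin n → ℕ) {i j : Fin n} (hij : i < j) :
    LabelLt (Tuple.sort (OrderDual.toDual ∘ w) i, w (Tuple.sort (OrderDual.toDual ∘ w) i))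
      (Tuple.sort (OrderDual.toDual ∘ w) j, w (Tuple.sort (OrderDual.toDual ∘ w) j)) := by
  have hle := Tuple.monotone_sort (OrderDual.toDual ∘ w) hij.le
  obtain hlt | heq := (OrderDual.toDual_le_toDual.1 hle).lt_or_eq
  · exact .inl hlt
  · exact .inr ⟨heq.symm,
      (Tuple.eq_sort_iff.1 rfl).2 i j hij (congrArg OrderDual.toDual heq.symm)⟩

/-- The periodic tableau with exponents `w` whose labels are ordered in the same way as those of the
standard tableau `τ`. -/
def inflate (τ : SYT n μ) (w : Fin n → ℕ) : PSYT n μ where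
  label b := (Tuple.sort (OrderDual.toDual ∘ w) (τ.label b),
    w (Tuple.sort (OrderDual.toDual ∘ w) (τ.label b)))
  bij := (Tuple.sort (OrderDual.toDual ∘ w)).bijective.comp τ.bij
  row_lt b b' hr hc := labelLt_sort w (τ.row_lt b b' hr hc)
  col_lt b b' hc hr := labelLt_sort w (τ.col_lt b b' hc hr)

theorem w_inflate (τ : SYT n μ) (w : Fin n → ℕ) : (τ.inflate w).w = w :=
  funext fun i => congrArg w ((τ.inflate w).label_box_fst i)

theorem inflate_injective {τ σ : SYT n μ} {w w' : Fin n → ℕ}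
    (h : τ.inflate w = σ.inflate w') : w = w' ∧ τ = σ := by
  obtain rfl : w = w' := by rw [← τ.w_inflate w, h, w_inflate]
  refine ⟨rfl, SYT.ext (funext fun b => ?_)⟩
  exact (Tuple.sort (OrderDual.toDual ∘ w)).injective
    (congrArg (fun x : PSYT n μ => (x.label b).1) h)

end SYT

namespace PSYT

variable {n : ℕ} {μ : YoungDiagram}

/-- A nonzero exponent is moved to the last label by swaps, and is then lowered by undoing `Ψ`. -/
theorem induction_swap_Psi {C : PSYT n μ → Prop} (standard : ∀ σ : SYT n μ, C σ.toPSYT)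
    (swap : ∀ (i : Fin (n - 1)) (τ σ : PSYT n μ), IsSwap i τ σ →
      IsAscent (τ.exponents (lo i)) (τ.exponents (hi i)) → C τ → C σ)
    (Psi : 0 < n → ∀ τ, C τ → C τ.Psi) (τ : PSYT n μ) : C τ := by
  induction hd : τ.deg generalizing τ with
  | zero =>
    obtain ⟨σ, rfl⟩ := τ.exists_toPSYT_eq fun i => Finset.sum_eq_zero_iff.1 hd i (Finset.mem_univ i)
    exact standard σ
  | succ d ih =>
    obtain ⟨j, hj⟩ : ∃ j, 0 < τ.w j := by
      by_contra! h
      exact d.succ_ne_zero (hd.symm.trans (Finset.sum_eq_zero fun j _ => Nat.le_zero.1 (h j)))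
    induction hm : n - 1 - j.1 generalizing τ j with
    | zero =>
      obtain ⟨σ, rfl⟩ := τ.exists_Psi_eq (by omega) hj
      rw [deg_Psi j.pos, Nat.succ_inj] at hd
      exact Psi j.pos σ (ih σ hd)
    | succ m ihm =>
      let i : Fin (n - 1) := ⟨j.1, by omega⟩
      have hi_rank : n - 1 - (hi i).1 = m := (show n - 1 - (j.1 + 1) = m by omega)
      obtain h | h := Nat.eq_zero_or_pos (τ.w (hi i))
      · have hdesc : IsAscent (τ.exponents (hi i)) (τ.exponents (lo i)) := .inl (h.trans_lt hj)
        have hs := τ.isSwap_swap i (.inr hdesc)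
        refine swap i _ τ hs.symm ?_ (ihm _ (hs.deg_eq.trans hd) (hi i) ?_ hi_rank)
        · rwa [hs.exponents_eq, Function.comp_apply, Function.comp_apply, Equiv.swap_apply_left,
            Equiv.swap_apply_right]
        · rwa [hs.w_eq, Equiv.swap_apply_right]
      · exact ihm τ hd (hi i) h hi_rank

end PSYT

/-! ### The model -/

/-- The vector space with basis the periodic tableaux of shape `μ`. It carries an explicit
representation of the double affine Hecke algebra, which turns out to be isomorphic to `V n μ`. -/
abbrev Model (n : ℕ) (μ : YoungDiagram) : Type := PSYT n μ →₀ K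

/-- The family `u` with the entries at `i` and `i + 1` exchanged. -/
def swapAt {n : ℕ} {α : Type*} (i : Fin (n - 1)) (u : Fin n → α) : Fin n → α :=
  u ∘ Equiv.swap (lo i) (hi i)

section swapAt

variable {n : ℕ} {α : Type*} (i : Fin (n - 1)) (u : Fin n → α)

theorem swapAt_lo : swapAt i u (lo i) = u (hi i) := by
  rw [swapAt, Function.comp_apply, Equiv.swap_apply_left]

theorem swapAt_hi : swapAt i u (hi i) = u (lo i) := by
  rw [swapAt, Function.comp_apply, Equiv.swap_apply_right]

variable {i} in
theorem swapAt_of_ne {k : Fin n} (h : k ≠ lo i) (h' : k ≠ hi i) : swapAt i u k = u k := by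
  rw [swapAt, Function.comp_apply, Equiv.swap_apply_of_ne_of_ne h h']

theorem swapAt_swapAt : swapAt i (swapAt i u) = u :=
  funext fun k => congrArg u (Equiv.swap_apply_self _ _ k)

variable {i} in
theorem swapAt_comm {j : Fin (n - 1)} (h : i.1 + 1 < j.1 ∨ j.1 + 1 < i.1) :
    swapAt i (swapAt j u) = swapAt j (swapAt i u) := by
  funext k
  simp only [swapAt, Function.comp_apply, Equiv.swap_apply_def]
  congr 1
  split_ifs <;> simp only [lo_val, hi_val, Fin.ext_iff] at * <;> omega

end swapAt

section replaceThree

variable {n : ℕ} {α : Type*} (u : Fin n → α) (i : ℕ) (x y z : α)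

/-- The family `u` with the entries at `i`, `i + 1`, `i + 2` replaced by `x`, `y`, `z`: the braid
relation of `T_i` and `T_{i+1}` involves only these three entries. -/
def replaceThree (k : Fin n) : α :=
  if k.1 = i then x else if k.1 = i + 1 then y else if k.1 = i + 2 then z else u k

variable {i} {k : Fin n}

theorem replaceThree_fst (h : k.1 = i) : replaceThree u i x y z k = x := if_pos h

theorem replaceThree_snd (h : k.1 = i + 1) : replaceThree u i x y z k = y := by
  rw [replaceThree, if_neg (by omega), if_pos h]

theorem replaceThree_thd (h : k.1 = i + 2) : replaceThree u i x y z k = z := by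
  rw [replaceThree, if_neg (by omega), if_neg (by omega), if_pos h]

theorem replaceThree_self {j l : Fin n} (hk : k.1 = i) (hj : j.1 = i + 1) (hl : l.1 = i + 2) :
    replaceThree u i (u k) (u j) (u l) = u := by
  funext m
  rw [replaceThree]
  split_ifs with h₁ h₂ h₃
  exacts [congrArg u (Fin.ext (hk.trans h₁.symm)), congrArg u (Fin.ext (hj.trans h₂.symm)),
    congrArg u (Fin.ext (hl.trans h₃.symm)), rfl]

theorem swapAt_replaceThree_fst_snd {j : Fin (n - 1)} (hj : j.1 = i) :
    swapAt j (replaceThree u i x y z) = replaceThree u i y x z := by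
  have lo_eq : (lo j).1 = i := hj
  have hi_eq : (hi j).1 = i + 1 := congrArg (· + 1) hj
  funext k
  by_cases h_lo : k = lo j
  · rw [h_lo, swapAt_lo, replaceThree_snd _ _ _ _ hi_eq, replaceThree_fst _ _ _ _ lo_eq]
  by_cases h_hi : k = hi j
  · rw [h_hi, swapAt_hi, replaceThree_fst _ _ _ _ lo_eq, replaceThree_snd _ _ _ _ hi_eq]
  rw [swapAt_of_ne _ h_lo h_hi]
  simp only [Fin.ext_iff, lo_eq, hi_eq] at h_lo h_hi
  simp only [replaceThree, if_neg h_lo, if_neg h_hi]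

theorem swapAt_replaceThree_snd_thd {j : Fin (n - 1)} (hj : j.1 = i + 1) :
    swapAt j (replaceThree u i x y z) = replaceThree u i x z y := by
  have lo_eq : (lo j).1 = i + 1 := hj
  have hi_eq : (hi j).1 = i + 2 := congrArg (· + 1) hj
  funext k
  by_cases h_lo : k = lo j
  · rw [h_lo, swapAt_lo, replaceThree_thd _ _ _ _ hi_eq, replaceThree_snd _ _ _ _ lo_eq]
  by_cases h_hi : k = hi j
  · rw [h_hi, swapAt_hi, replaceThree_snd _ _ _ _ lo_eq, replaceThree_thd _ _ _ _ hi_eq]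
  rw [swapAt_of_ne _ h_lo h_hi]
  simp only [Fin.ext_iff, lo_eq, hi_eq] at h_lo h_hi
  simp only [replaceThree, if_neg h_lo, if_neg h_hi]

end replaceThree

namespace PSYT

variable {n : ℕ}

theorem shiftExponents_of_lt (u : Fin n → ℕ × ℤ) {k : Fin n} (h : k.1 + 1 < n) :
    shiftExponents u k = u ⟨k.1 + 1, h⟩ := dif_pos h

theorem shiftExponents_last (u : Fin n → ℕ × ℤ) {k : Fin n} (h : k.1 + 1 = n) :
    shiftExponents u k = ((u ⟨0, k.pos⟩).1 + 1, (u ⟨0, k.pos⟩).2) := dif_neg h.not_lt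

theorem shiftExponents_injective :
    Function.Injective (shiftExponents : (Fin n → ℕ × ℤ) → Fin n → ℕ × ℤ) := by
  intro u v h
  funext ⟨k, hk⟩
  cases k with
  | zero =>
    have hlast := congrFun h ⟨n - 1, by omega⟩
    have hn : n - 1 + 1 = n := by omega
    rw [shiftExponents_last u hn, shiftExponents_last v hn] at hlast
    simpa only [Prod.ext_iff, Nat.add_right_cancel_iff] using hlast
  | succ k =>
    have hprev := congrFun h ⟨k, by omega⟩
    rwa [shiftExponents_of_lt u hk, shiftExponents_of_lt v hk] at hprev

theorem shiftExponents_lo (u : Fin n → ℕ × ℤ) {k : ℕ} (hk : k + 1 < n - 1) :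
    shiftExponents u (lo ⟨k, k.lt_succ_self.trans hk⟩) = u (lo ⟨k + 1, hk⟩) :=
  shiftExponents_of_lt u _

theorem shiftExponents_hi (u : Fin n → ℕ × ℤ) {k : ℕ} (hk : k + 1 < n - 1) :
    shiftExponents u (hi ⟨k, k.lt_succ_self.trans hk⟩) = u (hi ⟨k + 1, hk⟩) :=
  shiftExponents_of_lt u (by simp only [hi_val]; omega)

theorem shiftExponents_swapAt (u : Fin n → ℕ × ℤ) {k : ℕ} (hk : k + 1 < n - 1) :
    shiftExponents (swapAt ⟨k + 1, hk⟩ u) = swapAt ⟨k, by omega⟩ (shiftExponents u) := by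
  funext j
  by_cases h_lo : j = lo ⟨k, by omega⟩
  · rw [h_lo, shiftExponents_lo _ hk, swapAt_lo, swapAt_lo, shiftExponents_hi _ hk]
  by_cases h_hi : j = hi ⟨k, by omega⟩
  · rw [h_hi, shiftExponents_hi _ hk, swapAt_hi, swapAt_hi, shiftExponents_lo _ hk]
  rw [swapAt_of_ne _ h_lo h_hi]
  simp only [Fin.ext_iff, lo_val, hi_val] at h_lo h_hi
  rcases (Nat.succ_le_of_lt j.2).lt_or_eq with hj | hj
  · rw [shiftExponents_of_lt _ hj, shiftExponents_of_lt _ hj, swapAt_of_ne] <;>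
      simp only [ne_eq, Fin.ext_iff, lo_val, hi_val] <;> omega
  · rw [shiftExponents_last _ hj, shiftExponents_last _ hj, swapAt_of_ne] <;>
      simp only [ne_eq, Fin.ext_iff, lo_val, hi_val] <;> omega

section

variable (u : Fin n → ℕ × ℤ) (hn : 0 < n - 1)

theorem shiftExponents_shiftExponents_lo :
    shiftExponents (shiftExponents u) (lo ⟨n - 1 - 1, by omega⟩) =
      ((u (lo ⟨0, hn⟩)).1 + 1, (u (lo ⟨0, hn⟩)).2) := by
  rw [shiftExponents_of_lt _ (by simp only [lo_val]; omega),
    shiftExponents_last _ (by simp only [lo_val]; omega)]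
  rfl

theorem shiftExponents_shiftExponents_hi :
    shiftExponents (shiftExponents u) (hi ⟨n - 1 - 1, by omega⟩) =
      ((u (hi ⟨0, hn⟩)).1 + 1, (u (hi ⟨0, hn⟩)).2) := by
  rw [shiftExponents_last _ (by simp only [hi_val]; omega),
    shiftExponents_of_lt _ (show 0 + 1 < n by omega)]
  rfl

theorem shiftExponents_shiftExponents_swapAt :
    shiftExponents (shiftExponents (swapAt ⟨0, hn⟩ u)) =
      swapAt ⟨n - 1 - 1, by omega⟩ (shiftExponents (shiftExponents u)) := by
  funext j
  by_cases h_lo : j = lo ⟨n - 1 - 1, by omega⟩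
  · rw [h_lo, swapAt_lo, shiftExponents_shiftExponents_lo _ hn,
      shiftExponents_shiftExponents_hi _ hn, swapAt_lo]
  by_cases h_hi : j = hi ⟨n - 1 - 1, by omega⟩
  · rw [h_hi, swapAt_hi, shiftExponents_shiftExponents_lo _ hn,
      shiftExponents_shiftExponents_hi _ hn, swapAt_hi]
  rw [swapAt_of_ne _ h_lo h_hi]
  simp only [Fin.ext_iff, lo_val, hi_val] at h_lo h_hi
  have hj : j.1 + 1 < n := by omega
  have hj' : j.1 + 1 + 1 < n := by omega
  rw [shiftExponents_of_lt _ hj, shiftExponents_of_lt _ hj', shiftExponents_of_lt _ hj,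
    shiftExponents_of_lt _ hj', swapAt_of_ne] <;>
    simp only [ne_eq, Fin.ext_iff, lo_val, hi_val] <;> omega

end

end PSYT

namespace Model

variable {n : ℕ} {μ : YoungDiagram}

/-- The basis vector of the tableau with exponents `u`, or `0` if there is no such tableau. With
this convention the formulas below hold for all families `u`, which makes composing them easy. -/
def vec : (Fin n → ℕ × ℤ) → Model n μ :=
  Function.extend PSYT.exponents (fun τ => Finsupp.single τ 1) 0

theorem vec_exponents (τ : PSYT n μ) : vec τ.exponents = Finsupp.single τ (1 : K) :=
  PSYT.exponents_injective.extend_apply _ _ τ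

theorem vec_eq_zero {u : Fin n → ℕ × ℤ} (h : ¬ ∃ τ : PSYT n μ, τ.exponents = u) :
    (vec u : Model n μ) = 0 :=
  Function.extend_apply' _ _ u h

theorem hom_ext {M : Type*} [AddCommMonoid M] [Module K M] {f g : Model n μ →ₗ[K] M}
    (h : ∀ τ : PSYT n μ, f (vec τ.exponents) = g (vec τ.exponents)) : f = g :=
  Finsupp.lhom_ext' fun τ => LinearMap.ext_ring (vec_exponents τ ▸ h τ :)

/-- The endomorphism with `vec u ↦ f u` for the exponents `u` of tableaux. -/
def ofVec (f : (Fin n → ℕ × ℤ) → Model n μ) : Module.End K (Model n μ) :=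
  Finsupp.linearCombination K fun τ : PSYT n μ => f τ.exponents

theorem ofVec_apply (f : (Fin n → ℕ × ℤ) → Model n μ) (u : Fin n → ℕ × ℤ)
    (h : (¬ ∃ τ : PSYT n μ, τ.exponents = u) → f u = 0) : ofVec f (vec u) = f u := by
  by_cases hu : ∃ τ : PSYT n μ, τ.exponents = u
  · obtain ⟨τ, rfl⟩ := hu
    rw [vec_exponents, ofVec, Finsupp.linearCombination_single, one_smul]
  · rw [vec_eq_zero hu, map_zero, h hu]

/-- Young's seminormal form of `T_i`, with coefficients depending on the weights. -/
def T (i : Fin (n - 1)) : Module.End K (Model n μ) :=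
  ofVec fun u => diagCoeff (u (lo i)) (u (hi i)) • vec u +
    offCoeff (u (lo i)) (u (hi i)) • vec (swapAt i u)

/-- The diagonal operator with the weights at `k` as eigenvalues. -/
def θ (k : Fin n) : Module.End K (Model n μ) := ofVec fun u => wt (u k) • vec u

/-- The operator `X_n π_n⁻¹`, read off from the last claim of the theorem. -/
def Y (hn : 0 < n) : Module.End K (Model n μ) :=
  ofVec fun u => (q ^ (u ⟨0, hn⟩).1)⁻¹ • vec (PSYT.shiftExponents u)

theorem T_vec (i : Fin (n - 1)) (u : Fin n → ℕ × ℤ) :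
    T i (vec u : Model n μ) = diagCoeff (u (lo i)) (u (hi i)) • vec u +
      offCoeff (u (lo i)) (u (hi i)) • vec (swapAt i u) := by
  refine ofVec_apply _ u fun hu => ?_
  rw [vec_eq_zero hu, smul_zero, zero_add]
  by_cases h : ∃ σ : PSYT n μ, σ.exponents = swapAt i u
  · obtain ⟨σ, hσ⟩ := h
    have not_swappable : ¬ σ.Swappable i := fun hs => hu
      ⟨σ.swap i hs, by rw [(σ.isSwap_swap i hs).exponents_eq, hσ]; exact swapAt_swapAt i u⟩
    rw [PSYT.Swappable, hσ, swapAt_lo, swapAt_hi, not_or] at not_swappable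
    rw [offCoeff_eq_zero not_swappable.2 not_swappable.1, zero_smul]
  · rw [vec_eq_zero h, smul_zero]

theorem θ_vec (k : Fin n) (u : Fin n → ℕ × ℤ) : θ k (vec u : Model n μ) = wt (u k) • vec u :=
  ofVec_apply _ u fun h => by rw [vec_eq_zero h, smul_zero]

theorem Y_vec (hn : 0 < n) (u : Fin n → ℕ × ℤ) :
    Y hn (vec u : Model n μ) = (q ^ (u ⟨0, hn⟩).1)⁻¹ • vec (PSYT.shiftExponents u) := by
  refine ofVec_apply _ u fun h => ?_
  rw [vec_eq_zero, smul_zero]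
  rintro ⟨σ, hσ⟩
  have hlast : n - 1 + 1 = n := Nat.succ_pred_eq_of_pos hn
  have w_pos : 0 < σ.w ⟨n - 1, by omega⟩ := by
    change 0 < (σ.exponents ⟨n - 1, by omega⟩).1
    rw [hσ, PSYT.shiftExponents_last u hlast]
    exact Nat.succ_pos _
  obtain ⟨τ, rfl⟩ := σ.exists_Psi_eq hlast w_pos
  rw [PSYT.exponents_Psi] at hσ
  exact h ⟨τ, PSYT.shiftExponents_injective hσ⟩

theorem T_quad (i : Fin (n - 1)) :
    ((T i : Module.End K (Model n μ)) - 1) * (T i + algebraMap K _ t) = 0 := by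
  refine hom_ext fun τ => ?_
  have hne := τ.exponents_lo_ne_hi i
  simp only [Module.End.mul_apply, LinearMap.add_apply, LinearMap.sub_apply, Module.End.one_apply,
    Module.algebraMap_end_apply, map_add, map_smul, T_vec, swapAt_lo, swapAt_hi, swapAt_swapAt,
    LinearMap.zero_apply]
  set u := τ.exponents (lo i)
  set v := τ.exponents (hi i)
  linear_combination (norm := module)
    (diagCoeff u v * diagCoeff_add hne - diagCoeff_mul_add hne) • vec τ.exponents +
      (offCoeff u v * diagCoeff_add hne) • vec (swapAt i τ.exponents)

theorem T_comm {i j : Fin (n - 1)} (h : i.1 + 1 < j.1 ∨ j.1 + 1 < i.1) :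
    (T i : Module.End K (Model n μ)) * T j = T j * T i := by
  refine hom_ext fun τ => ?_
  obtain ⟨h₁, h₂, h₃, h₄⟩ : lo i ≠ lo j ∧ lo i ≠ hi j ∧ hi i ≠ lo j ∧ hi i ≠ hi j := by
    simp only [Ne, Fin.ext_iff, lo_val, hi_val]
    omega
  simp only [Module.End.mul_apply, map_add, map_smul, T_vec, swapAt_of_ne _ h₁ h₂,
    swapAt_of_ne _ h₃ h₄, swapAt_of_ne _ h₁.symm h₃.symm, swapAt_of_ne _ h₂.symm h₄.symm,
    swapAt_comm _ h]
  module

theorem T_braid {i j : Fin (n - 1)} (h : i.1 + 1 = j.1) :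
    (T i : Module.End K (Model n μ)) * T j * T i = T j * T i * T j := by
  refine hom_ext fun τ => ?_
  have lo_j : lo j = hi i := Fin.ext h.symm
  have hi_j : (hi j).1 = i.1 + 2 := congrArg (· + 1) h.symm
  have T_i_apply (x y z : ℕ × ℤ) := T_vec (μ := μ) i (replaceThree τ.exponents i.1 x y z)
  have T_j_apply (x y z : ℕ × ℤ) := T_vec (μ := μ) j (replaceThree τ.exponents i.1 x y z)
  simp only [replaceThree_fst _ _ _ _ (lo_val i), replaceThree_snd _ _ _ _ (hi_val i),
    swapAt_replaceThree_fst_snd _ _ _ _ rfl] at T_i_apply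
  simp only [lo_j, replaceThree_snd _ _ _ _ (hi_val i), replaceThree_thd _ _ _ _ hi_j,
    swapAt_replaceThree_snd_thd _ _ _ _ h.symm] at T_j_apply
  have braid := seminormal_braid t wt offCoeff
    (fun u v huv => offCoeff_mul_offCoeff (ne_of_apply_ne wt huv))
    (fun x y z => vec (replaceThree τ.exponents i.1 x y z)) (T i : Module.End K (Model n μ)) (T j)
    T_i_apply T_j_apply (wt_injective.ne (τ.exponents_lo_ne_hi i))
    (wt_injective.ne (τ.exponents_ne_of_add_two_eq (i := lo i) (j := hi j) hi_j.symm))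
    (wt_injective.ne (lo_j ▸ τ.exponents_lo_ne_hi j))
  simpa only [Module.End.mul_apply, replaceThree_self _ (lo_val i) (hi_val i) hi_j] using braid

theorem satHecke : SatHecke (T : Fin (n - 1) → Module.End K (Model n μ)) := by
  intro a b h
  cases h with
  | quad i => exact T_quad i
  | braid i j h => exact T_braid h
  | comm i j h => exact T_comm h

theorem T_mul_θ_mul_T (i : Fin (n - 1)) :
    (T i : Module.End K (Model n μ)) * θ (hi i) * T i = t • θ (lo i) := by
  refine hom_ext fun τ => ?_
  have hne := τ.exponents_lo_ne_hi i
  simp only [Module.End.mul_apply, LinearMap.smul_apply, map_add, map_smul, T_vec, θ_vec,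
    swapAt_lo, swapAt_hi, swapAt_swapAt]
  set u := τ.exponents (lo i)
  set v := τ.exponents (hi i)
  linear_combination (norm := module)
    (diagCoeff u v * wt_mul_diagCoeff u v - wt u * diagCoeff_mul_add hne) • vec τ.exponents +
      (offCoeff u v * wt_mul_diagCoeff u v) • vec (swapAt i τ.exponents)

theorem satAffine : SatAffine (T : Fin (n - 1) → Module.End K (Model n μ)) θ := by
  intro a b h
  cases h with
  | hecke h => exact satHecke _ _ h
  | theta_comm i j =>
    refine hom_ext fun τ => ?_
    simp only [Module.End.mul_apply, θ_vec, map_smul]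
    exact smul_comm _ _ _
  | theta_succ i =>
    rw [← smul_mul_assoc, ← mul_smul_comm, ← T_mul_θ_mul_T]
    simp only [mul_assoc]
    rw [T_mul_Tinv satHecke, mul_one, ← mul_assoc, Tinv_mul_T satHecke, one_mul]
  | T_theta i j h h' =>
    refine hom_ext fun τ => ?_
    simp only [Module.End.mul_apply, θ_vec, T_vec, map_smul, map_add, swapAt_of_ne _ h h']
    module

theorem isUnit_θ (k : Fin n) : IsUnit (θ k : Module.End K (Model n μ)) := by
  let θinv : Module.End K (Model n μ) := ofVec fun u => (wt (u k))⁻¹ • vec u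
  have θinv_vec (u : Fin n → ℕ × ℤ) : θinv (vec u) = (wt (u k))⁻¹ • vec u :=
    ofVec_apply _ u fun h => by rw [vec_eq_zero h, smul_zero]
  refine ⟨⟨θ k, θinv, hom_ext fun τ => ?_, hom_ext fun τ => ?_⟩, rfl⟩
  · rw [Module.End.mul_apply, θinv_vec, map_smul, θ_vec, inv_smul_smul₀ (wt_ne_zero _),
      Module.End.one_apply]
  · rw [Module.End.mul_apply, θ_vec, map_smul, θinv_vec, smul_inv_smul₀ (wt_ne_zero _),
      Module.End.one_apply]

section Shift

variable (hn : 0 < n) {k : ℕ}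

theorem semiconjBy_Y_θ (hk : k + 1 < n) :
    SemiconjBy (Y hn : Module.End K (Model n μ)) (θ ⟨k + 1, hk⟩)
      (θ ⟨k, k.lt_succ_self.trans hk⟩) := by
  refine hom_ext fun τ => ?_
  simp only [Module.End.mul_apply, θ_vec, Y_vec, map_smul,
    PSYT.shiftExponents_of_lt (k := ⟨k, k.lt_succ_self.trans hk⟩) _ hk]
  exact smul_comm _ _ _

theorem θ_mul_Y :
    (θ ⟨n - 1, by omega⟩ * Y hn : Module.End K (Model n μ)) = q • (Y hn * θ ⟨0, hn⟩) := by
  refine hom_ext fun τ => ?_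
  have shift_last := PSYT.shiftExponents_last (k := ⟨n - 1, Nat.sub_one_lt_of_lt hn⟩) τ.exponents
    (Nat.succ_pred_eq_of_pos hn)
  simp only [Module.End.mul_apply, LinearMap.smul_apply, θ_vec, Y_vec, map_smul,
    shift_last, wt_succ_fst]
  module

theorem semiconjBy_Y_T (hk : k + 1 < n - 1) :
    SemiconjBy (Y hn : Module.End K (Model n μ)) (T ⟨k + 1, hk⟩)
      (T ⟨k, k.lt_succ_self.trans hk⟩) := by
  refine hom_ext fun τ => ?_
  have zero_ne_lo : (⟨0, hn⟩ : Fin n) ≠ lo ⟨k + 1, hk⟩ := Fin.ne_of_val_ne k.succ_ne_zero.symm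
  have zero_ne_hi : (⟨0, hn⟩ : Fin n) ≠ hi ⟨k + 1, hk⟩ := Fin.ne_of_val_ne (k + 1).succ_ne_zero.symm
  simp only [Module.End.mul_apply, T_vec, Y_vec, map_smul, map_add,
    swapAt_of_ne _ zero_ne_lo zero_ne_hi, PSYT.shiftExponents_swapAt,
    PSYT.shiftExponents_lo _ hk, PSYT.shiftExponents_hi _ hk]
  module

theorem semiconjBy_Y_mul_Y_T (hn' : 0 < n - 1) :
    SemiconjBy (Y hn * Y hn : Module.End K (Model n μ)) (T ⟨0, hn'⟩)
      (T ⟨n - 1 - 1, by omega⟩) := by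
  refine hom_ext fun τ => ?_
  have shift_lo (u : Fin n → ℕ × ℤ) :
      PSYT.shiftExponents u (lo ⟨0, hn'⟩) = u (hi ⟨0, hn'⟩) :=
    PSYT.shiftExponents_of_lt u (show 0 + 1 < n by omega)
  have zero_eq : (⟨0, hn⟩ : Fin n) = lo ⟨0, hn'⟩ := rfl
  simp only [Module.End.mul_apply, T_vec, Y_vec, map_smul, map_add, shift_lo,
    PSYT.shiftExponents_shiftExponents_swapAt, PSYT.shiftExponents_shiftExponents_lo _ hn',
    PSYT.shiftExponents_shiftExponents_hi _ hn', zero_eq, swapAt_lo, swapAt_hi, diagCoeff_shift,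
    offCoeff_shift]
  module

variable (n μ) in
/-- The operator `Y`, with the exchange relations that let it stand for `X_n π_n⁻¹`. -/
def shiftLift : ShiftLift q ((satAffine (n := n) (μ := μ)).braidFamily hn) where
  Y := Y hn
  Y_theta k hk := by
    rw [satAffine.braidFamily_θ hn ⟨k, by omega⟩, satAffine.braidFamily_θ hn ⟨k + 1, by omega⟩]
    exact semiconjBy_Y_θ hn _
  theta_Y := by
    rw [satAffine.braidFamily_θ hn ⟨n - 1, by omega⟩, satAffine.braidFamily_θ hn ⟨0, hn⟩]
    exact θ_mul_Y hn
  Y_T k hk := by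
    rw [satAffine.braidFamily_T hn ⟨k, by omega⟩, satAffine.braidFamily_T hn ⟨k + 1, by omega⟩]
    exact semiconjBy_Y_T hn hk
  Y_Y_T hn' := by
    rw [satAffine.braidFamily_T hn ⟨0, hn'⟩, satAffine.braidFamily_T hn ⟨n - 1 - 1, by omega⟩]
    exact semiconjBy_Y_mul_Y_T hn hn'
  isUnit_theta := by
    rw [satAffine.braidFamily_θ hn ⟨0, hn⟩]
    exact isUnit_θ _

end Shift

/-- The action of `X_k`. -/
def X (k : Fin n) : Module.End K (Model n μ) := (shiftLift n μ k.pos).X k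

theorem satDaha : SatDaha (T : Fin (n - 1) → Module.End K (Model n μ)) θ X := by
  rcases Nat.eq_zero_or_pos n with rfl | hn
  · intro a b h
    cases h with
    | affine h => exact satAffine _ _ h
    | X_comm i => exact i.elim0
    | X_succ i => exact i.elim0
    | T_X i => exact i.elim0
    | pi_X hn => exact absurd hn (lt_irrefl 0)
    | pi_X_last hn => exact absurd hn (lt_irrefl 0)
  · exact ShiftLift.satDaha satAffine hn (shiftLift n μ hn)

variable (n μ) in
/-- The representation of the double affine Hecke algebra on the model. -/
def dahaRep : Daha n →ₐ[K] Module.End K (Model n μ) := Daha.lift T θ X satDaha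

theorem dahaRep_T (i : Fin (n - 1)) : dahaRep n μ (Daha.T i) = T i := Daha.lift_T _ i

theorem dahaRep_θ (k : Fin n) : dahaRep n μ (Daha.θ k) = θ k := Daha.lift_θ _ k

theorem dahaRep_X (k : Fin n) : dahaRep n μ (Daha.X k) = X k := Daha.lift_X _ k

end Model

/-! ### Frobenius reciprocity -/

section InducedModules

variable {A H B M N : Type} [Ring A] [Algebra K A] [Ring H] [Algebra K H] [Ring B] [Algebra K B]
  {f : A →ₐ[K] B} {g : A →ₐ[K] H} [AddCommGroup M] [Module K M] [Module H M] [IsScalarTower K H M]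
  [AddCommGroup N] [Module K N] [Module B N] [IsScalarTower K B N]

variable (f g) in
/-- The map `m ↦ 1 ⊗ m` from a module to the module induced from it. -/
def indOne : M →ₗ[K] IndPullback f g M :=
  ((Submodule.mkQ _).restrictScalars K).comp (TensorProduct.mk K B M 1)

theorem smul_indOne (b : B) (m : M) :
    b • indOne f g m = Submodule.Quotient.mk (TensorProduct.tmul K b m) := by
  change Submodule.Quotient.mk (b • TensorProduct.tmul K (1 : B) m) = _
  rw [TensorProduct.smul_tmul', smul_eq_mul, mul_one]

theorem map_smul_indOne (a : A) (m : M) : f a • indOne f g m = indOne f g (g a • m) := by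
  rw [smul_indOne]
  exact (Submodule.Quotient.eq _).2
    (Submodule.subset_span ⟨1, a, m, by rw [one_mul, TensorProduct.mk_apply]⟩)

theorem span_indOne : Submodule.span B (Set.range (indOne f g (M := M))) = ⊤ := by
  rw [eq_top_iff]
  rintro x -
  obtain ⟨x, rfl⟩ := Submodule.Quotient.mk_surjective _ x
  induction x using TensorProduct.induction_on with
  | zero => exact zero_mem _
  | tmul b m =>
    rw [← smul_indOne]
    exact Submodule.smul_mem _ _ (Submodule.subset_span ⟨m, rfl⟩)
  | add x y hx hy => exact add_mem hx hy

/-- Frobenius reciprocity: the extension of a `K`-linear map compatible with the action of `A`. -/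
def indLift (φ : M →ₗ[K] N) (hφ : ∀ a m, φ (g a • m) = f a • φ m) :
    IndPullback f g M →ₗ[B] N :=
  Submodule.liftQ _ (TensorProduct.AlgebraTensorModule.lift
      (LinearMap.toSpanSingleton B (M →ₗ[K] N) φ)) <|
    Submodule.span_le.2 <| by
      rintro _ ⟨b, a, m, rfl⟩
      simp [hφ, mul_smul]

theorem indLift_indOne (φ : M →ₗ[K] N) (hφ : ∀ a m, φ (g a • m) = f a • φ m) (m : M) :
    indLift φ hφ (indOne f g m) = φ m := by
  simp [indLift, indOne]

end InducedModules

theorem Specht.span_of {n : ℕ} {μ : YoungDiagram} :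
    Submodule.span (Hecke n) (Set.range (Specht.of (n := n) (μ := μ))) = ⊤ := by
  have range_of : Set.range (Specht.of (n := n) (μ := μ)) =
      Submodule.mkQ _ '' Set.range (Finsupp.basisSingleOne (R := Hecke n)) := by
    rw [← Set.range_comp]
    exact congrArg Set.range (funext fun τ => by simp [Specht.of, basisVec])
  rw [range_of, ← Submodule.map_span, Module.Basis.span_eq, Submodule.map_top, Submodule.range_mkQ]

namespace Model

variable {n : ℕ} {μ : YoungDiagram}

instance : Module (Daha n) (Model n μ) := Module.compHom _ (dahaRep n μ).toRingHom

theorem daha_smul_def (b : Daha n) (v : Model n μ) : b • v = dahaRep n μ b v := rfl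

instance : IsScalarTower K (Daha n) (Model n μ) :=
  .of_algebraMap_smul fun c v => by
    rw [daha_smul_def, AlgHom.commutes, Module.algebraMap_end_apply]

theorem daha_T_smul (i : Fin (n - 1)) (v : Model n μ) : Daha.T i • v = T i v := by
  rw [daha_smul_def, dahaRep_T]

theorem daha_θ_smul (k : Fin n) (v : Model n μ) : Daha.θ k • v = θ k v := by
  rw [daha_smul_def, dahaRep_θ]

theorem daha_X_smul (k : Fin n) (v : Model n μ) : Daha.X k • v = X k v := by
  rw [daha_smul_def, dahaRep_X]

variable (n μ) in
/-- The representation of the finite Hecke algebra on the model. -/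
def heckeRep : Hecke n →ₐ[K] Module.End K (Model n μ) := Hecke.lift T satHecke

theorem heckeRep_T : (fun i => heckeRep n μ (Hecke.T i)) = T := funext (Hecke.lift_T satHecke)

instance : Module (Hecke n) (Model n μ) := Module.compHom _ (heckeRep n μ).toRingHom

theorem hecke_smul_def (a : Hecke n) (v : Model n μ) : a • v = heckeRep n μ a v := rfl

instance : IsScalarTower K (Hecke n) (Model n μ) :=
  .of_algebraMap_smul fun c v => by
    rw [hecke_smul_def, AlgHom.commutes, Module.algebraMap_end_apply]

theorem hecke_T_smul (i : Fin (n - 1)) (v : Model n μ) : Hecke.T i • v = T i v :=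
  congrArg (· v) (Hecke.lift_T satHecke i)

variable (n μ) in
/-- The span of the standard tableaux. -/
def standard : Submodule K (Model n μ) :=
  Submodule.span K (Set.range fun τ : SYT n μ => vec τ.toPSYT.exponents)

theorem vec_mem_standard (τ : SYT n μ) : vec τ.toPSYT.exponents ∈ standard n μ :=
  Submodule.subset_span ⟨τ, rfl⟩

theorem T_mem_standard (i : Fin (n - 1)) {v : Model n μ} (hv : v ∈ standard n μ) :
    T i v ∈ standard n μ := by
  suffices standard n μ ≤ (standard n μ).comap (T i) from this hv
  refine Submodule.span_le.2 (Set.range_subset_iff.2 fun τ => ?_)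
  rw [SetLike.mem_coe, Submodule.mem_comap, T_vec]
  refine add_mem (Submodule.smul_mem _ _ (vec_mem_standard τ)) ?_
  by_cases h : τ.toPSYT.Swappable i
  · obtain ⟨σ, hσ⟩ := SYT.exists_isSwap h
    rw [swapAt, ← hσ.exponents_eq]
    exact Submodule.smul_mem _ _ (vec_mem_standard σ)
  · rw [PSYT.Swappable, not_or] at h
    rw [offCoeff_eq_zero h.1 h.2, zero_smul]
    exact zero_mem _

theorem tTinv_mem_standard (i : Fin (n - 1)) {v : Model n μ} (hv : v ∈ standard n μ) :
    tTinv T i v ∈ standard n μ :=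
  add_mem (T_mem_standard i hv) (Submodule.smul_mem _ _ hv)

theorem hecke_smul_mem_standard (a : Hecke n) {v : Model n μ} (hv : v ∈ standard n μ) :
    a • v ∈ standard n μ := by
  induction a using Presented.induction generalizing v with
  | algebraMap c => exact algebraMap_smul (Hecke n) c v ▸ Submodule.smul_mem _ _ hv
  | gen i => exact hecke_T_smul i v ▸ T_mem_standard i hv
  | mul a b ha hb => exact mul_smul a b v ▸ ha (hb hv)
  | add a b ha hb => exact add_smul a b v ▸ add_mem (ha hv) (hb hv)

theorem wt_exponents_toPSYT (τ : SYT n μ) (k : Fin n) :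
    wt (τ.toPSYT.exponents k) = t ^ τ.toPSYT.c k := by
  rw [wt, PSYT.exponents, SYT.w_toPSYT, pow_zero, one_mul]

theorem θ_zero_apply (hn : 0 < n) {v : Model n μ} (hv : v ∈ standard n μ) : θ ⟨0, hn⟩ v = v := by
  suffices standard n μ ≤ LinearMap.eqLocus (θ ⟨0, hn⟩) LinearMap.id from this hv
  refine Submodule.span_le.2 (Set.range_subset_iff.2 fun τ => ?_)
  rw [SetLike.mem_coe, LinearMap.mem_eqLocus, θ_vec, wt_exponents_toPSYT, SYT.c_toPSYT_zero τ hn,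
    zpow_zero, one_smul, LinearMap.id_apply]

theorem thetaBarAux_apply {k : ℕ} (hk : k < n) {v : Model n μ} (hv : v ∈ standard n μ) :
    thetaBarAux T k v = θ ⟨k, hk⟩ v := by
  induction k generalizing v with
  | zero => rw [θ_zero_apply hk hv, thetaBarAux, Module.End.one_apply]
  | succ k ih =>
    have Tinv_mem : Tinv T ⟨k, by omega⟩ v ∈ standard n μ :=
      Submodule.smul_mem _ _ (tTinv_mem_standard _ hv)
    have θ_succ : θ ⟨k + 1, hk⟩ = t • (Tinv T ⟨k, by omega⟩ * θ ⟨k, by omega⟩ *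
      Tinv T ⟨k, by omega⟩ : Module.End K (Model n μ)) := satAffine _ _ (.theta_succ ⟨k, by omega⟩)
    rw [thetaBarAux_succ k (by omega), θ_succ]
    simp only [LinearMap.smul_apply, Module.End.mul_apply]
    rw [ih _ Tinv_mem]

theorem thetaBar_apply (k : Fin n) {v : Model n μ} (hv : v ∈ standard n μ) :
    thetaBar T k v = θ k v := thetaBarAux_apply k.2 hv

theorem thetaBar_smul (k : Fin n) {v : Model n μ} (hv : v ∈ standard n μ) :
    thetaBar (Hecke.T (n := n)) k • v = θ k v := by
  rw [hecke_smul_def, map_thetaBar (B := Module.End K (Model n μ)), heckeRep_T, thetaBar_apply k hv]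

theorem thetaBar_smul_vec (k : Fin n) (τ : SYT n μ) :
    thetaBar (Hecke.T (n := n)) k • (vec τ.toPSYT.exponents : Model n μ) =
      t ^ τ.toPSYT.c k • vec τ.toPSYT.exponents := by
  rw [thetaBar_smul k (vec_mem_standard τ), θ_vec, wt_exponents_toPSYT]

theorem phiBar_smul_vec {i : Fin (n - 1)} {τ σ : SYT n μ}
    (h : PSYT.IsSwap i τ.toPSYT σ.toPSYT) (hlt : PSYT.Lt τ.toPSYT σ.toPSYT) :
    phiBar (Hecke.T (n := n)) i • (vec τ.toPSYT.exponents : Model n μ) =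
      (t ^ τ.toPSYT.c (lo i) - t ^ τ.toPSYT.c (hi i)) • vec σ.toPSYT.exponents := by
  have swap_eq : swapAt i τ.toPSYT.exponents = σ.toPSYT.exponents := h.exponents_eq.symm
  have wt_lo : wt (σ.toPSYT.exponents (lo i)) = t ^ τ.toPSYT.c (hi i) := by
    rw [← swap_eq, swapAt_lo, wt_exponents_toPSYT]
  rw [hecke_smul_def, map_phiBar (B := Module.End K (Model n μ)), heckeRep_T, phiBar,
    LinearMap.sub_apply, Module.End.mul_apply,
    Module.End.mul_apply, thetaBar_apply _ (vec_mem_standard τ),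
    thetaBar_apply _ (tTinv_mem_standard i (vec_mem_standard τ))]
  simp only [tTinv, LinearMap.add_apply, Module.algebraMap_end_apply, T_vec, θ_vec, map_add,
    map_smul, offCoeff_of_isAscent (h.isAscent_of_lt hlt), swap_eq, wt_lo, wt_exponents_toPSYT]
  module

theorem T_vec_of_row {i : Fin (n - 1)} {τ : PSYT n μ} (hw : τ.w (lo i) = τ.w (hi i))
    (h : (τ.box (lo i)).1.1 = (τ.box (hi i)).1.1) :
    T i (vec τ.exponents : Model n μ) = vec τ.exponents := by
  rw [T_vec, PSYT.exponents_hi_of_row hw h, diagCoeff_succ_right, offCoeff_succ_right, one_smul,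
    zero_smul, add_zero]

theorem T_vec_of_col {i : Fin (n - 1)} {τ : PSYT n μ} (hw : τ.w (lo i) = τ.w (hi i))
    (h : (τ.box (lo i)).1.2 = (τ.box (hi i)).1.2) :
    T i (vec τ.exponents : Model n μ) = -t • vec τ.exponents := by
  rw [T_vec, PSYT.exponents_lo_of_col hw h, diagCoeff_succ_left, offCoeff_succ_left, zero_smul,
    add_zero]

variable (n μ) in
/-- The map from the Hecke module sending each standard tableau to its basis vector. -/
def spechtMap : Specht n μ →ₗ[Hecke n] Model n μ :=
  Submodule.liftQ _ (Finsupp.linearCombination _ fun τ : SYT n μ => vec τ.toPSYT.exponents) <|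
    Submodule.span_le.2 fun x hx => by
      cases hx with
      | theta k τ => simp [basisVec, thetaBar_smul_vec]
      | phi i τ σ h hlt => simp [basisVec, phiBar_smul_vec h hlt]
      | row i τ h => simp [basisVec, hecke_T_smul, T_vec_of_row (τ := τ.toPSYT) rfl h]
      | col i τ h => simp [basisVec, hecke_T_smul, T_vec_of_col (τ := τ.toPSYT) rfl h]

theorem spechtMap_of (τ : SYT n μ) : spechtMap n μ (Specht.of τ) = vec τ.toPSYT.exponents := by
  rw [spechtMap, Specht.of, Submodule.liftQ_apply, basisVec, Finsupp.linearCombination_single,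
    one_smul]

theorem spechtMap_mem_standard (m : Specht n μ) : spechtMap n μ m ∈ standard n μ := by
  have hm : m ∈ Submodule.span (Hecke n) (Set.range Specht.of) := Specht.span_of ▸ Submodule.mem_top
  induction hm using Submodule.span_induction with
  | mem m hm =>
    obtain ⟨τ, rfl⟩ := hm
    exact spechtMap_of τ ▸ vec_mem_standard τ
  | zero => exact map_zero (spechtMap n μ) ▸ zero_mem _
  | add m m' _ _ hm hm' => exact map_add (spechtMap n μ) m m' ▸ add_mem hm hm'
  | smul a m _ hm => exact map_smul (spechtMap n μ) a m ▸ hecke_smul_mem_standard a hm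

theorem rho_smul (a : Affine n) {v : Model n μ} (hv : v ∈ standard n μ) :
    rho n a • v = affineToDaha n a • v := by
  induction a using Presented.induction generalizing v with
  | algebraMap c => simp only [AlgHom.commutes, algebraMap_smul]
  | gen g =>
    cases g with
    | T i =>
      change rho n (Affine.T i) • v = affineToDaha n (Affine.T i) • v
      rw [rho_T, affineToDaha_T, hecke_T_smul, daha_T_smul]
    | θ k =>
      change rho n (Affine.θ k) • v = affineToDaha n (Affine.θ k) • v
      rw [rho_θ, affineToDaha_θ, thetaBar_smul k hv, daha_θ_smul]
  | mul a b ha hb =>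
    rw [map_mul, map_mul, mul_smul, mul_smul, ha (hecke_smul_mem_standard _ hv), hb hv]
  | add a b ha hb => rw [map_add, map_add, add_smul, add_smul, ha hv, hb hv]

variable (n μ) in
/-- The map from the induced module to the model given by Frobenius reciprocity. -/
def toModel : V n μ →ₗ[Daha n] Model n μ :=
  indLift ((spechtMap n μ).restrictScalars K) fun a m => by
    rw [LinearMap.restrictScalars_apply, map_smul, rho_smul a (spechtMap_mem_standard m),
      LinearMap.restrictScalars_apply]

theorem toModel_oneTmul (τ : SYT n μ) : toModel n μ (oneTmul τ) = vec τ.toPSYT.exponents :=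
  (indLift_indOne _ _ _).trans (spechtMap_of τ)

end Model

/-! ### The degree filtration -/

section Stabilizer

variable {B P : Type} [Ring B] [Algebra K B] [AddCommGroup P] [Module K P] [Module B P]
  [IsScalarTower K B P]

/-- The subalgebra of elements preserving the subspace `U`. -/
def stab (U : Submodule K P) : Subalgebra K B where
  carrier := {b | ∀ v ∈ U, b • v ∈ U}
  mul_mem' ha hb v hv := by rw [mul_smul]; exact ha _ (hb v hv)
  add_mem' ha hb v hv := by rw [add_smul]; exact add_mem (ha v hv) (hb v hv)
  algebraMap_mem' c v hv := by rw [algebraMap_smul]; exact Submodule.smul_mem _ _ hv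

theorem mem_stab_span {s : Set P} {b : B} (h : ∀ v ∈ s, b • v ∈ Submodule.span K s) :
    b ∈ stab (Submodule.span K s) := by
  suffices Submodule.span K s ≤ (Submodule.span K s).comap (Algebra.lsmul K K P b) from
    fun v hv => this hv
  exact Submodule.span_le.2 h

end Stabilizer

section Quadratic

variable {n : ℕ} {A : Type} [Ring A] [Algebra K A] {T : Fin (n - 1) → A} (hT : SatHecke T)
include hT

theorem T_mul_T (i : Fin (n - 1)) : T i * T i = (1 - t) • T i + t • 1 := by
  rw [← T_mul_tTinv hT i, tTinv, mul_add, ← Algebra.commutes, ← Algebra.smul_def]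
  module

theorem T_mul_of_eq_Tinv_mul_Tinv {i : Fin (n - 1)} {x y : A}
    (h : y = t • (Tinv T i * x * Tinv T i)) : T i * y = x * tTinv T i := by
  rw [h, mul_smul_comm, ← mul_assoc, ← mul_assoc, T_mul_Tinv hT, one_mul, Tinv, mul_smul_comm,
    smul_inv_smul₀ t_ne_zero]

theorem mul_T_of_eq_Tinv_mul_Tinv {i : Fin (n - 1)} {x y : A}
    (h : y = t • (Tinv T i * x * Tinv T i)) : y * T i = tTinv T i * x := by
  rw [h, smul_mul_assoc, mul_assoc, Tinv_mul_T hT, mul_one, Tinv, smul_mul_assoc,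
    smul_inv_smul₀ t_ne_zero]

end Quadratic

namespace Specht

variable {n : ℕ} {μ : YoungDiagram}

theorem mk_eq_zero {x : SYT n μ →₀ Hecke n} (h : SpechtRel n μ x) :
    (Submodule.Quotient.mk x : Specht n μ) = 0 :=
  (Submodule.Quotient.mk_eq_zero _).2 (Submodule.subset_span h)

theorem thetaBar_smul_of (k : Fin n) (τ : SYT n μ) :
    thetaBar Hecke.T k • of τ = wt (τ.toPSYT.exponents k) • of τ := by
  rw [Model.wt_exponents_toPSYT]
  exact sub_eq_zero.1 (mk_eq_zero (.theta k τ))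

theorem phiBar_smul_of {i : Fin (n - 1)} {τ σ : SYT n μ} (h : PSYT.IsSwap i τ.toPSYT σ.toPSYT)
    (hlt : PSYT.Lt τ.toPSYT σ.toPSYT) :
    phiBar Hecke.T i • of τ =
      (wt (τ.toPSYT.exponents (lo i)) - wt (τ.toPSYT.exponents (hi i))) • of σ := by
  rw [Model.wt_exponents_toPSYT, Model.wt_exponents_toPSYT]
  exact sub_eq_zero.1 (mk_eq_zero (.phi i τ σ h hlt))

theorem T_smul_of_row {i : Fin (n - 1)} {τ : SYT n μ}
    (h : (τ.toPSYT.box (lo i)).1.1 = (τ.toPSYT.box (hi i)).1.1) : Hecke.T i • of τ = of τ :=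
  sub_eq_zero.1 (mk_eq_zero (.row i τ h))

theorem T_smul_of_col {i : Fin (n - 1)} {τ : SYT n μ}
    (h : (τ.toPSYT.box (lo i)).1.2 = (τ.toPSYT.box (hi i)).1.2) :
    Hecke.T i • of τ = -(t • of τ) :=
  eq_neg_of_add_eq_zero_left (mk_eq_zero (.col i τ h))

theorem T_smul_of_of_isSwap {i : Fin (n - 1)} {τ σ : SYT n μ}
    (h : PSYT.IsSwap i τ.toPSYT σ.toPSYT)
    (hasc : IsAscent (τ.toPSYT.exponents (lo i)) (τ.toPSYT.exponents (hi i))) :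
    Hecke.T i • of τ =
      diagCoeff (τ.toPSYT.exponents (lo i)) (τ.toPSYT.exponents (hi i)) • of τ + of σ := by
  have hne : wt (τ.toPSYT.exponents (lo i)) - wt (τ.toPSYT.exponents (hi i)) ≠ 0 :=
    sub_ne_zero.2 (wt_injective.ne (τ.toPSYT.exponents_lo_ne_hi i))
  have thetaBar_hi := affineRel_thetaBar (satHecke_T n) (.theta_succ i)
  have key := phiBar_smul_of h (h.lt hasc)
  rw [phiBar, ← T_mul_of_eq_Tinv_mul_Tinv (satHecke_T n) thetaBar_hi, sub_smul, mul_smul, mul_smul,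
    thetaBar_smul_of, thetaBar_smul_of, smul_comm (tTinv _ _), smul_comm (Hecke.T i), tTinv,
    add_smul, algebraMap_smul] at key
  generalize Hecke.T i • of τ = v at key ⊢
  refine smul_right_injective (Specht n μ) hne ?_
  simp only [smul_add, smul_smul, diagCoeff, seminormalDiag, mul_div_cancel₀ _ hne, ← key]
  module

theorem T_smul_of_mem_span (i : Fin (n - 1)) (τ : SYT n μ) :
    Hecke.T i • of τ ∈ Submodule.span K (Set.range (of (n := n) (μ := μ))) := by
  have of_mem (σ : SYT n μ) : of σ ∈ Submodule.span K (Set.range (of (n := n) (μ := μ))) :=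
    Submodule.subset_span ⟨σ, rfl⟩
  obtain (hasc | hdesc) | ⟨-, hcov⟩ := τ.toPSYT.swappable_or_covBy i
  · obtain ⟨σ, hσ⟩ := SYT.exists_isSwap (.inl hasc)
    rw [T_smul_of_of_isSwap hσ hasc]
    exact add_mem (Submodule.smul_mem _ _ (of_mem τ)) (of_mem σ)
  · obtain ⟨σ, hσ⟩ := SYT.exists_isSwap (.inr hdesc)
    have hasc : IsAscent (σ.toPSYT.exponents (lo i)) (σ.toPSYT.exponents (hi i)) := by
      simpa [hσ.exponents_eq] using hdesc
    have of_eq := sub_eq_iff_eq_add'.2 (T_smul_of_of_isSwap hσ.symm hasc)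
    have T_mem : Hecke.T i • of σ ∈ Submodule.span K (Set.range (of (n := n) (μ := μ))) := by
      rw [T_smul_of_of_isSwap hσ.symm hasc]
      exact add_mem (Submodule.smul_mem _ _ (of_mem σ)) (of_mem τ)
    rw [← of_eq, smul_sub, smul_smul, T_mul_T (satHecke_T n), add_smul, smul_assoc, smul_assoc,
      one_smul, smul_comm (Hecke.T i)]
    exact sub_mem (add_mem (Submodule.smul_mem _ _ T_mem) (Submodule.smul_mem _ _ (of_mem σ)))
      (Submodule.smul_mem _ _ T_mem)
  · obtain ⟨hrow, -⟩ | ⟨hcol, -⟩ := cell_covBy hcov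
    · rw [T_smul_of_row hrow]
      exact of_mem τ
    · rw [T_smul_of_col hcol]
      exact neg_mem (Submodule.smul_mem _ _ (of_mem τ))

variable (n μ) in
theorem span_range_of : Submodule.span K (Set.range (of (n := n) (μ := μ))) = ⊤ := by
  have stable (a : Hecke n) : a ∈ stab (Submodule.span K (Set.range (of (n := n) (μ := μ)))) := by
    induction a using Presented.induction with
    | algebraMap c => exact Subalgebra.algebraMap_mem _ c
    | gen i => exact mem_stab_span (Set.forall_mem_range.2 (T_smul_of_mem_span i))
    | mul a b ha hb => exact mul_mem ha hb
    | add a b ha hb => exact add_mem ha hb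
  refine eq_top_iff.2 fun m _ => ?_
  have hm : m ∈ Submodule.span (Hecke n) (Set.range of) := span_of ▸ Submodule.mem_top
  induction hm using Submodule.span_induction with
  | mem m hm => exact Submodule.subset_span hm
  | zero => exact zero_mem _
  | add m m' _ _ hm hm' => exact add_mem (hm trivial) (hm' trivial)
  | smul a m _ hm => exact stable a m (hm trivial)

end Specht

namespace Daha

variable {n : ℕ}

/-- The monomial `X^s` in the commuting elements `X_k`. -/
def monomial (s : Multiset (Fin n)) : Daha n :=
  (s.map X).noncommProd fun _ hx _ hy _ => by
    obtain ⟨j, -, rfl⟩ := Multiset.mem_map.1 hx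
    obtain ⟨k, -, rfl⟩ := Multiset.mem_map.1 hy
    exact satDaha _ _ (.X_comm j k)

theorem monomial_zero : monomial (0 : Multiset (Fin n)) = 1 := rfl

theorem monomial_cons (k : Fin n) (s : Multiset (Fin n)) :
    monomial (k ::ₘ s) = X k * monomial s := by
  simp only [monomial, Multiset.map_cons, Multiset.noncommProd_cons]

end Daha

namespace V

variable {n : ℕ} {μ : YoungDiagram}

variable (n μ) in
/-- The filtration by degree in the `X_k`: the span of the vectors `X^s ⊗ τ` with `|s| ≤ d`. -/
def filt (d : ℕ) : Submodule K (V n μ) :=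
  Submodule.span K (Set.range fun x : {s : Multiset (Fin n) // s.card ≤ d} × SYT n μ =>
    Daha.monomial x.1.1 • oneTmul x.2)

theorem monomial_smul_mem_filt {s : Multiset (Fin n)} {d : ℕ} (h : s.card ≤ d) (τ : SYT n μ) :
    Daha.monomial s • oneTmul τ ∈ filt n μ d :=
  Submodule.subset_span ⟨(⟨s, h⟩, τ), rfl⟩

theorem filt_mono : Monotone (filt n μ) := fun _ _ h =>
  Submodule.span_le.2 (Set.range_subset_iff.2 fun x => monomial_smul_mem_filt (x.1.2.trans h) x.2)

theorem indOne_mem_filt (m : Specht n μ) (d : ℕ) :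
    indOne (affineToDaha n) (rho n) m ∈ filt n μ d := by
  suffices Submodule.span K (Set.range (Specht.of (n := n) (μ := μ))) ≤
      (filt n μ d).comap (indOne (affineToDaha n) (rho n)) from
    this (Specht.span_range_of n μ ▸ Submodule.mem_top)
  refine Submodule.span_le.2 (Set.range_subset_iff.2 fun τ => ?_)
  have mem := monomial_smul_mem_filt (Multiset.card_zero.trans_le d.zero_le) τ
  rwa [Daha.monomial_zero, one_smul] at mem

theorem oneTmul_mem_filt (τ : SYT n μ) (d : ℕ) : oneTmul τ ∈ filt n μ d :=
  indOne_mem_filt (Specht.of τ) d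

theorem X_smul_mem_filt (k : Fin n) {d : ℕ} {v : V n μ} (hv : v ∈ filt n μ d) :
    Daha.X k • v ∈ filt n μ (d + 1) := by
  suffices filt n μ d ≤ (filt n μ (d + 1)).comap (Algebra.lsmul K K (V n μ) (Daha.X k)) from this hv
  refine Submodule.span_le.2 (Set.range_subset_iff.2 fun ⟨⟨s, hs⟩, τ⟩ => ?_)
  change Daha.X k • Daha.monomial s • oneTmul τ ∈ filt n μ (d + 1)
  rw [smul_smul, ← Daha.monomial_cons]
  exact monomial_smul_mem_filt (by simpa using hs) τ

/-- In degree `0` the algebra `A_n` acts through `ρ_n`, so it remains to move `a` past the `X_k`. -/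
theorem affineToDaha_mem_stab_filt {a : Affine n}
    (hX : ∀ d, affineToDaha n a ∈ stab (filt n μ d) → ∀ k, ∀ v ∈ filt n μ d,
      (affineToDaha n a * Daha.X k) • v ∈ filt n μ (d + 1)) (d : ℕ) :
    affineToDaha n a ∈ stab (filt n μ d) := by
  have smul_oneTmul_mem (d : ℕ) (τ : SYT n μ) : affineToDaha n a • oneTmul τ ∈ filt n μ d := by
    change affineToDaha n a • indOne (affineToDaha n) (rho n) (Specht.of τ) ∈ _
    rw [map_smul_indOne]
    exact indOne_mem_filt _ d
  induction d with
  | zero =>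
    refine mem_stab_span (Set.forall_mem_range.2 fun ⟨⟨s, hs⟩, τ⟩ => ?_)
    obtain rfl := Multiset.card_eq_zero.1 (Nat.le_zero.1 hs)
    rw [Daha.monomial_zero, one_smul]
    exact smul_oneTmul_mem 0 τ
  | succ d ih =>
    refine mem_stab_span (Set.forall_mem_range.2 fun ⟨⟨s, hs⟩, τ⟩ => ?_)
    induction s using Multiset.induction_on with
    | empty =>
      rw [Daha.monomial_zero, one_smul]
      exact smul_oneTmul_mem (d + 1) τ
    | cons k s _ =>
      rw [Daha.monomial_cons, mul_smul, smul_smul]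
      exact hX d ih k _ (monomial_smul_mem_filt (by simpa using hs) τ)

theorem T_mem_stab_filt (i : Fin (n - 1)) (d : ℕ) : Daha.T i ∈ stab (filt n μ d) := by
  rw [← affineToDaha_T]
  refine affineToDaha_mem_stab_filt (fun d hd k v hv => ?_) d
  rw [affineToDaha_T] at hd ⊢
  have X_hi : (Daha.X (hi i) : Daha n) = _ := Daha.satDaha _ _ (.X_succ i)
  by_cases hlo : k = lo i
  · have T_mul_X : Daha.T i * Daha.X (lo i) =
        Daha.X (hi i) * Daha.T i - (t - 1) • Daha.X (lo i) := by
      rw [mul_T_of_eq_Tinv_mul_Tinv Daha.satDaha.satAffine.satHecke X_hi, tTinv, add_mul,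
        ← Algebra.smul_def, add_sub_cancel_right]
    rw [hlo, T_mul_X, sub_smul, mul_smul, smul_assoc]
    exact sub_mem (X_smul_mem_filt _ (hd v hv)) (Submodule.smul_mem _ _ (X_smul_mem_filt _ hv))
  by_cases hhi : k = hi i
  · have tTinv_mem : tTinv Daha.T i ∈ stab (filt n μ d) :=
      add_mem hd (Subalgebra.algebraMap_mem _ _)
    rw [hhi, T_mul_of_eq_Tinv_mul_Tinv Daha.satDaha.satAffine.satHecke X_hi, mul_smul]
    exact X_smul_mem_filt _ (tTinv_mem v hv)
  · rw [Daha.satDaha _ _ (.T_X i k hlo hhi), mul_smul]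
    exact X_smul_mem_filt _ (hd v hv)

theorem Tinv_mem_stab_filt (i : Fin (n - 1)) (d : ℕ) : Tinv Daha.T i ∈ stab (filt n μ d) :=
  Subalgebra.smul_mem _ (add_mem (T_mem_stab_filt i d) (Subalgebra.algebraMap_mem _ _)) _

theorem pi_mem_stab_filt (hn : 0 < n) (d : ℕ) : Daha.pi hn ∈ stab (filt n μ d) := by
  have pi_eq : affineToDaha n (piElt Affine.T Affine.θ hn) = Daha.pi hn := by
    rw [map_piElt]
    simp only [affineToDaha_T, affineToDaha_θ, Daha.pi]
  rw [← pi_eq]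
  refine affineToDaha_mem_stab_filt (fun d hd k v hv => ?_) d
  rw [pi_eq] at hd ⊢
  by_cases hk : k.1 + 1 < n
  · have pi_mul_X : Daha.pi hn * Daha.X k = Daha.X (hi ⟨k.1, by omega⟩) * Daha.pi hn :=
      Daha.satDaha _ _ (.pi_X hn ⟨k.1, by omega⟩)
    rw [pi_mul_X, mul_smul]
    exact X_smul_mem_filt _ (hd v hv)
  · have pi_mul_X : Daha.pi hn * Daha.X k = q • (Daha.X ⟨0, hn⟩ * Daha.pi hn) := by
      rw [show k = ⟨n - 1, by omega⟩ from Fin.ext (show k.1 = n - 1 by omega)]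
      exact Daha.satDaha _ _ (.pi_X_last hn)
    rw [pi_mul_X, smul_assoc, mul_smul]
    exact Submodule.smul_mem _ _ (X_smul_mem_filt _ (hd v hv))

theorem θ_mem_stab_filt (k : Fin n) (d : ℕ) : Daha.θ k ∈ stab (filt n μ d) := by
  have hn : 0 < n := k.pos
  let D := (Daha.satDaha (n := n)).satAffine.braidFamily hn
  have T_mem (j : ℕ) (hj : j < n - 1) : D.T j ∈ (stab (filt n μ d)).toSubmonoid.units := by
    rw [show D.T j = _ from SatAffine.braidFamily_T _ hn ⟨j, hj⟩, Submonoid.mem_units_iff]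
    exact ⟨T_mem_stab_filt ⟨j, hj⟩ d, Tinv_mem_stab_filt ⟨j, hj⟩ d⟩
  have pi_mem : D.pi ∈ stab (filt n μ d) := by
    rw [SatAffine.braidFamily_pi]
    exact pi_mem_stab_filt hn d
  rw [← SatAffine.braidFamily_θ Daha.satDaha.satAffine hn]
  exact D.theta_mem T_mem pi_mem (by omega)

theorem exists_mem_filt (v : V n μ) : ∃ d, v ∈ filt n μ d := by
  have mem_iSup {v : V n μ} : v ∈ ⨆ d, filt n μ d ↔ ∃ d, v ∈ filt n μ d :=
    Submodule.mem_iSup_of_directed _ filt_mono.directed_le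
  have stable (b : Daha n) : b ∈ stab (⨆ d, filt n μ d) := by
    induction b using Presented.induction with
    | algebraMap c => exact Subalgebra.algebraMap_mem _ c
    | gen g =>
      intro v hv
      obtain ⟨d, hd⟩ := mem_iSup.1 hv
      cases g with
      | T i => exact mem_iSup.2 ⟨d, T_mem_stab_filt i d v hd⟩
      | θ k => exact mem_iSup.2 ⟨d, θ_mem_stab_filt k d v hd⟩
      | X k => exact mem_iSup.2 ⟨d + 1, X_smul_mem_filt k hd⟩
    | mul a b ha hb => exact mul_mem ha hb
    | add a b ha hb => exact add_mem ha hb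
  have hv : v ∈ Submodule.span (Daha n) (Set.range (indOne (affineToDaha n) (rho n))) := by
    rw [span_indOne]
    exact Submodule.mem_top
  rw [← mem_iSup]
  induction hv using Submodule.span_induction with
  | mem v hv =>
    obtain ⟨m, rfl⟩ := hv
    exact mem_iSup.2 ⟨0, indOne_mem_filt m 0⟩
  | zero => exact zero_mem _
  | add v v' _ _ hv hv' => exact add_mem hv hv'
  | smul b v _ hv => exact stable b v hv

end V

/-! ### The isomorphism with the model -/

theorem disjoint_span_ker_of_linearIndependent {R V W I J : Type*} [Field R] [AddCommGroup V]
    [Module R V] [AddCommGroup W] [Module R W] [Finite J] {f : V →ₗ[R] W} {v : I → V} {w : J → W}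
    {e : I → J} (he : Function.Injective e) (hw : LinearIndependent R w)
    (h : ∀ j, w j ∈ (Submodule.span R (Set.range v)).map f) :
    Disjoint (Submodule.span R (Set.range v)) (LinearMap.ker f) := by
  have := Fintype.ofFinite J
  have := Fintype.ofInjective e he
  refine Submodule.range_ker_disjoint (linearIndependent_iff_card_le_finrank_span.2 ?_)
  have span_le : Submodule.span R (Set.range w) ≤ Submodule.span R (Set.range (f ∘ v)) := by
    rw [Set.range_comp, ← Submodule.map_span]
    exact Submodule.span_le.2 (Set.range_subset_iff.2 h)
  calc Fintype.card I ≤ Fintype.card J := Fintype.card_le_of_injective e he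
    _ = Module.finrank R (Submodule.span R (Set.range w)) := (finrank_span_eq_card hw).symm
    _ ≤ (Set.range (f ∘ v)).finrank R := by
      have := FiniteDimensional.span_of_finite R (Set.finite_range (f ∘ v))
      exact Submodule.finrank_mono span_le

namespace PSYT

variable {n : ℕ} {μ : YoungDiagram}

theorem w_le_deg (τ : PSYT n μ) (i : Fin n) : τ.w i ≤ τ.deg :=
  Finset.single_le_sum (fun _ _ => Nat.zero_le _) (Finset.mem_univ i)

theorem finite_deg_le (d : ℕ) : Finite {τ : PSYT n μ // τ.deg ≤ d} := by
  have label_le (τ : PSYT n μ) (h : τ.deg ≤ d) (b : μ.cells) : (τ.label b).2 < d + 1 := by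
    rw [← w_label]
    exact Nat.lt_succ_of_le ((τ.w_le_deg _).trans h)
  let labels : {τ : PSYT n μ // τ.deg ≤ d} → μ.cells → Fin n × Fin (d + 1) := fun τ b =>
    ((τ.1.label b).1, ⟨(τ.1.label b).2, label_le τ.1 τ.2 b⟩)
  refine Finite.of_injective labels fun τ σ h => Subtype.ext (PSYT.ext (funext fun b => ?_))
  exact Prod.ext (congrArg (fun f => (f b).1) h) (congrArg (fun f => (f b).2.1) h)

end PSYT

namespace SYT

variable {n : ℕ} {μ : YoungDiagram}

theorem deg_inflate_count (τ : SYT n μ) (s : Multiset (Fin n)) :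
    (τ.inflate s.count).deg = s.card := by
  rw [PSYT.deg, w_inflate, Multiset.sum_count_eq_card fun _ _ => Finset.mem_univ _]

theorem inflate_count_injective :
    Function.Injective fun x : Multiset (Fin n) × SYT n μ => x.2.inflate x.1.count :=
  fun _ _ h => Prod.ext (Multiset.ext.2 (congrFun (inflate_injective h).1)) (inflate_injective h).2

end SYT

namespace Model

variable {n : ℕ} {μ : YoungDiagram}

variable (n μ) in
/-- The image in the model of the part of `V n μ` of degree at most `d`. -/
def image (d : ℕ) : Submodule K (Model n μ) :=
  (V.filt n μ d).map ((toModel n μ).restrictScalars K)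

theorem vec_toPSYT_mem_image (τ : SYT n μ) (d : ℕ) : vec τ.toPSYT.exponents ∈ image n μ d :=
  ⟨oneTmul τ, V.oneTmul_mem_filt τ d, toModel_oneTmul τ⟩

theorem dahaRep_mem_stab_image {b : Daha n} {d : ℕ} (hb : b ∈ stab (V.filt n μ d)) :
    dahaRep n μ b ∈ stab (image n μ d) := by
  rintro _ ⟨v, hv, rfl⟩
  exact ⟨b • v, hb v hv, map_smul (toModel n μ) b v⟩

theorem T_mem_stab_image (i : Fin (n - 1)) (d : ℕ) :
    (T i : Module.End K (Model n μ)) ∈ stab (image n μ d) :=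
  dahaRep_T (μ := μ) i ▸ dahaRep_mem_stab_image (V.T_mem_stab_filt i d)

theorem Tinv_mem_stab_image (i : Fin (n - 1)) (d : ℕ) :
    Tinv (T : Fin (n - 1) → Module.End K (Model n μ)) i ∈ stab (image n μ d) :=
  Subalgebra.smul_mem _ (add_mem (T_mem_stab_image i d) (Subalgebra.algebraMap_mem _ _)) _

theorem X_apply_mem_image (k : Fin n) {d : ℕ} {v : Model n μ} (hv : v ∈ image n μ d) :
    X k v ∈ image n μ (d + 1) := by
  obtain ⟨v, hv, rfl⟩ := hv
  exact ⟨Daha.X k • v, V.X_smul_mem_filt k hv, by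
    rw [LinearMap.restrictScalars_apply, map_smul, daha_X_smul, LinearMap.restrictScalars_apply]⟩

/-- Since `X_0 = T_0 ⋯ T_{n-2} Y θ_0`, the operator `Y θ_0` raises the degree by one like `X_0`. -/
theorem Y_θ_mem_image (hn : 0 < n) {d : ℕ} {v : Model n μ} (hv : v ∈ image n μ d) :
    Y hn (θ ⟨0, hn⟩ v) ∈ image n μ (d + 1) := by
  let D := (satAffine (n := n) (μ := μ)).braidFamily hn
  have segment_mem : segment D.T 0 (n - 1) ∈ (stab (image n μ (d + 1))).toSubmonoid.units :=
    Subgroup.list_prod_mem _ fun x hx => by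
      obtain ⟨k, rfl⟩ := List.mem_ofFn.1 hx
      rw [zero_add, show D.T k = _ from satAffine.braidFamily_T hn k, Submonoid.mem_units_iff]
      exact ⟨T_mem_stab_image k _, Tinv_mem_stab_image k _⟩
  have Y_θ : (Y hn * θ ⟨0, hn⟩ : Module.End K (Model n μ)) =
      (↑(segment D.T 0 (n - 1))⁻¹ : Module.End K (Model n μ)) * X ⟨0, hn⟩ := by
    rw [X, ShiftLift.X_zero, mul_assoc, Units.inv_mul_cancel_left]
    exact congrArg (Y hn * ·) (satAffine.braidFamily_θ hn ⟨0, hn⟩).symm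
  rw [← Module.End.mul_apply, Y_θ]
  exact (inv_mem segment_mem).1 _ (X_apply_mem_image ⟨0, hn⟩ hv)

theorem vec_Psi_mem_image (hn : 0 < n) {d : ℕ} {τ : PSYT n μ}
    (h : vec τ.exponents ∈ image n μ d) : vec τ.Psi.exponents ∈ image n μ (d + 1) := by
  have hY := Y_θ_mem_image hn h
  rw [θ_vec, map_smul, Y_vec, ← PSYT.exponents_Psi, smul_smul] at hY
  exact (Submodule.smul_mem_iff _
    (mul_ne_zero (wt_ne_zero _) (inv_ne_zero (pow_ne_zero _ q_ne_zero)))).1 hY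

theorem T_vec_of_isSwap {i : Fin (n - 1)} {τ σ : PSYT n μ} (h : PSYT.IsSwap i τ σ)
    (hasc : IsAscent (τ.exponents (lo i)) (τ.exponents (hi i))) :
    T i (vec τ.exponents : Model n μ) =
      diagCoeff (τ.exponents (lo i)) (τ.exponents (hi i)) • vec τ.exponents + vec σ.exponents := by
  rw [T_vec, offCoeff_of_isAscent hasc, one_smul, h.exponents_eq]
  rfl

theorem vec_mem_image (τ : PSYT n μ) : vec τ.exponents ∈ image n μ τ.deg := by
  induction τ using PSYT.induction_swap_Psi with
  | standard σ => exact vec_toPSYT_mem_image σ _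
  | swap i τ σ h hasc ih =>
    rw [h.deg_eq, ← sub_eq_iff_eq_add'.2 (T_vec_of_isSwap h hasc)]
    exact sub_mem (T_mem_stab_image i _ _ ih) (Submodule.smul_mem _ _ ih)
  | Psi hn τ ih =>
    rw [PSYT.deg_Psi hn]
    exact vec_Psi_mem_image hn ih

theorem image_mono : Monotone (image n μ) := fun _ _ h => Submodule.map_mono (V.filt_mono h)

theorem linearIndependent_vec :
    LinearIndependent K fun τ : PSYT n μ => (vec τ.exponents : Model n μ) := by
  simp only [vec_exponents]
  exact Finsupp.basisSingleOne.linearIndependent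

theorem toModel_injective : Function.Injective (toModel n μ) := by
  refine (injective_iff_map_eq_zero _).2 fun v hv => ?_
  obtain ⟨d, hd⟩ := V.exists_mem_filt v
  have := PSYT.finite_deg_le (n := n) (μ := μ) d
  let inflate : {s : Multiset (Fin n) // s.card ≤ d} × SYT n μ → {τ : PSYT n μ // τ.deg ≤ d} :=
    fun x => ⟨x.2.inflate x.1.1.count, (x.2.deg_inflate_count x.1.1).trans_le x.1.2⟩
  have inflate_injective : Function.Injective inflate := fun _ _ h =>
    Subtype.val_injective.prodMap Function.injective_id <|
      SYT.inflate_count_injective (congrArg Subtype.val h)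
  have disjoint := disjoint_span_ker_of_linearIndependent inflate_injective
    (linearIndependent_vec.comp _ Subtype.val_injective)
    fun τ => image_mono τ.2 (vec_mem_image τ.1)
  exact Submodule.disjoint_def.1 disjoint v hd hv

theorem toModel_surjective : Function.Surjective (toModel n μ) := by
  suffices LinearMap.range ((toModel n μ).restrictScalars K) = ⊤ from
    LinearMap.range_eq_top (f := (toModel n μ).restrictScalars K).1 this
  rw [eq_top_iff, ← Finsupp.basisSingleOne.span_eq, Submodule.span_le, Set.range_subset_iff]
  intro τ
  obtain ⟨v, -, hv⟩ := vec_mem_image τ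
  exact ⟨v, hv.trans (vec_exponents τ)⟩

variable (n μ) in
/-- The identification of the induced module with the model. -/
def equiv : V n μ ≃ₗ[Daha n] Model n μ :=
  LinearEquiv.ofBijective (toModel n μ) ⟨toModel_injective, toModel_surjective⟩

variable (hn : 0 < n)

theorem equiv_smul (c : K) (v : V n μ) : equiv n μ (c • v) = c • equiv n μ v :=
  (toModel n μ).map_smul_of_tower c v

theorem dahaRep_pi : dahaRep n μ (Daha.pi hn) = (satAffine.braidFamily hn).pi := by
  rw [Daha.pi, map_piElt (B := Module.End K (Model n μ)), SatAffine.braidFamily_pi]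
  simp only [dahaRep_T, dahaRep_θ]

theorem isUnit_dahaRep_pi : IsUnit (dahaRep n μ (Daha.pi hn)) := by
  rw [dahaRep_pi]
  exact AffineBraidFamily.isUnit_pi _ (shiftLift n μ hn).isUnit_theta

theorem X_last_smul (v : Model n μ) :
    (Daha.X ⟨n - 1, Nat.sub_lt hn Nat.one_pos⟩ : Daha n) • v = Y hn (Daha.pi hn • v) := by
  rw [daha_X_smul, X, ShiftLift.X_last, daha_smul_def, dahaRep_pi]
  rfl

end Model

namespace V

variable {n : ℕ} {μ : YoungDiagram}

variable (n μ) in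
/-- The basis `F_τ` of weight vectors, corresponding to the standard basis of the model. -/
def eigenbasis : Module.Basis (PSYT n μ) K (V n μ) :=
  Finsupp.basisSingleOne.map ((Model.equiv n μ).symm.restrictScalars K)

theorem equiv_eigenbasis (τ : PSYT n μ) :
    Model.equiv n μ (eigenbasis n μ τ) = Model.vec τ.exponents := by
  rw [Model.vec_exponents, eigenbasis, Module.Basis.map_apply]
  exact (Model.equiv n μ).apply_symm_apply _

theorem θ_smul_eigenbasis (τ : PSYT n μ) (i : Fin n) :
    Daha.θ i • eigenbasis n μ τ = wt (τ.exponents i) • eigenbasis n μ τ := by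
  apply (Model.equiv n μ).injective
  rw [map_smul, Model.equiv_smul, equiv_eigenbasis, Model.daha_θ_smul, Model.θ_vec]

theorem eigenbasis_toPSYT (τ : SYT n μ) : eigenbasis n μ τ.toPSYT = oneTmul τ :=
  (Model.equiv n μ).injective ((equiv_eigenbasis _).trans (Model.toModel_oneTmul τ).symm)

theorem tTinv_smul_eigenbasis {i : Fin (n - 1)} {τ σ : PSYT n μ} (h : PSYT.IsSwap i τ σ)
    (hasc : IsAscent (τ.exponents (lo i)) (τ.exponents (hi i))) :
    Daha.tTinv i • eigenbasis n μ τ +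
      diagCoeff (τ.exponents (hi i)) (τ.exponents (lo i)) • eigenbasis n μ τ =
        eigenbasis n μ σ := by
  apply (Model.equiv n μ).injective
  rw [map_add, map_smul, Model.equiv_smul, equiv_eigenbasis, equiv_eigenbasis,
    Daha.tTinv, tTinv, add_smul, algebraMap_smul, Model.daha_T_smul, Model.T_vec_of_isSwap h hasc]
  linear_combination (norm := module)
    diagCoeff_add (τ.exponents_lo_ne_hi i) • Model.vec τ.exponents

theorem pi_smul_bijective (hn : 0 < n) :
    Function.Bijective (Algebra.lsmul K K (V n μ) (Daha.pi hn)) := by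
  have pi_smul_eq : ⇑(Algebra.lsmul K K (V n μ) (Daha.pi hn)) =
      (Model.equiv n μ).symm ∘ Model.dahaRep n μ (Daha.pi hn) ∘ Model.equiv n μ := by
    funext v
    rw [Function.comp_apply, Function.comp_apply, ← Model.daha_smul_def, ← map_smul,
      LinearEquiv.symm_apply_apply]
    rfl
  rw [pi_smul_eq]
  have bijective := (Module.End.isUnit_iff _).1 (Model.isUnit_dahaRep_pi (μ := μ) hn)
  exact (Model.equiv n μ).symm.bijective.comp (bijective.comp (Model.equiv n μ).bijective)

/-- The invertible action of `π_n`. -/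
def piEquiv (hn : 0 < n) : V n μ ≃ₗ[K] V n μ :=
  LinearEquiv.ofBijective (Algebra.lsmul K K (V n μ) (Daha.pi hn)) (pi_smul_bijective hn)

theorem piEquiv_apply (hn : 0 < n) (v : V n μ) : piEquiv hn v = Daha.pi hn • v := rfl

theorem eigenbasis_Psi (hn : 0 < n) (τ : PSYT n μ) :
    eigenbasis n μ τ.Psi = q ^ τ.w ⟨0, hn⟩ •
      (Daha.X ⟨n - 1, Nat.sub_lt hn Nat.one_pos⟩ • (piEquiv hn).symm (eigenbasis n μ τ)) := by
  apply (Model.equiv n μ).injective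
  rw [Model.equiv_smul, map_smul, Model.X_last_smul, ← map_smul (Model.equiv n μ), ← piEquiv_apply,
    LinearEquiv.apply_symm_apply, equiv_eigenbasis, equiv_eigenbasis, Model.Y_vec,
    PSYT.exponents_Psi]
  exact (smul_inv_smul₀ (pow_ne_zero _ q_ne_zero) _).symm

end V

end

end VVMac

theorem mainTheorem9 (n : ℕ) (μ : YoungDiagram) (hμ : μ.card = n) :
    ∃ F : Module.Basis (VVMac.PSYT n μ) VVMac.K (VVMac.V n μ),
      -- weight vectors with the given weights
      (∀ (τ : VVMac.PSYT n μ) (i : Fin n),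
        VVMac.Daha.θ i • F τ = (VVMac.q ^ τ.w i * VVMac.t ^ τ.c i) • F τ) ∧
      -- distinct tableaux have distinct weights
      Function.Injective (fun (τ : VVMac.PSYT n μ) (i : Fin n) =>
        VVMac.q ^ τ.w i * VVMac.t ^ τ.c i) ∧
      -- normalization on standard tableaux
      (∀ τ : VVMac.SYT n μ, F τ.toPSYT = VVMac.oneTmul τ) ∧
      -- intertwiner relations
      (∀ (i : Fin (n - 1)) (τ σ : VVMac.PSYT n μ), VVMac.PSYT.IsSwap i τ σ →
        VVMac.PSYT.Lt τ σ →
        VVMac.Daha.tTinv i • F τ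
          + ((VVMac.t - 1) * τ.weight (VVMac.hi i) /
              (τ.weight (VVMac.lo i) - τ.weight (VVMac.hi i))) • F τ = F σ) ∧
      -- `π_n` acts invertibly, and the shift relation holds
      (∀ hn : 0 < n, ∃ P : VVMac.V n μ ≃ₗ[VVMac.K] VVMac.V n μ,
        (∀ v, P v = VVMac.Daha.pi hn • v) ∧
        ∀ τ : VVMac.PSYT n μ,
          F τ.Psi = VVMac.q ^ τ.w ⟨0, hn⟩ •
            (VVMac.Daha.X ⟨n - 1, Nat.sub_lt hn Nat.one_pos⟩ • P.symm (F τ))) := by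
  refine ⟨VVMac.V.eigenbasis n μ, VVMac.V.θ_smul_eigenbasis, fun τ σ h => ?_,
    VVMac.V.eigenbasis_toPSYT, fun i τ σ h hlt => ?_, fun hn => ?_⟩
  · exact VVMac.PSYT.exponents_injective
      (funext fun i => VVMac.wt_injective (congrFun h i))
  · rw [← neg_div_neg_eq, ← neg_mul, neg_sub, neg_sub]
    exact VVMac.V.tTinv_smul_eigenbasis h (h.isAscent_of_lt hlt)
  · exact ⟨VVMac.V.piEquiv hn, VVMac.V.piEquiv_apply hn, VVMac.V.eigenbasis_Psi hn⟩
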